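/- **Setting.** Let $q\ge 2$, $\mathcal Q=\mathbb Z/q\mathbb Z$, and let $\mathcal Y_3$ be a finite set. A memoryless multiple-access/degraded-broadcast two-way channel (MA/DB TWC) has three users with input alphabets $\mathcal X_1=\mathcal X_2=\mathcal X_3=\mathcal Q$ and output alphabets $\mathcal Y_1=\mathcal Y_2=\mathcal Q$ and $\mathcal Y_3$. It is given by transition probabilities $P_{Y_3|X_1,X_2,X_3}$ and two noise distributions $P_{Z_1},P_{Z_2}$ on $\mathcal Q$. In each channel use, $Y_1=X_1\oplus_q X_3\oplus_q Z_1$, $Y_2=X_2\oplus_q X_3\oplus_q Z_1\oplus_q Z_2$, and $Y_3$ is drawn from $P_{Y_3|X_1,X_2,X_3}$; given the inputs, $Y_3,Z_1,Z_2$ are independent, and the channel is memoryless. *Codes.* For nonnegative rates, an $(n,R_{13},R_{23},R_{31},R_{32})$ code has message sets of sizes $2^{nR_{13}},2^{nR_{23}},2^{nR_{31}},2^{nR_{32}}$ (rounded up), encoders $X_{1,i}=f_{1,i}(M_{13},Y_1^{i-1})$, $X_{2,i}=f_{2,i}(M_{23},Y_2^{i-1})$, $X_{3,i}=f_{3,i}(M_{31},M_{32},Y_3^{i-1})$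 for $1\le i\le n$, and decoders $\hat M_{31}=g_1(M_{13},Y_1^n)$, $\hat M_{32}=g_2(M_{23},Y_2^n)$, $(\hat M_{13},\hat M_{23})=g_3(M_{31},M_{32},Y_3^n)$. The four messages are independent and uniformly distributed. A rate quadruple $(R_{13},R_{23},R_{31},R_{32})$ is achievable if there is a sequence of such codes, $n=1,2,\dots$, for which the probability that at least one of the four messages is decoded wrongly tends to $0$. The capacity region $\mathcal C$ is the closure of the convex hull of the set of achievable quadruples. *Bounds.* Mutual informations are in bits. For a distribution $P_{X_1,X_2,X_3,V}$, where $V$ is an auxiliary variable whose alphabet has at most $q+1$ elements, let $\mathcal R(P_{X_1,X_2,X_3,V})$ be the set of nonnegative quadruples with $$R_{13}\le I(X_1;Y_3|X_2,X_3),\quad R_{23}\le I(X_2;Y_3|X_1,X_3),\quad R_{13}+R_{23}\le I(X_1,X_2;Y_3|X_3),$$ $$R_{31}\le I(X_3;X_3\oplus_q Z_1|V),\qquad R_{32}\le I(V;X_3\oplus_q Z_1\oplus_q Z_2),$$ evaluated under $P_{X_1,X_2,X_3,V}\cdot P_{Y_3|X_1,X_2,X_3}\cdot P_{Z_1}\cdot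 P_{Z_2}$. Let $\overline{\mathrm{co}}$ denote the closure of the convex hull. The inner bound $\mathcal C_{\mathrm I}$ is $\overline{\mathrm{co}}$ of the union of $\mathcal R(P_{X_1}\cdot P_{X_2}\cdot P_{V,X_3})$ over all $P_{X_1},P_{X_2},P_{V,X_3}$, and the outer bound $\mathcal C_{\mathrm O}$ is $\overline{\mathrm{co}}$ of the union of $\mathcal R(P_{X_1,X_2,X_3,V})$ over all $P_{X_1,X_2,X_3,V}$. Write $\mathcal I(P_X,P_{Y|X})$ for the mutual information between the input, of law $P_X$, and the output of the channel $P_{Y|X}$. **Theorem.** Suppose that there is a distribution $P^*_{X_1}$ on $\mathcal X_1$ such that: (i) for all $x_2,x_3$, $P^*_{X_1}$ maximizes $P\mapsto \mathcal I(P,P_{Y_3|X_1,X_2=x_2,X_3=x_3})$ over all distributions $P$ on $\mathcal X_1$, and for every fixed $x_3$ the value $\mathcal I(P^*_{X_1},P_{Y_3|X_1,X_2=x_2,X_3=x_3})$ does not depend on $x_2$; (ii) for every distribution $P_{X_2}$ on $\mathcal X_2$, $\mathcal I(P_{X_2},P_{Y_3|X_1=x_1,X_2,X_3=x_3})$ does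 not depend on $x_1$ and $x_3$; (iii) for every distribution $P_{X_1,X_2}$ on $\mathcal X_1\times\mathcal X_2$, with $X_2$-marginal $P_{X_2}$, $\mathcal I(P_{X_1,X_2},P_{Y_3|X_1,X_2,X_3=x_3})$ does not depend on $x_3$, and for each $x_3$ $$\mathcal I(P_{X_1,X_2},P_{Y_3|X_1,X_2,X_3=x_3})\le \mathcal I(P^*_{X_1}\cdot P_{X_2},P_{Y_3|X_1,X_2,X_3=x_3}).$$ Then the inner and outer bounds coincide and give the capacity region, $\mathcal C=\mathcal C_{\mathrm I}=\mathcal C_{\mathrm O}$, and $$\mathcal C=\overline{\mathrm{co}}\Bigg(\bigcup_{P_{X_2},\,P_{V,X_3}}\mathcal R\big(P^*_{X_1}\cdot P_{X_2}\cdot P_{V,X_3}\big)\Bigg).$$ -/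

import Mathlib

/-! Finite-alphabet information measures. A probability mass function on a finite type `α` is an
element of `stdSimplex ℝ α`. All logarithms are to base two. -/

open Classical in
/-- The law of the random variable `f` when the underlying finite space carries the pmf `p`:
`pmfLaw p f a = Pr(f = a)`. -/
noncomputable def pmfLaw {Ω A : Type*} [Fintype Ω] (p : Ω → ℝ) (f : Ω → A) (a : A) : ℝ :=
  ∑ ω with f ω = a, p ω

/-- The mutual information `I(A; B)` of two finite random variables, in bits. -/
noncomputable def mutualInfo {Ω A B : Type*} [Fintype Ω] [Fintype A] [Fintype B]
    (p : Ω → ℝ) (X : Ω → A) (Y : Ω → B) : ℝ :=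
  ∑ a, ∑ b, pmfLaw p (fun ω => (X ω, Y ω)) (a, b) *
    Real.logb 2 (pmfLaw p (fun ω => (X ω, Y ω)) (a, b) / (pmfLaw p X a * pmfLaw p Y b))

/-- The conditional mutual information `I(A; B | C)` of finite random variables, in bits. -/
noncomputable def condMutualInfo {Ω A B C : Type*} [Fintype Ω] [Fintype A] [Fintype B] [Fintype C]
    (p : Ω → ℝ) (X : Ω → A) (Y : Ω → B) (Z : Ω → C) : ℝ :=
  ∑ a, ∑ b, ∑ c, pmfLaw p (fun ω => (X ω, Y ω, Z ω)) (a, b, c) *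
    Real.logb 2 (pmfLaw p (fun ω => (X ω, Y ω, Z ω)) (a, b, c) * pmfLaw p Z c /
      (pmfLaw p (fun ω => (X ω, Z ω)) (a, c) * pmfLaw p (fun ω => (Y ω, Z ω)) (b, c)))

/-- The mutual information between the input, of law `P`, and the output of a one-way channel with
transition probabilities `K x y = P(y | x)`, in bits. -/
noncomputable def channelInfo {A B : Type*} [Fintype A] [Fintype B]
    (P : A → ℝ) (K : A → B → ℝ) : ℝ :=
  ∑ x, ∑ y, P x * K x y * Real.logb 2 (K x y / ∑ x', P x' * K x' y)

/-- A memoryless multiple access / degraded broadcast two-way channel: all input alphabets and the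
output alphabets of users 1 and 2 are `ZMod q`, user 3 has the output alphabet `𝒴`.
`mac x₁ x₂ x₃ y₃` is the probability of `y₃` given the inputs, `noise₁` and `noise₂` are the laws
of the additive noises. -/
structure MADBChannel (q : ℕ) [NeZero q] (𝒴 : Type*) [Fintype 𝒴] where
  mac : ZMod q → ZMod q → ZMod q → 𝒴 → ℝ
  noise₁ : ZMod q → ℝ
  noise₂ : ZMod q → ℝ
  mac_mem : ∀ x₁ x₂ x₃, mac x₁ x₂ x₃ ∈ stdSimplex ℝ 𝒴
  noise₁_mem : noise₁ ∈ stdSimplex ℝ (ZMod q)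
  noise₂_mem : noise₂ ∈ stdSimplex ℝ (ZMod q)

/-- A code of block length `n` with `k₁₃`, `k₂₃`, `k₃₁`, `k₃₂` messages. The channel input of a user
at time `i` depends on the messages of that user and on the channel outputs which that user has
received at the earlier times. -/
structure MADBCode (q : ℕ) (𝒴 : Type*) (n k₁₃ k₂₃ k₃₁ k₃₂ : ℕ) where
  enc₁ : (i : Fin n) → Fin k₁₃ → (Fin (i : ℕ) → ZMod q) → ZMod q
  enc₂ : (i : Fin n) → Fin k₂₃ → (Fin (i : ℕ) → ZMod q) → ZMod q
  enc₃ : (i : Fin n) → Fin k₃₁ → Fin k₃₂ → (Fin (i : ℕ) → 𝒴) → ZMod q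
  dec₁ : Fin k₁₃ → (Fin n → ZMod q) → Fin k₃₁
  dec₂ : Fin k₂₃ → (Fin n → ZMod q) → Fin k₃₂
  dec₃ : Fin k₃₁ → Fin k₃₂ → (Fin n → 𝒴) → Fin k₁₃ × Fin k₂₃

/-- The symbols of the sequence `y` strictly before time `i`. -/
def pastOf {α : Type*} {n : ℕ} (y : Fin n → α) (i : Fin n) : Fin (i : ℕ) → α :=
  fun j => y (Fin.castLE i.isLt.le j)

/-- The number of messages at rate `R` and block length `n`: `2 ^ (n R)`, rounded up. -/
noncomputable def numMessages (n : ℕ) (R : ℝ) : ℕ := ⌈(2 : ℝ) ^ ((n : ℝ) * R)⌉₊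

namespace MADBChannel

variable {q : ℕ} [NeZero q] {𝒴 : Type*} [Fintype 𝒴]

/-- The probability of the outputs `(y₁, y₂, y₃)` given the inputs in one channel use, where
`y₁ = x₁ + x₃ + z₁` and `y₂ = x₂ + x₃ + z₁ + z₂` modulo `q`, and `y₃` is independent of the noises
given the inputs. -/
def transition (W : MADBChannel q 𝒴) (x₁ x₂ x₃ y₁ y₂ : ZMod q) (y₃ : 𝒴) : ℝ :=
  W.mac x₁ x₂ x₃ y₃ * W.noise₁ (y₁ - x₁ - x₃) * W.noise₂ (y₂ - x₂ - y₁ + x₁)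

/-- The probability that the three users receive the sequences `y₁`, `y₂`, `y₃` when the messages
`m₁₃`, `m₂₃`, `m₃₁`, `m₃₂` are sent with a given code. -/
noncomputable def outputProb (W : MADBChannel q 𝒴) {n k₁₃ k₂₃ k₃₁ k₃₂ : ℕ}
    (c : MADBCode q 𝒴 n k₁₃ k₂₃ k₃₁ k₃₂) (m₁₃ : Fin k₁₃) (m₂₃ : Fin k₂₃) (m₃₁ : Fin k₃₁)
    (m₃₂ : Fin k₃₂) (y₁ y₂ : Fin n → ZMod q) (y₃ : Fin n → 𝒴) : ℝ :=
  ∏ i, W.transition (c.enc₁ i m₁₃ (pastOf y₁ i)) (c.enc₂ i m₂₃ (pastOf y₂ i))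
    (c.enc₃ i m₃₁ m₃₂ (pastOf y₃ i)) (y₁ i) (y₂ i) (y₃ i)

open Classical in
/-- The probability that some message is decoded wrongly, when the four messages are independent
and uniformly distributed. -/
noncomputable def errorProb (W : MADBChannel q 𝒴) {n k₁₃ k₂₃ k₃₁ k₃₂ : ℕ}
    (c : MADBCode q 𝒴 n k₁₃ k₂₃ k₃₁ k₃₂) : ℝ :=
  ∑ m₁₃, ∑ m₂₃, ∑ m₃₁, ∑ m₃₂, ((k₁₃ : ℝ) * k₂₃ * k₃₁ * k₃₂)⁻¹ *
    ∑ y₁ : Fin n → ZMod q, ∑ y₂ : Fin n → ZMod q, ∑ y₃ : Fin n → 𝒴,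
      if c.dec₃ m₃₁ m₃₂ y₃ ≠ (m₁₃, m₂₃) ∨ c.dec₁ m₁₃ y₁ ≠ m₃₁ ∨ c.dec₂ m₂₃ y₂ ≠ m₃₂
      then W.outputProb c m₁₃ m₂₃ m₃₁ m₃₂ y₁ y₂ y₃ else 0

/-- Achievability of a quadruple `(R₁₃, R₂₃, R₃₁, R₃₂)` of nonnegative rates. -/
def Achievable (W : MADBChannel q 𝒴) (R₁₃ R₂₃ R₃₁ R₃₂ : ℝ) : Prop :=
  0 ≤ R₁₃ ∧ 0 ≤ R₂₃ ∧ 0 ≤ R₃₁ ∧ 0 ≤ R₃₂ ∧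
  ∃ c : (n : ℕ) → MADBCode q 𝒴 n (numMessages n R₁₃) (numMessages n R₂₃)
      (numMessages n R₃₁) (numMessages n R₃₂),
    Filter.Tendsto (fun n => W.errorProb (c n)) Filter.atTop (nhds 0)

/-- The capacity region: the closure of the convex hull of the achievable rate quadruples. -/
def capacityRegion (W : MADBChannel q 𝒴) : Set (ℝ × ℝ × ℝ × ℝ) :=
  closure (convexHull ℝ {(R₁₃, R₂₃, R₃₁, R₃₂) | W.Achievable R₁₃ R₂₃ R₃₁ R₃₂})

/-- The joint law of `(X₁, X₂, X₃, V, Y₃, Z₁, Z₂)` for the law `P` of `(X₁, X₂, X₃, V)`. -/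
def jointLaw (W : MADBChannel q 𝒴) {𝒱 : Type*} (P : ZMod q × ZMod q × ZMod q × 𝒱 → ℝ) :
    ZMod q × ZMod q × ZMod q × 𝒱 × 𝒴 × ZMod q × ZMod q → ℝ :=
  fun (x₁, x₂, x₃, v, y₃, z₁, z₂) =>
    P (x₁, x₂, x₃, v) * W.mac x₁ x₂ x₃ y₃ * W.noise₁ z₁ * W.noise₂ z₂

/-- The rate quadruples `(R₁₃, R₂₃, R₃₁, R₃₂)` allowed by the law `P` of `(X₁, X₂, X₃, V)`. -/
def rateRegion (W : MADBChannel q 𝒴) {𝒱 : Type*} [Fintype 𝒱]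
    (P : ZMod q × ZMod q × ZMod q × 𝒱 → ℝ) : Set (ℝ × ℝ × ℝ × ℝ) :=
  let X₁ : ZMod q × ZMod q × ZMod q × 𝒱 × 𝒴 × ZMod q × ZMod q → ZMod q := fun ω => ω.1
  let X₂ : ZMod q × ZMod q × ZMod q × 𝒱 × 𝒴 × ZMod q × ZMod q → ZMod q := fun ω => ω.2.1
  let X₃ : ZMod q × ZMod q × ZMod q × 𝒱 × 𝒴 × ZMod q × ZMod q → ZMod q := fun ω => ω.2.2.1
  let V : ZMod q × ZMod q × ZMod q × 𝒱 × 𝒴 × ZMod q × ZMod q → 𝒱 := fun ω => ω.2.2.2.1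
  let Y₃ : ZMod q × ZMod q × ZMod q × 𝒱 × 𝒴 × ZMod q × ZMod q → 𝒴 := fun ω => ω.2.2.2.2.1
  let Z₁ : ZMod q × ZMod q × ZMod q × 𝒱 × 𝒴 × ZMod q × ZMod q → ZMod q :=
    fun ω => ω.2.2.2.2.2.1
  let Z₂ : ZMod q × ZMod q × ZMod q × 𝒱 × 𝒴 × ZMod q × ZMod q → ZMod q :=
    fun ω => ω.2.2.2.2.2.2
  {(R₁₃, R₂₃, R₃₁, R₃₂) | 0 ≤ R₁₃ ∧ 0 ≤ R₂₃ ∧ 0 ≤ R₃₁ ∧ 0 ≤ R₃₂ ∧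
    R₁₃ ≤ condMutualInfo (W.jointLaw P) X₁ Y₃ (fun ω => (X₂ ω, X₃ ω)) ∧
    R₂₃ ≤ condMutualInfo (W.jointLaw P) X₂ Y₃ (fun ω => (X₁ ω, X₃ ω)) ∧
    R₁₃ + R₂₃ ≤ condMutualInfo (W.jointLaw P) (fun ω => (X₁ ω, X₂ ω)) Y₃ X₃ ∧
    R₃₁ ≤ condMutualInfo (W.jointLaw P) X₃ (fun ω => X₃ ω + Z₁ ω) V ∧
    R₃₂ ≤ mutualInfo (W.jointLaw P) V (fun ω => X₃ ω + Z₁ ω + Z₂ ω)}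

/-- The product input law `P_{X₁} · P_{X₂} · P_{V, X₃}`. -/
def productInput {𝒱 : Type*} (P₁ P₂ : ZMod q → ℝ) (P₃ : 𝒱 × ZMod q → ℝ) :
    ZMod q × ZMod q × ZMod q × 𝒱 → ℝ :=
  fun (x₁, x₂, x₃, v) => P₁ x₁ * P₂ x₂ * P₃ (v, x₃)

/-- The Shannon-type inner bound: inputs of the form `P_{X₁} · P_{X₂} · P_{V, X₃}`, where the
alphabet of `V` has at most `q + 1` elements. -/
def innerBound (W : MADBChannel q 𝒴) : Set (ℝ × ℝ × ℝ × ℝ) :=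
  closure (convexHull ℝ {r | ∃ k ≤ q + 1, ∃ P₁ ∈ stdSimplex ℝ (ZMod q),
    ∃ P₂ ∈ stdSimplex ℝ (ZMod q), ∃ P₃ ∈ stdSimplex ℝ (Fin k × ZMod q),
      r ∈ W.rateRegion (productInput P₁ P₂ P₃)})

/-- The outer bound: all input laws `P_{X₁, X₂, X₃, V}`, where the alphabet of `V` has at most
`q + 1` elements. -/
def outerBound (W : MADBChannel q 𝒴) : Set (ℝ × ℝ × ℝ × ℝ) :=
  closure (convexHull ℝ {r | ∃ k ≤ q + 1,
    ∃ P ∈ stdSimplex ℝ (ZMod q × ZMod q × ZMod q × Fin k), r ∈ W.rateRegion P})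

/-- The region given by the inputs `P₁ · P_{X₂} · P_{V, X₃}` with `P₁` fixed, where the alphabet of
`V` has at most `q + 1` elements. -/
def fixedFirstInputRegion (W : MADBChannel q 𝒴) (P₁ : ZMod q → ℝ) : Set (ℝ × ℝ × ℝ × ℝ) :=
  closure (convexHull ℝ {r | ∃ k ≤ q + 1, ∃ P₂ ∈ stdSimplex ℝ (ZMod q),
    ∃ P₃ ∈ stdSimplex ℝ (Fin k × ZMod q), r ∈ W.rateRegion (productInput P₁ P₂ P₃)})

end MADBChannel

/-! Achievability uses no symmetry and no feedback. Users 1 and 2 subtract their own inputs, so the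
channel splits into a multiple-access channel to user 3, whose state `X₃` is known to that receiver,
and a degraded broadcast channel out of user 3. Superposition coding is itself treated as a
multiple-access problem: write `X₃ = U(V)` with a random function `U` independent of `V`. A single
theorem, `random_coding_tendsto`, then handles all four messages, and every rate quadruple of a
product input lies in the capacity region.

The converse is a hypothesis test instead of Fano's inequality with chain rules. A code with
feedback induces the input law `meanInput` at a uniformly random time, the auxiliary variable `V`
being the time, `M₁₃`, `M₂₃`, `M₃₂` and the past outputs of users 1 and 2. Dividing the law of the
code by the product over time of information densities gives a reference measure under which a
message among `k` is guessed correctly with mass at most `1 / k`, even by a receiver with some side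
information. Gibbs' inequality (`event_mul_logb_sub_one_le`) turns this into `Pr(correct) * log k -
1 ≤ n * I`. Five choices of density (`converse₁₃`, `converse₂₃`, `converse_sum`, `converse₃₁`,
`converse₃₂`) place the slightly reduced rates in `rateRegion` of a joint input law.

Symmetry closes the gap (`rateRegion_subset_of_symmetry`). The multiple-access bounds see only the
law of `(X₁, X₂, X₃)`, the broadcast bounds only that of `(V, X₃)`. Hence the joint law may be
replaced by `P* · P_{X₂} · P_{V,X₃}`: optimality of `P*` handles `R₁₃`; for `R₂₃` and the sum rate
the invariances remove the dependence on the conditioning variables, concavity of mutual information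
then merges the conditional input laws into their mean, and the last part of (iii) brings in `P*`. A
Carathéodory argument cuts the alphabet of `V` to `q + 1`. All regions are thereby squeezed onto the
one with first input `P*`. -/

section

open Finset Filter Topology

/-! ### Product laws and moments of i.i.d. sums. -/

section ProductLaws

variable {ι A : Type*} [Fintype ι]

/-- The product of the laws `p i`. -/
def prodPmf (p : ι → A → ℝ) (x : ι → A) : ℝ := ∏ i, p i (x i)

theorem prodPmf_nonneg {p : ι → A → ℝ} (hp : ∀ i a, 0 ≤ p i a) (x : ι → A) : 0 ≤ prodPmf p x :=
  prod_nonneg fun i _ => hp i (x i)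

variable [Fintype A] [DecidableEq ι]

theorem sum_prodPmf_mul_prod (p g : ι → A → ℝ) :
    ∑ x, prodPmf p x * ∏ i, g i (x i) = ∏ i, ∑ a, p i a * g i a := by
  simp only [prodPmf, ← prod_mul_distrib, prod_univ_sum, Fintype.piFinset_univ]

theorem sum_prodPmf (p : ι → A → ℝ) : ∑ x, prodPmf p x = ∏ i, ∑ a, p i a := by
  simpa using sum_prodPmf_mul_prod p (fun _ _ => 1)

theorem prodPmf_mem {p : ι → A → ℝ} (hp : ∀ i, p i ∈ stdSimplex ℝ A) :
    prodPmf p ∈ stdSimplex ℝ (ι → A) :=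
  ⟨prodPmf_nonneg fun i => (hp i).1, by simp [sum_prodPmf, fun i => (hp i).2]⟩

theorem sum_prodPmf_mul_apply {p : ι → A → ℝ} (hp : ∀ i, ∑ a, p i a = 1) (i : ι) (f : A → ℝ) :
    ∑ x, prodPmf p x * f (x i) = ∑ a, p i a * f a := by
  have h := sum_prodPmf_mul_prod p (fun j a => if j = i then f a else 1)
  have h1 : ∀ x : ι → A, ∏ j, (if j = i then f (x j) else 1) = f (x i) := by
    intro x; rw [prod_ite_eq' univ i (fun j => f (x j))]; simp
  have h2 : ∏ j, ∑ a, p j a * (if j = i then f a else 1) = ∑ a, p i a * f a := by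
    rw [prod_eq_single i]
    · simp
    · intro j _ hj; simp [hj, hp]
    · simp
  simp only [h1, h2] at h
  exact h

theorem sum_prodPmf_mul_apply_mul_apply {p : ι → A → ℝ} (hp : ∀ i, ∑ a, p i a = 1) {i j : ι}
    (hij : i ≠ j) (f g : A → ℝ) :
    ∑ x, prodPmf p x * (f (x i) * g (x j)) = (∑ a, p i a * f a) * ∑ a, p j a * g a := by
  have h := sum_prodPmf_mul_prod p
    (fun k a => (if k = i then f a else 1) * (if k = j then g a else 1))
  have h1 : ∀ x : ι → A, ∏ k, ((if k = i then f (x k) else 1) * (if k = j then g (x k) else 1))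
      = f (x i) * g (x j) := by
    intro x
    rw [prod_mul_distrib, prod_ite_eq' univ i (fun j => f (x j)),
      prod_ite_eq' univ j (fun j => g (x j))]
    simp
  have h2 : ∏ k, ∑ a, p k a * ((if k = i then f a else 1) * (if k = j then g a else 1))
      = (∑ a, p i a * f a) * ∑ a, p j a * g a := by
    rw [prod_eq_mul i j hij]
    · simp [hij, hij.symm]
    · intro k _ hk; simp [hk.1, hk.2, hp]
    · simp
    · simp
  simp only [h1, h2] at h
  exact h

theorem sum_prodPmf_mul_apply₂ {p : ι → A → ℝ} (hp : ∀ i, ∑ a, p i a = 1) {i j : ι}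
    (hij : i ≠ j) (f : A → A → ℝ) :
    ∑ x, prodPmf p x * f (x i) (x j) = ∑ a, ∑ b, p i a * p j b * f a b := by
  classical
  have h : ∀ x : ι → A, prodPmf p x * f (x i) (x j)
      = ∑ b, prodPmf p x * (f (x i) b * if x j = b then 1 else 0) := by
    intro x; rw [← mul_sum]; simp
  simp only [h]
  rw [sum_comm]
  symm
  rw [sum_comm]
  symm
  refine sum_congr rfl fun b _ => ?_
  rw [sum_prodPmf_mul_apply_mul_apply hp hij (fun a => f a b) (fun a => if a = b then 1 else 0)]
  simp only [mul_ite, mul_one, mul_zero, sum_ite_eq', mem_univ, if_true]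
  rw [sum_mul]
  exact sum_congr rfl fun a _ => by ring

/-- Independence and centring kill the cross terms of the square; the diagonal terms remain. -/
theorem sum_prodPmf_mul_sq {p : A → ℝ} (hp : ∑ a, p a = 1) {f : A → ℝ} (hf : ∑ a, p a * f a = 0) :
    ∑ x : ι → A, prodPmf (fun _ => p) x * (∑ i, f (x i)) ^ 2
      = Fintype.card ι * ∑ a, p a * f a ^ 2 := by
  have h : ∀ x : ι → A, prodPmf (fun _ => p) x * (∑ i, f (x i)) ^ 2
      = ∑ i, ∑ j, prodPmf (fun _ => p) x * (f (x i) * f (x j)) := by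
    intro x; rw [sq, sum_mul_sum, mul_sum]; simp only [mul_sum]
  simp only [h]
  rw [sum_comm]
  have : ∀ i : ι, ∑ x : ι → A, ∑ j, prodPmf (fun _ => p) x * (f (x i) * f (x j))
      = ∑ a, p a * f a ^ 2 := by
    intro i
    rw [sum_comm, sum_eq_single i]
    · rw [sum_prodPmf_mul_apply (p := fun _ : ι => p) (fun _ => hp) i (fun a => f a * f a)]
      simp [sq]
    · intro j _ hj
      rw [sum_prodPmf_mul_apply_mul_apply (p := fun _ : ι => p) (fun _ => hp) hj.symm]
      simp [hf]
    · simp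
  simp [this]

end ProductLaws

/-- The weak law of large numbers for a log-likelihood ratio, by Chebyshev: the bound is variance
over `n * (I - γ) ^ 2`. It makes the correct codewords pass the decoding test. -/
theorem tendsto_iid_threshold {A : Type*} [Fintype A] {p k l : A → ℝ} (hp : p ∈ stdSimplex ℝ A)
    (hk : ∀ a, 0 < p a → 0 < k a) (hl : ∀ a, 0 < p a → 0 < l a) {γ : ℝ}
    (hγ : γ < ∑ a, p a * Real.logb 2 (k a / l a)) :
    Tendsto (fun n : ℕ => ∑ x : Fin n → A,
      if (2 : ℝ) ^ (n * γ) * ∏ i, l (x i) < ∏ i, k (x i) then 0 else prodPmf (fun _ => p) x)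
      atTop (𝓝 0) := by
  set I := ∑ a, p a * Real.logb 2 (k a / l a) with hI
  set f : A → ℝ := fun a => Real.logb 2 (k a / l a) - I with hf
  have hf0 : ∑ a, p a * f a = 0 := by
    simp only [hf, mul_sub, sum_sub_distrib, ← sum_mul, hp.2]; simp [hI]
  set V := ∑ a, p a * f a ^ 2
  have hδ : 0 < I - γ := sub_pos.2 hγ
  have hlim : Tendsto (fun n : ℕ => V / (I - γ) ^ 2 * (1 / (n : ℝ))) atTop (𝓝 0) := by
    simpa using (tendsto_one_div_atTop_nhds_zero_nat (𝕜 := ℝ)).const_mul (V / (I - γ) ^ 2)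
  refine squeeze_zero' (Eventually.of_forall fun n => ?_) ?_ hlim
  · exact sum_nonneg fun x _ => by
      split_ifs
      · exact le_rfl
      · exact prodPmf_nonneg (fun _ => hp.1) x
  filter_upwards [eventually_ge_atTop 1] with n hn
  have hn0 : (0 : ℝ) < n := by exact_mod_cast hn
  -- Chebyshev pointwise: where the test fails, the centred sum is at most `-n * (I - γ)`. Sequences
  -- of mass zero are set apart because `k` or `l` may vanish there.
  have key : ∀ x : Fin n → A,
      (if (2 : ℝ) ^ (n * γ) * ∏ i, l (x i) < ∏ i, k (x i) then 0 else prodPmf (fun _ => p) x)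
        ≤ prodPmf (fun _ => p) x * (∑ i, f (x i)) ^ 2 * ((n * (I - γ)) ^ 2)⁻¹ := by
    intro x
    have hx0 : 0 ≤ prodPmf (fun _ => p) x := prodPmf_nonneg (fun _ => hp.1) x
    split_ifs with h
    · positivity
    rcases hx0.eq_or_lt with h0 | h0
    · rw [← h0]; simp
    have hpx : ∀ i, 0 < p (x i) := fun i =>
      (hp.1 _).lt_of_ne fun e => h0.ne' (prod_eq_zero (mem_univ i) e.symm)
    have hkx : ∀ i, 0 < k (x i) := fun i => hk _ (hpx i)
    have hlx : ∀ i, 0 < l (x i) := fun i => hl _ (hpx i)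
    have hK : 0 < ∏ i, k (x i) := prod_pos fun i _ => hkx i
    have hL : 0 < ∏ i, l (x i) := prod_pos fun i _ => hlx i
    have hsum : ∑ i, Real.logb 2 (k (x i) / l (x i)) ≤ n * γ := by
      rw [← Real.logb_prod _ _ (fun i _ => (div_pos (hkx i) (hlx i)).ne'), prod_div_distrib,
        Real.logb_le_iff_le_rpow one_lt_two (div_pos hK hL), div_le_iff₀ hL]
      exact not_lt.1 h
    have hle : n * (I - γ) ≤ -∑ i, f (x i) := by
      simp only [hf, sum_sub_distrib]; simp; linarith
    have hpos : 0 < n * (I - γ) := by positivity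
    have hsq : (n * (I - γ)) ^ 2 ≤ (∑ i, f (x i)) ^ 2 := by
      rw [← neg_sq (∑ i, f (x i))]; gcongr
    rw [mul_assoc, ← div_eq_mul_inv]
    exact le_mul_of_one_le_right hx0 ((one_le_div (by positivity)).2 hsq)
  refine (sum_le_sum fun x _ => key x).trans (le_of_eq ?_)
  rw [← sum_mul, sum_prodPmf_mul_sq hp.2 hf0]
  simp only [Fintype.card_fin]
  field_simp
  rfl

/-! ### Random coding for a fixed received word. -/

section RandomCoding

variable {A B : Type*} {M₁ M₂ : ℕ}

open Classical in
/-- The threshold decoder: the unique first message that is compatible with some second message. -/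
noncomputable def thresholdDecoder [NeZero M₁] (T : A → B → Prop) (ca : Fin M₁ → A)
    (cb : Fin M₂ → B) : Fin M₁ :=
  if h : ∃ m, (∃ m₂, T (ca m) (cb m₂)) ∧ ∀ m', (∃ m₂, T (ca m') (cb m₂)) → m' = m
  then h.choose else 0

theorem thresholdDecoder_eq [NeZero M₁] {T : A → B → Prop} {ca : Fin M₁ → A} {cb : Fin M₂ → B}
    {m₁ : Fin M₁} {m₂ : Fin M₂} (h : T (ca m₁) (cb m₂))
    (h' : ∀ m ≠ m₁, ∀ m₂', ¬ T (ca m) (cb m₂')) : thresholdDecoder T ca cb = m₁ := by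
  have hex : ∃ m, (∃ m₂, T (ca m) (cb m₂)) ∧ ∀ m', (∃ m₂, T (ca m') (cb m₂)) → m' = m :=
    ⟨m₁, ⟨m₂, h⟩, fun m' ⟨n, hn⟩ => by_contra fun hne => h' m' hne n hn⟩
  rw [thresholdDecoder, dif_pos hex]
  exact (hex.choose_spec.2 m₁ ⟨m₂, h⟩).symm

-- A union bound. A wrong second message next to the right first one does no harm, as only the first
-- message is decoded; hence no rate condition on the second message alone arises later.
open Classical in
theorem thresholdDecoder_error_le [NeZero M₁] (T : A → B → Prop) (ca : Fin M₁ → A)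
    (cb : Fin M₂ → B) (m₁ : Fin M₁) (m₂ : Fin M₂) :
    (if thresholdDecoder T ca cb = m₁ then (0 : ℝ) else 1) ≤
      (if T (ca m₁) (cb m₂) then 0 else 1) +
      (∑ m ∈ univ.erase m₁, (if T (ca m) (cb m₂) then 1 else 0) +
      ∑ m ∈ univ.erase m₁, ∑ m' ∈ univ.erase m₂, if T (ca m) (cb m') then 1 else 0) := by
  have n1 : ∀ m ∈ univ.erase m₁, (0 : ℝ) ≤ if T (ca m) (cb m₂) then 1 else 0 :=
    fun m _ => by split_ifs <;> norm_num
  have n2' : ∀ m, ∀ m' ∈ univ.erase m₂, (0 : ℝ) ≤ if T (ca m) (cb m') then 1 else 0 :=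
    fun m m' _ => by split_ifs <;> norm_num
  have n2 : ∀ m ∈ univ.erase m₁,
      (0 : ℝ) ≤ ∑ m' ∈ univ.erase m₂, if T (ca m) (cb m') then 1 else 0 :=
    fun m _ => sum_nonneg (n2' m)
  have s1 := sum_nonneg n1
  have s2 := sum_nonneg n2
  by_cases hT : T (ca m₁) (cb m₂)
  swap
  · rw [if_neg hT]; split_ifs <;> linarith
  by_cases h : ∀ m ≠ m₁, ∀ m₂', ¬ T (ca m) (cb m₂')
  · rw [if_pos (thresholdDecoder_eq hT h), if_pos hT]; linarith
  push Not at h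
  obtain ⟨m, hm, m', hm'⟩ := h
  have hmem : m ∈ univ.erase m₁ := by simp [hm]
  rw [if_pos hT]
  by_cases he : m' = m₂
  · subst he
    have := single_le_sum n1 hmem
    rw [if_pos hm'] at this
    split_ifs <;> linarith
  · have h1 := single_le_sum n2 hmem
    have h2 := single_le_sum (n2' m) (show m' ∈ univ.erase m₂ by simp [he])
    rw [if_pos hm'] at h2
    split_ifs <;> linarith

variable [Fintype A] [Fintype B]

/-- Distinct words of a random codebook are independent, so averages over codebooks reduce to
averages over the words involved. The next two versions add a competing word from one or from both
codebooks. -/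
theorem sum_codebooks {pA : A → ℝ} {pB : B → ℝ} (hA : ∑ a, pA a = 1) (hB : ∑ b, pB b = 1)
    (m₁ : Fin M₁) (m₂ : Fin M₂) (f : A → B → ℝ) :
    ∑ ca : Fin M₁ → A, ∑ cb : Fin M₂ → B,
      prodPmf (fun _ => pA) ca * prodPmf (fun _ => pB) cb * f (ca m₁) (cb m₂)
      = ∑ a, ∑ b, pA a * pB b * f a b := by
  simp only [mul_assoc, ← mul_sum]
  rw [← sum_prodPmf_mul_apply (p := fun _ => pA) (fun _ => hA) m₁]
  refine sum_congr rfl fun ca _ => ?_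
  rw [← sum_prodPmf_mul_apply (p := fun _ => pB) (fun _ => hB) m₂]

theorem sum_codebooks₁ {pA : A → ℝ} {pB : B → ℝ} (hA : ∑ a, pA a = 1) (hB : ∑ b, pB b = 1)
    {m₁ m : Fin M₁} (hm : m₁ ≠ m) (m₂ : Fin M₂) (f : A → A → B → ℝ) :
    ∑ ca : Fin M₁ → A, ∑ cb : Fin M₂ → B,
      prodPmf (fun _ => pA) ca * prodPmf (fun _ => pB) cb * f (ca m₁) (ca m) (cb m₂)
      = ∑ a, ∑ a', pA a * pA a' * ∑ b, pB b * f a a' b := by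
  simp only [mul_assoc, ← mul_sum]
  have := sum_prodPmf_mul_apply₂ (p := fun _ : Fin M₁ => pA) (fun _ => hA) hm
    (fun a a' => ∑ b, pB b * f a a' b)
  simp only [mul_assoc, ← mul_sum] at this
  rw [← this]
  refine sum_congr rfl fun ca _ => ?_
  rw [← sum_prodPmf_mul_apply (p := fun _ => pB) (fun _ => hB) m₂]

theorem sum_codebooks₂ {pA : A → ℝ} {pB : B → ℝ} (hA : ∑ a, pA a = 1) (hB : ∑ b, pB b = 1)
    {m₁ m : Fin M₁} (hm : m₁ ≠ m) {m₂ m' : Fin M₂} (hm' : m₂ ≠ m') (f : A → B → A → B → ℝ) :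
    ∑ ca : Fin M₁ → A, ∑ cb : Fin M₂ → B,
      prodPmf (fun _ => pA) ca * prodPmf (fun _ => pB) cb * f (ca m₁) (cb m₂) (ca m) (cb m')
      = ∑ a, ∑ a', pA a * pA a' * ∑ b, ∑ b', pB b * pB b' * f a b a' b' := by
  simp only [mul_assoc, ← mul_sum]
  have := sum_prodPmf_mul_apply₂ (p := fun _ : Fin M₁ => pA) (fun _ => hA) hm
    (fun a a' => ∑ b, pB b * ∑ b', pB b' * f a b a' b')
  simp only [mul_assoc, ← mul_sum] at this
  rw [← this]
  refine sum_congr rfl fun ca _ => ?_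
  have := sum_prodPmf_mul_apply₂ (p := fun _ => pB) (fun _ => hB) hm'
    (fun b b' => f (ca m₁) b (ca m) b')
  simp only [mul_assoc, ← mul_sum] at this
  rw [← this]

open Classical in
/-- The random coding bound for a single received symbol, with likelihood `k`. -/
theorem random_coding_bound [NeZero M₁] {pA : A → ℝ} {pB : B → ℝ} (hA : pA ∈ stdSimplex ℝ A)
    (hB : pB ∈ stdSimplex ℝ B) {k : A → B → ℝ} (hk : ∀ a b, 0 ≤ k a b) {T : A → B → Prop}
    {c₁ c₂ : ℝ} (hc₁ : 0 < c₁) (hc₂ : 0 < c₂)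
    (h₁ : ∀ a b, T a b → c₁ * ∑ a', pA a' * k a' b ≤ k a b)
    (h₂ : ∀ a b, T a b → c₂ * ∑ a', ∑ b', pA a' * pB b' * k a' b' ≤ k a b)
    (m₁ : Fin M₁) (m₂ : Fin M₂) :
    ∑ ca : Fin M₁ → A, ∑ cb : Fin M₂ → B, prodPmf (fun _ => pA) ca * prodPmf (fun _ => pB) cb *
      (k (ca m₁) (cb m₂) * if thresholdDecoder T ca cb = m₁ then 0 else 1)
    ≤ (∑ a, ∑ b, pA a * pB b * if T a b then 0 else k a b) +
      ((M₁ - 1) * c₁⁻¹ + (M₁ - 1) * (M₂ - 1) * c₂⁻¹) * ∑ a, ∑ b, pA a * pB b * k a b := by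
  set κ := ∑ a, ∑ b, pA a * pB b * k a b with hκ
  have hA0 := hA.1
  have hB0 := hB.1
  have step : ∀ (ca : Fin M₁ → A) (cb : Fin M₂ → B),
      prodPmf (fun _ => pA) ca * prodPmf (fun _ => pB) cb *
        (k (ca m₁) (cb m₂) * if thresholdDecoder T ca cb = m₁ then 0 else 1) ≤
      prodPmf (fun _ => pA) ca * prodPmf (fun _ => pB) cb *
          (if T (ca m₁) (cb m₂) then 0 else k (ca m₁) (cb m₂)) +
      (∑ m ∈ univ.erase m₁, prodPmf (fun _ => pA) ca * prodPmf (fun _ => pB) cb *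
          (k (ca m₁) (cb m₂) * if T (ca m) (cb m₂) then 1 else 0) +
      ∑ m ∈ univ.erase m₁, ∑ m' ∈ univ.erase m₂, prodPmf (fun _ => pA) ca *
          prodPmf (fun _ => pB) cb * (k (ca m₁) (cb m₂) * if T (ca m) (cb m') then 1 else 0)) := by
    intro ca cb
    have hw : 0 ≤ prodPmf (fun _ => pA) ca * prodPmf (fun _ => pB) cb :=
      mul_nonneg (prodPmf_nonneg (fun _ => hA0) _) (prodPmf_nonneg (fun _ => hB0) _)
    refine (mul_le_mul_of_nonneg_left (mul_le_mul_of_nonneg_left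
      (thresholdDecoder_error_le T ca cb m₁ m₂) (hk (ca m₁) (cb m₂))) hw).trans (le_of_eq ?_)
    simp only [← mul_sum, ← mul_add]
    congr 2
    rw [mul_add]
    congr 1
    split_ifs <;> simp
  refine (sum_le_sum fun ca _ => sum_le_sum fun cb _ => step ca cb).trans ?_
  simp only [sum_add_distrib, add_mul]
  have e1 := sum_codebooks (f := fun a b => if T a b then 0 else k a b) hA.2 hB.2 m₁ m₂
  rw [e1]
  have card₁ : (((univ.erase m₁).card : ℕ) : ℝ) = M₁ - 1 := by
    rw [card_erase_of_mem (mem_univ _), card_univ, Fintype.card_fin,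
      Nat.cast_sub (NeZero.one_le)]
    simp
  have card₂ : (((univ.erase m₂).card : ℕ) : ℝ) = M₂ - 1 := by
    rw [card_erase_of_mem (mem_univ _), card_univ, Fintype.card_fin,
      Nat.cast_sub (by have := m₂.2; omega)]
    simp
  gcongr ?_ + (?_ + ?_)
  · exact le_rfl
  · have : ∀ m ∈ univ.erase m₁, ∑ ca : Fin M₁ → A, ∑ cb : Fin M₂ → B,
        prodPmf (fun _ => pA) ca * prodPmf (fun _ => pB) cb *
          (k (ca m₁) (cb m₂) * if T (ca m) (cb m₂) then 1 else 0) ≤ c₁⁻¹ * κ := by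
      intro m hm
      rw [sum_codebooks₁ (f := fun a a' b => k a b * if T a' b then 1 else 0) hA.2 hB.2
        (ne_of_mem_erase hm).symm m₂, sum_comm, hκ, mul_sum]
      refine sum_le_sum fun a' _ => ?_
      have : ∑ a, pA a * pA a' * ∑ b, pB b * (k a b * if T a' b then 1 else 0)
          = ∑ b, pA a' * pB b * (if T a' b then ∑ a, pA a * k a b else 0) := by
        simp only [mul_sum]
        rw [sum_comm]
        refine sum_congr rfl fun b _ => ?_
        split_ifs
        · rw [mul_sum]; exact sum_congr rfl fun a _ => by ring
        · simp
      rw [this, mul_sum]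
      refine sum_le_sum fun b _ => ?_
      rw [mul_left_comm]
      refine mul_le_mul_of_nonneg_left ?_ (mul_nonneg (hA0 _) (hB0 _))
      -- Change of measure: a word that passes the test has likelihood at least `c₁` times the mean
      -- likelihood, so competitors that the received word does not depend on pass with total weight
      -- at most `c₁⁻¹ * κ`.
      split_ifs with hT
      · rw [le_inv_mul_iff₀ hc₁]; exact h₁ a' b hT
      · exact mul_nonneg (inv_nonneg.2 hc₁.le) (hk _ _)
    have h := sum_le_sum this
    rw [sum_const, nsmul_eq_mul, card₁, ← mul_assoc] at h
    refine le_trans (le_of_eq ?_) h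
    simp only [sum_comm (s := univ.erase m₁)]
  · have : ∀ m ∈ univ.erase m₁, ∀ m' ∈ univ.erase m₂, ∑ ca : Fin M₁ → A, ∑ cb : Fin M₂ → B,
        prodPmf (fun _ => pA) ca * prodPmf (fun _ => pB) cb *
          (k (ca m₁) (cb m₂) * if T (ca m) (cb m') then 1 else 0) ≤ c₂⁻¹ * κ := by
      intro m hm m' hm'
      rw [sum_codebooks₂ (f := fun a b a' b' => k a b * if T a' b' then 1 else 0) hA.2 hB.2
        (ne_of_mem_erase hm).symm (ne_of_mem_erase hm').symm, sum_comm, hκ, mul_sum]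
      refine sum_le_sum fun a' _ => ?_
      -- Both competing words are independent of the transmitted pair, so the full mean likelihood
      -- `κ` factors out.
      have : ∑ a, pA a * pA a' * ∑ b, ∑ b', pB b * pB b' * (k a b * if T a' b' then 1 else 0)
          = ∑ b', pA a' * pB b' * (if T a' b' then κ else 0) := by
        simp only [mul_sum]
        have : ∀ a, ∑ b, ∑ b', pA a * pA a' * (pB b * pB b' * (k a b * if T a' b' then 1 else 0))
          = ∑ b', ∑ b, pA a * pA a' * (pB b * pB b' * (k a b * if T a' b' then 1 else 0)) :=
          fun a => sum_comm
        simp only [this]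
        rw [sum_comm]
        refine sum_congr rfl fun b' _ => ?_
        split_ifs
        · rw [hκ, mul_sum]
          refine sum_congr rfl fun a _ => ?_
          rw [mul_sum]
          exact sum_congr rfl fun b _ => by ring
        · simp
      rw [this, mul_sum]
      refine sum_le_sum fun b _ => ?_
      rw [mul_left_comm]
      refine mul_le_mul_of_nonneg_left ?_ (mul_nonneg (hA0 _) (hB0 _))
      split_ifs with hT
      · rw [le_inv_mul_iff₀ hc₂]; exact h₂ a' b hT
      · exact mul_nonneg (inv_nonneg.2 hc₂.le) (hk _ _)
    have h := sum_le_sum fun m hm => sum_le_sum (this m hm)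
    simp only [sum_const, nsmul_eq_mul, card₁, card₂] at h
    rw [← mul_assoc, ← mul_assoc] at h
    refine le_trans (le_of_eq ?_) h
    rw [sum_congr rfl fun ca _ => sum_comm, sum_comm]
    refine sum_congr rfl fun m _ => ?_
    rw [sum_congr rfl fun ca _ => sum_comm, sum_comm]

end RandomCoding

/-! ### Numbers of messages. -/

theorem sum_arrow_prod {ι A B : Type*} [Fintype ι] [DecidableEq ι] [Fintype A] [Fintype B]
    (F : (ι → A) → (ι → B) → ℝ) :
    ∑ x : ι → A × B, F (fun i => (x i).1) (fun i => (x i).2) = ∑ a, ∑ b, F a b := by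
  rw [← Fintype.sum_prod_type' (f := F)]
  exact Fintype.sum_equiv (Equiv.arrowProdEquivProdArrow ι (fun _ => A) (fun _ => B)) _ _
    fun x => rfl

theorem numMessages_zero (n : ℕ) : numMessages n 0 = 1 := by simp [numMessages]

theorem numMessages_pos (n : ℕ) (R : ℝ) : 0 < numMessages n R :=
  Nat.ceil_pos.2 (by positivity)

instance (n : ℕ) (R : ℝ) : NeZero (numMessages n R) := ⟨(numMessages_pos n R).ne'⟩

/-- The union bounds count only the wrong messages, one fewer than all, which exactly absorbs the
rounding up. -/
theorem numMessages_sub_one_le (n : ℕ) (R : ℝ) :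
    (numMessages n R : ℝ) - 1 ≤ (2 : ℝ) ^ ((n : ℝ) * R) := by
  have := Nat.ceil_lt_add_one (R := ℝ) (a := (2 : ℝ) ^ ((n : ℝ) * R)) (by positivity)
  unfold numMessages; linarith

theorem one_le_numMessages (n : ℕ) (R : ℝ) : (1 : ℝ) ≤ numMessages n R := by
  exact_mod_cast numMessages_pos n R

theorem tendsto_two_rpow_neg_mul {δ : ℝ} (hδ : 0 < δ) :
    Tendsto (fun n : ℕ => ((2 : ℝ) ^ ((n : ℝ) * δ))⁻¹) atTop (𝓝 0) := by
  have h : Tendsto (fun n : ℕ => ((2 : ℝ) ^ δ) ^ n) atTop atTop :=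
    tendsto_pow_atTop_atTop_of_one_lt (Real.one_lt_rpow one_lt_two hδ)
  refine (tendsto_inv_atTop_zero.comp h).congr fun n => ?_
  simp only [Function.comp]
  rw [← Real.rpow_natCast, ← Real.rpow_mul zero_le_two, mul_comm]

/-! ### Vanishing error of random codes over `n` channel uses. -/

section RandomCoding

variable {A B S Y : Type*} [Fintype A] [Fintype B] [Fintype S] [Fintype Y]

/-- The failure probability of the test is rearranged with state and output outermost, the form
needed to apply `random_coding_bound` for each fixed pair of them. -/
theorem sum_thresholds {n : ℕ} {pA : A → ℝ} {pB : B → ℝ} {pS : S → ℝ} {K : A → B → S → Y → ℝ}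
    (c : ℝ) (l : A × B × S × Y → ℝ) :
    ∑ x : Fin n → A × B × S × Y, (if c * ∏ i, l (x i) <
        ∏ i, K (x i).1 (x i).2.1 (x i).2.2.1 (x i).2.2.2 then 0 else
      prodPmf (fun _ ω => pA ω.1 * pB ω.2.1 * pS ω.2.2.1 * K ω.1 ω.2.1 ω.2.2.1 ω.2.2.2) x)
    = ∑ s : Fin n → S, ∑ y : Fin n → Y, prodPmf (fun _ => pS) s * ∑ a : Fin n → A, ∑ b : Fin n → B,
      prodPmf (fun _ => pA) a * prodPmf (fun _ => pB) b *
        if c * ∏ i, l (a i, b i, s i, y i) < ∏ i, K (a i) (b i) (s i) (y i) then 0 else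
          ∏ i, K (a i) (b i) (s i) (y i) := by
  have h1 := sum_arrow_prod (ι := Fin n) (A := A) (B := B × S × Y) (fun a x =>
    (if c * ∏ i, l (a i, x i) <
        ∏ i, K (a i) (x i).1 (x i).2.1 (x i).2.2 then 0 else
      prodPmf (fun _ ω => pA ω.1 * pB ω.2.1 * pS ω.2.2.1 * K ω.1 ω.2.1 ω.2.2.1 ω.2.2.2)
        (fun i => (a i, x i))))
  have h2 := fun a : Fin n → A => sum_arrow_prod (ι := Fin n) (A := B) (B := S × Y) (fun b x =>
    (if c * ∏ i, l (a i, b i, x i) <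
        ∏ i, K (a i) (b i) (x i).1 (x i).2 then 0 else
      prodPmf (fun _ ω => pA ω.1 * pB ω.2.1 * pS ω.2.2.1 * K ω.1 ω.2.1 ω.2.2.1 ω.2.2.2)
        (fun i => (a i, b i, x i))))
  have h3 := fun (a : Fin n → A) (b : Fin n → B) => sum_arrow_prod (ι := Fin n) (A := S) (B := Y)
    (fun s y => (if c * ∏ i, l (a i, b i, s i, y i) < ∏ i, K (a i) (b i) (s i) (y i) then 0 else
      prodPmf (fun _ ω => pA ω.1 * pB ω.2.1 * pS ω.2.2.1 * K ω.1 ω.2.1 ω.2.2.1 ω.2.2.2)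
        (fun i => (a i, b i, s i, y i))))
  refine (h1.trans (sum_congr rfl fun a _ => (h2 a).trans (sum_congr rfl fun b _ => h3 a b))).trans
    ?_
  simp only [mul_sum]
  have hswap : ∀ F : (Fin n → A) → (Fin n → B) → (Fin n → S) → (Fin n → Y) → ℝ,
      ∑ a, ∑ b, ∑ s, ∑ y, F a b s y = ∑ s, ∑ y, ∑ a, ∑ b, F a b s y := by
    intro F
    rw [sum_congr rfl fun a _ => sum_comm, sum_comm]
    refine sum_congr rfl fun s _ => ?_
    rw [sum_congr rfl fun a _ => sum_comm, sum_comm]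
  rw [hswap]
  refine sum_congr rfl fun s _ => sum_congr rfl fun y _ => sum_congr rfl fun a _ =>
    sum_congr rfl fun b _ => ?_
  split_ifs
  · simp
  · simp only [prodPmf, prod_mul_distrib]; ring

open Classical in
/-- Random coding for the first user of a multiple access channel whose state is known to the
receiver: the error probability tends to zero, uniformly in the messages. -/
theorem random_coding_tendsto {pA : A → ℝ} {pB : B → ℝ} {pS : S → ℝ} {K : A → B → S → Y → ℝ}
    (hA : pA ∈ stdSimplex ℝ A) (hB : pB ∈ stdSimplex ℝ B) (hS : pS ∈ stdSimplex ℝ S)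
    (hK : ∀ a b s, K a b s ∈ stdSimplex ℝ Y) {R₁ R₂ : ℝ}
    (hR : R₁ = 0 ∨
      R₁ < ∑ a, ∑ b, ∑ s, ∑ y, pA a * pB b * pS s * K a b s y *
        Real.logb 2 (K a b s y / ∑ a', pA a' * K a' b s y) ∧
      R₁ + R₂ < ∑ a, ∑ b, ∑ s, ∑ y, pA a * pB b * pS s * K a b s y *
        Real.logb 2 (K a b s y / ∑ a', ∑ b', pA a' * pB b' * K a' b' s y)) :
    ∃ dec : (n : ℕ) → (Fin (numMessages n R₁) → Fin n → A) → (Fin (numMessages n R₂) → Fin n → B) →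
      (Fin n → S) → (Fin n → Y) → Fin (numMessages n R₁),
    ∃ ε : ℕ → ℝ, Tendsto ε atTop (𝓝 0) ∧ ∀ n m₁ m₂,
      ∑ ca : Fin (numMessages n R₁) → Fin n → A, ∑ cb : Fin (numMessages n R₂) → Fin n → B,
        prodPmf (fun _ => prodPmf fun _ => pA) ca * prodPmf (fun _ => prodPmf fun _ => pB) cb *
        ∑ s : Fin n → S, ∑ y : Fin n → Y, prodPmf (fun _ => pS) s *
          ((∏ i, K (ca m₁ i) (cb m₂ i) (s i) (y i)) * if dec n ca cb s y = m₁ then 0 else 1)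
        ≤ ε n := by
  -- At rate zero there is one message and nothing to decode. The case is separate because the
  -- strict inequalities are impossible for it when the information vanishes.
  rcases hR with rfl | ⟨hR₁, hR₂⟩
  · refine ⟨fun _ _ _ _ _ => 0, fun _ => 0, tendsto_const_nhds, fun n m₁ m₂ => le_of_eq ?_⟩
    have : (0 : Fin (numMessages n 0)) = m₁ := by
      have h0 := m₁.2
      have h1 := (0 : Fin (numMessages n 0)).2
      have h2 := numMessages_zero n
      exact Fin.ext (by omega)
    simp [this]
  -- The thresholds lie strictly between rate and information: the gap below suppresses wrong
  -- messages, the gap above lets the true pair pass.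
  obtain ⟨γ₁, h1, h1'⟩ := exists_between hR₁
  obtain ⟨γ₂, h2, h2'⟩ := exists_between hR₂
  let p : A × B × S × Y → ℝ :=
    fun ω => pA ω.1 * pB ω.2.1 * pS ω.2.2.1 * K ω.1 ω.2.1 ω.2.2.1 ω.2.2.2
  let k : A × B × S × Y → ℝ := fun ω => K ω.1 ω.2.1 ω.2.2.1 ω.2.2.2
  let l₁ : A × B × S × Y → ℝ := fun ω => ∑ a', pA a' * K a' ω.2.1 ω.2.2.1 ω.2.2.2
  let l₂ : A × B × S × Y → ℝ := fun ω => ∑ a', ∑ b', pA a' * pB b' * K a' b' ω.2.2.1 ω.2.2.2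
  have hA0 := hA.1
  have hB0 := hB.1
  have hS0 := hS.1
  have hK0 : ∀ a b s y, 0 ≤ K a b s y := fun a b s => (hK a b s).1
  have hp : p ∈ stdSimplex ℝ (A × B × S × Y) := by
    refine ⟨fun ω => mul_nonneg (mul_nonneg (mul_nonneg (hA0 _) (hB0 _)) (hS0 _)) (hK0 _ _ _ _), ?_⟩
    simp only [p, Fintype.sum_prod_type, ← mul_sum, (hK _ _ _).2, mul_one, hS.2, hB.2, hA.2]
  have hpos : ∀ ω, 0 < p ω → 0 < pA ω.1 ∧ 0 < pB ω.2.1 ∧ 0 < k ω := by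
    intro ω hω
    refine ⟨(hA0 _).lt_of_ne fun e => hω.ne' ?_, (hB0 _).lt_of_ne fun e => hω.ne' ?_,
      (hK0 _ _ _ _).lt_of_ne fun e => hω.ne' ?_⟩ <;> simp [p, ← e]
  have hk : ∀ ω, 0 < p ω → 0 < k ω := fun ω h => (hpos ω h).2.2
  have hl₁ : ∀ ω, 0 < p ω → 0 < l₁ ω := by
    intro ω h
    obtain ⟨ha, hb, hk⟩ := hpos ω h
    exact sum_pos' (fun a _ => mul_nonneg (hA0 _) (hK0 _ _ _ _)) ⟨ω.1, mem_univ _, mul_pos ha hk⟩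
  have hl₂ : ∀ ω, 0 < p ω → 0 < l₂ ω := by
    intro ω h
    obtain ⟨ha, hb, hk⟩ := hpos ω h
    have h0 : ∀ a b, 0 ≤ pA a * pB b * K a b ω.2.2.1 ω.2.2.2 :=
      fun a b => mul_nonneg (mul_nonneg (hA0 _) (hB0 _)) (hK0 _ _ _ _)
    exact sum_pos' (fun a _ => sum_nonneg fun b _ => h0 a b) ⟨ω.1, mem_univ _,
      sum_pos' (fun b _ => h0 _ b) ⟨ω.2.1, mem_univ _, mul_pos (mul_pos ha hb) hk⟩⟩
  have lim₁ := tendsto_iid_threshold hp hk hl₁ (γ := γ₁)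
    (by simpa only [p, k, l₁, Fintype.sum_prod_type] using h1')
  have lim₂ := tendsto_iid_threshold hp hk hl₂ (γ := γ₂)
    (by simpa only [p, k, l₂, Fintype.sum_prod_type] using h2')
  simp only [k, p] at lim₁ lim₂
  simp only [sum_thresholds] at lim₁ lim₂
  have lim₃ : Tendsto (fun n : ℕ => ((numMessages n R₁ : ℝ) - 1) * ((2 : ℝ) ^ ((n : ℝ) * γ₁))⁻¹)
      atTop (𝓝 0) := by
    refine squeeze_zero (fun n => mul_nonneg (by linarith [one_le_numMessages n R₁]) (by positivity))
      (fun n => ?_) (tendsto_two_rpow_neg_mul (sub_pos.2 h1))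
    rw [mul_sub, Real.rpow_sub two_pos, inv_div, div_eq_mul_inv]
    gcongr
    exact numMessages_sub_one_le n R₁
  have lim₄ : Tendsto (fun n : ℕ => ((numMessages n R₁ : ℝ) - 1) * ((numMessages n R₂ : ℝ) - 1) *
      ((2 : ℝ) ^ ((n : ℝ) * γ₂))⁻¹) atTop (𝓝 0) := by
    refine squeeze_zero (fun n => mul_nonneg (mul_nonneg (by linarith [one_le_numMessages n R₁])
      (by linarith [one_le_numMessages n R₂])) (by positivity))
      (fun n => ?_) (tendsto_two_rpow_neg_mul (sub_pos.2 h2))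
    rw [mul_sub (n : ℝ), Real.rpow_sub two_pos, inv_div, div_eq_mul_inv, mul_add, Real.rpow_add two_pos]
    gcongr
    · linarith [one_le_numMessages n R₂]
    · exact numMessages_sub_one_le n R₁
    · exact numMessages_sub_one_le n R₂
  let T : (n : ℕ) → (Fin n → S) → (Fin n → Y) → (Fin n → A) → (Fin n → B) → Prop :=
    fun n s y a b =>
      (2 : ℝ) ^ ((n : ℝ) * γ₁) * ∏ i, l₁ (a i, b i, s i, y i) < ∏ i, K (a i) (b i) (s i) (y i) ∧
      (2 : ℝ) ^ ((n : ℝ) * γ₂) * ∏ i, l₂ (a i, b i, s i, y i) < ∏ i, K (a i) (b i) (s i) (y i)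
  have lim := (lim₁.add lim₂).add (lim₃.add lim₄)
  simp only [add_zero] at lim
  refine ⟨fun n ca cb s y => thresholdDecoder (T n s y) ca cb, _, lim, fun n m₁ m₂ => ?_⟩
  have hAn : prodPmf (fun _ : Fin n => pA) ∈ stdSimplex ℝ (Fin n → A) := prodPmf_mem fun _ => hA
  have hBn : prodPmf (fun _ : Fin n => pB) ∈ stdSimplex ℝ (Fin n → B) := prodPmf_mem fun _ => hB
  have hSn : prodPmf (fun _ : Fin n => pS) ∈ stdSimplex ℝ (Fin n → S) := prodPmf_mem fun _ => hS
  have bound := fun (s : Fin n → S) (y : Fin n → Y) =>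
    random_coding_bound (M₁ := numMessages n R₁) (M₂ := numMessages n R₂)
      hAn hBn (k := fun a b => ∏ i, K (a i) (b i) (s i) (y i))
      (fun a b => prod_nonneg fun i _ => hK0 _ _ _ _) (T := T n s y)
      (c₁ := (2 : ℝ) ^ ((n : ℝ) * γ₁)) (c₂ := (2 : ℝ) ^ ((n : ℝ) * γ₂)) (by positivity)
      (by positivity)
      (fun a b h => by
        refine le_trans (le_of_eq ?_) h.1.le
        rw [sum_prodPmf_mul_prod (fun _ => pA) (fun i a' => K a' (b i) (s i) (y i))])
      (fun a b h => by
        refine le_trans (le_of_eq ?_) h.2.le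
        simp only [mul_assoc, ← mul_sum, l₂]
        have hb : ∀ a' : Fin n → A, ∑ b' : Fin n → B, prodPmf (fun _ => pB) b' *
            ∏ i, K (a' i) (b' i) (s i) (y i) = ∏ i, ∑ b', pB b' * K (a' i) b' (s i) (y i) :=
          fun a' => sum_prodPmf_mul_prod (fun _ => pB) (fun i b' => K (a' i) b' (s i) (y i))
        simp only [hb]
        rw [sum_prodPmf_mul_prod (fun _ => pA) (fun i a' => ∑ b', pB b' * K a' b' (s i) (y i))])
      m₁ m₂
  have hsum := sum_le_sum fun (s : Fin n → S) (_ : s ∈ univ) =>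
    sum_le_sum fun (y : Fin n → Y) (_ : y ∈ univ) =>
      mul_le_mul_of_nonneg_left (bound s y) (hSn.1 s)
  -- Summed over states and outputs the mean likelihood is one, so the wrong-message terms
  -- contribute only their coefficients.
  have hone : ∑ s : Fin n → S, ∑ y : Fin n → Y, prodPmf (fun _ => pS) s *
      ∑ a : Fin n → A, ∑ b : Fin n → B, prodPmf (fun _ => pA) a * prodPmf (fun _ => pB) b *
        ∏ i, K (a i) (b i) (s i) (y i) = 1 := by
    have hKn : ∀ (a : Fin n → A) (b : Fin n → B) (s : Fin n → S),
        ∑ y : Fin n → Y, ∏ i, K (a i) (b i) (s i) (y i) = 1 := by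
      intro a b s
      have := sum_prodPmf (fun i : Fin n => K (a i) (b i) (s i))
      simpa [prodPmf, (hK _ _ _).2] using this
    simp only [← mul_sum]
    have : ∀ s : Fin n → S, ∑ y : Fin n → Y, ∑ a : Fin n → A, ∑ b : Fin n → B,
        prodPmf (fun _ => pA) a * prodPmf (fun _ => pB) b * ∏ i, K (a i) (b i) (s i) (y i) = 1 := by
      intro s
      rw [sum_comm, sum_congr rfl fun a _ => sum_comm]
      simp only [← mul_sum, hKn, mul_one, hBn.2, hAn.2]
    simp only [this, mul_one, hSn.2]
  calc _ = ∑ s : Fin n → S, ∑ y : Fin n → Y, prodPmf (fun _ => pS) s *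
        ∑ ca : Fin (numMessages n R₁) → Fin n → A, ∑ cb : Fin (numMessages n R₂) → Fin n → B,
        prodPmf (fun _ => prodPmf fun _ => pA) ca * prodPmf (fun _ => prodPmf fun _ => pB) cb *
        ((∏ i, K (ca m₁ i) (cb m₂ i) (s i) (y i)) *
          if thresholdDecoder (T n s y) ca cb = m₁ then 0 else 1) := by
        simp only [mul_sum]
        rw [sum_congr rfl fun a _ => sum_comm, sum_comm]
        refine sum_congr rfl fun s _ => ?_
        rw [sum_congr rfl fun a _ => sum_comm, sum_comm]
        refine sum_congr rfl fun y _ => sum_congr rfl fun a _ => sum_congr rfl fun b _ => ?_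
        ring
    _ ≤ _ := hsum
    _ ≤ _ := by
        simp only [mul_add, sum_add_distrib]
        have e : ∀ (c : ℝ), ∑ s : Fin n → S, ∑ y : Fin n → Y, prodPmf (fun _ => pS) s *
          (c * ∑ a : Fin n → A, ∑ b : Fin n → B, prodPmf (fun _ => pA) a * prodPmf (fun _ => pB) b *
            ∏ i, K (a i) (b i) (s i) (y i)) = c := by
          intro c
          simp only [mul_left_comm _ c]
          simp only [← mul_sum] at hone ⊢
          rw [hone, mul_one]
        rw [e]
        refine add_le_add ?_ le_rfl
        simp only [← sum_add_distrib, ← mul_add]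
        refine sum_le_sum fun s _ => sum_le_sum fun y _ =>
          mul_le_mul_of_nonneg_left (sum_le_sum fun a _ => sum_le_sum fun b _ =>
            mul_le_mul_of_nonneg_left ?_ (mul_nonneg (hAn.1 a) (hBn.1 b))) (hSn.1 s)
        have : 0 ≤ ∏ i, K (a i) (b i) (s i) (y i) := prod_nonneg fun i _ => hK0 _ _ _ _
        simp only [T]
        split_ifs <;> first | tauto | linarith

end RandomCoding

/-! ### Laws of finite random variables and Gibbs' inequality. -/

section Laws

variable {Ω A B C : Type*} [Fintype Ω]

theorem pmfLaw_eq_sum_ite [DecidableEq A] (p : Ω → ℝ) (f : Ω → A) (a : A) :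
    pmfLaw p f a = ∑ ω, if f ω = a then p ω else 0 := by
  rw [pmfLaw, sum_filter]
  exact sum_congr rfl fun ω _ => by congr

theorem sum_pmfLaw_mul [Fintype A] (p : Ω → ℝ) (f : Ω → A) (F : A → ℝ) :
    ∑ a, pmfLaw p f a * F a = ∑ ω, p ω * F (f ω) := by
  classical
  simp only [pmfLaw_eq_sum_ite, sum_mul]
  rw [sum_comm]
  simp [ite_mul]

theorem pmfLaw_comp [Fintype A] [DecidableEq B] (p : Ω → ℝ) (f : Ω → A) (g : A → B) (b : B) :
    pmfLaw p (fun ω => g (f ω)) b = ∑ a, pmfLaw p f a * if g a = b then 1 else 0 := by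
  rw [sum_pmfLaw_mul, pmfLaw_eq_sum_ite]
  simp

theorem pmfLaw_nonneg {p : Ω → ℝ} (hp : ∀ ω, 0 ≤ p ω) (f : Ω → A) (a : A) : 0 ≤ pmfLaw p f a :=
  sum_nonneg fun ω _ => hp ω

theorem pmfLaw_pos {p : Ω → ℝ} (hp : ∀ ω, 0 ≤ p ω) (f : Ω → A) {ω : Ω} (h : 0 < p ω) :
    0 < pmfLaw p f (f ω) :=
  sum_pos' (fun ω _ => hp ω) ⟨ω, by simp, h⟩

theorem sum_pmfLaw [Fintype A] (p : Ω → ℝ) (f : Ω → A) : ∑ a, pmfLaw p f a = ∑ ω, p ω := by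
  simpa using sum_pmfLaw_mul p f (fun _ => 1)

variable [Fintype A] [Fintype B] [Fintype C]

theorem pmfLaw_fst (p : Ω → ℝ) (X : Ω → A) (Y : Ω → B) (a : A) :
    pmfLaw p X a = ∑ b, pmfLaw p (fun ω => (X ω, Y ω)) (a, b) := by
  classical
  rw [pmfLaw_comp p (fun ω => (X ω, Y ω)) Prod.fst a]
  simp [Fintype.sum_prod_type]
  rw [sum_comm]
  simp

theorem pmfLaw_snd (p : Ω → ℝ) (X : Ω → A) (Y : Ω → B) (b : B) :
    pmfLaw p Y b = ∑ a, pmfLaw p (fun ω => (X ω, Y ω)) (a, b) := by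
  classical
  rw [pmfLaw_comp p (fun ω => (X ω, Y ω)) Prod.snd b]
  simp [Fintype.sum_prod_type]

theorem pmfLaw_fst_thd (p : Ω → ℝ) (X : Ω → A) (Y : Ω → B) (Z : Ω → C) (a : A) (c : C) :
    pmfLaw p (fun ω => (X ω, Z ω)) (a, c) = ∑ b, pmfLaw p (fun ω => (X ω, Y ω, Z ω)) (a, b, c) := by
  classical
  rw [pmfLaw_comp p (fun ω => (X ω, Y ω, Z ω)) (fun t => (t.1, t.2.2)) (a, c)]
  simp only [Fintype.sum_prod_type, Prod.mk.injEq]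
  rw [sum_eq_single a]
  · exact sum_congr rfl fun b _ => by simp
  · intro a' _ h; simp [h]
  · simp

/-- The expectation form is what allows the information to be read as the mean of a log-density
along the trajectory of a code. -/
theorem condMutualInfo_eq_expectation (p : Ω → ℝ) (X : Ω → A) (Y : Ω → B) (Z : Ω → C) :
    condMutualInfo p X Y Z = ∑ ω, p ω *
      Real.logb 2 (pmfLaw p (fun ω => (X ω, Y ω, Z ω)) (X ω, Y ω, Z ω) * pmfLaw p Z (Z ω) /
      (pmfLaw p (fun ω => (X ω, Z ω)) (X ω, Z ω) * pmfLaw p (fun ω => (Y ω, Z ω)) (Y ω, Z ω))) := by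
  rw [← sum_pmfLaw_mul p (fun ω => (X ω, Y ω, Z ω)) (fun t =>
      Real.logb 2 (pmfLaw p (fun ω => (X ω, Y ω, Z ω)) (t.1, t.2.1, t.2.2) * pmfLaw p Z t.2.2 /
      (pmfLaw p (fun ω => (X ω, Z ω)) (t.1, t.2.2) *
        pmfLaw p (fun ω => (Y ω, Z ω)) (t.2.1, t.2.2))))]
  simp only [Fintype.sum_prod_type, condMutualInfo]

theorem mutualInfo_eq_expectation (p : Ω → ℝ) (X : Ω → A) (Y : Ω → B) :
    mutualInfo p X Y = ∑ ω, p ω * Real.logb 2 (pmfLaw p (fun ω => (X ω, Y ω)) (X ω, Y ω) /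
      (pmfLaw p X (X ω) * pmfLaw p Y (Y ω))) := by
  rw [← sum_pmfLaw_mul p (fun ω => (X ω, Y ω)) (fun t =>
      Real.logb 2 (pmfLaw p (fun ω => (X ω, Y ω)) (t.1, t.2) / (pmfLaw p X t.1 * pmfLaw p Y t.2)))]
  simp only [Fintype.sum_prod_type, mutualInfo]

end Laws

/-- Gibbs' inequality. -/
theorem sum_mul_logb_div_nonneg {ι : Type*} [Fintype ι] {a b : ι → ℝ} (ha : ∀ i, 0 ≤ a i)
    (hb : ∀ i, 0 ≤ b i) (hab : ∀ i, 0 < a i → 0 < b i) (h : ∑ i, b i ≤ ∑ i, a i) :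
    0 ≤ ∑ i, a i * Real.logb 2 (a i / b i) := by
  have hlog : 0 < Real.log 2 := Real.log_pos one_lt_two
  -- Termwise `log x ≤ x - 1` at `x = b i / a i`.
  have key : ∀ i, (a i - b i) / Real.log 2 ≤ a i * Real.logb 2 (a i / b i) := by
    intro i
    rw [Real.logb, mul_div_assoc', div_le_div_iff_of_pos_right hlog]
    rcases (ha i).eq_or_lt with h0 | h0
    · rw [← h0]; simpa using hb i
    have hbi := hab i h0
    have := Real.log_le_sub_one_of_pos (div_pos hbi h0)
    rw [← inv_div, Real.log_inv]
    have e : a i * (b i / a i) = b i := by field_simp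
    nlinarith
  refine le_trans ?_ (sum_le_sum fun i _ => key i)
  rw [← sum_div, sum_sub_distrib]
  exact div_nonneg (sub_nonneg.2 h) hlog.le

/-! ### Homogeneous mutual information: concavity and data processing. -/

section ScaledInfo

variable {A B C Y : Type*} [Fintype A] [Fintype B] [Fintype C] [Fintype Y]

/-- The mutual information between input and output of the channel `K`, extended to unnormalised
input weights as a homogeneous function. -/
noncomputable def scaledInfo (P : A → ℝ) (K : A → Y → ℝ) : ℝ :=
  ∑ x, ∑ y, P x * K x y * Real.logb 2 (K x y * (∑ x', P x') / ∑ x', P x' * K x' y)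

theorem scaledInfo_eq_channelInfo {P : A → ℝ} (hP : ∑ x, P x = 1) (K : A → Y → ℝ) :
    scaledInfo P K = channelInfo P K := by simp [scaledInfo, channelInfo, hP]

theorem scaledInfo_const_mul (t : ℝ) (P : A → ℝ) (K : A → Y → ℝ) :
    scaledInfo (fun x => t * P x) K = t * scaledInfo P K := by
  rcases eq_or_ne t 0 with rfl | ht
  · simp [scaledInfo]
  simp only [scaledInfo, mul_assoc, ← mul_sum]
  congr 1
  refine sum_congr rfl fun x _ => ?_
  congr 1
  refine sum_congr rfl fun y _ => ?_
  rw [mul_left_comm (K x y), mul_div_mul_left _ _ ht]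

theorem scaledInfo_eq_mul_channelInfo {P : A → ℝ} (hP : ∑ x, P x ≠ 0) (K : A → Y → ℝ) :
    scaledInfo P K = (∑ x, P x) * channelInfo (fun x => (∑ x, P x)⁻¹ * P x) K := by
  rw [← scaledInfo_eq_channelInfo (by rw [← mul_sum, inv_mul_cancel₀ hP]), ← scaledInfo_const_mul]
  congr 1
  ext x
  rw [mul_inv_cancel_left₀ hP]

theorem scaledInfo_zero {P : A → ℝ} (hP : ∀ x, P x = 0) (K : A → Y → ℝ) : scaledInfo P K = 0 := by
  simp [scaledInfo, hP]

/-- Inputs with the same image under `φ` have the same row of the channel, so their weights can be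
pooled. -/
theorem scaledInfo_comp (P : A → ℝ) (φ : A → B) (K : B → Y → ℝ) :
    scaledInfo P (fun x => K (φ x)) = scaledInfo (pmfLaw P φ) K := by
  simp only [scaledInfo, sum_pmfLaw, sum_pmfLaw_mul P φ (fun x => K x _), mul_assoc, ← mul_sum]
  rw [sum_pmfLaw_mul P φ (fun x => ∑ y, (K x y * Real.logb 2 (K x y * (∑ x', P x') /
    ∑ x', P x' * K (φ x') y)))]

theorem scaledInfo_nonneg {P : A → ℝ} (hP : ∀ x, 0 ≤ P x) {K : A → Y → ℝ}
    (hK : ∀ x, K x ∈ stdSimplex ℝ Y) : 0 ≤ scaledInfo P K := by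
  have hK0 : ∀ x y, 0 ≤ K x y := fun x => (hK x).1
  have hS : 0 ≤ ∑ x, P x := sum_nonneg fun x _ => hP x
  have hPK : ∀ y, 0 ≤ ∑ x, P x * K x y := fun y => sum_nonneg fun x _ => mul_nonneg (hP x) (hK0 x y)
  have hpos : ∀ x y, 0 < P x * K x y → 0 < P x ∧ 0 < K x y ∧ 0 < ∑ x, P x ∧ 0 < ∑ x, P x * K x y := by
    intro x y h
    have h1 : 0 < P x := (hP x).lt_of_ne fun e => h.ne' (by rw [← e, zero_mul])
    have h2 : 0 < K x y := (hK0 x y).lt_of_ne fun e => h.ne' (by rw [← e, mul_zero])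
    exact ⟨h1, h2, sum_pos' (fun x _ => hP x) ⟨x, mem_univ _, h1⟩,
      sum_pos' (fun x _ => mul_nonneg (hP x) (hK0 x y)) ⟨x, mem_univ _, h⟩⟩
  have := sum_mul_logb_div_nonneg (a := fun t : A × Y => P t.1 * K t.1 t.2)
    (b := fun t => P t.1 * (∑ x, P x * K x t.2) / ∑ x, P x)
    (fun t => mul_nonneg (hP _) (hK0 _ _)) (fun t => div_nonneg (mul_nonneg (hP _) (hPK _)) hS)
    (fun t h => by
      obtain ⟨h1, h2, h3, h4⟩ := hpos _ _ h
      positivity) (le_of_eq (by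
      simp only [Fintype.sum_prod_type, ← mul_sum, ← sum_div, (hK _).2, mul_one]
      rw [sum_comm]
      simp only [← mul_sum, (hK _).2, mul_one, ← sum_mul]
      exact mul_self_div_self _))
  refine this.trans (le_of_eq ?_)
  simp only [Fintype.sum_prod_type, scaledInfo]
  refine sum_congr rfl fun x _ => sum_congr rfl fun y _ => ?_
  rcases (mul_nonneg (hP x) (hK0 x y)).eq_or_lt with h | h
  · simp [← h]
  obtain ⟨h1, h2, h3, h4⟩ := hpos x y h
  congr 2
  field_simp

/-- The information gained by merging the inputs `P c` is the information between `c` and the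
output. -/
theorem scaledInfo_sum_sub {P : C → A → ℝ} (hP : ∀ c x, 0 ≤ P c x) {K : A → Y → ℝ}
    (hK : ∀ x y, 0 ≤ K x y) :
    scaledInfo (fun x => ∑ c, P c x) K - ∑ c, scaledInfo (P c) K =
      ∑ c, ∑ y, (∑ x, P c x * K x y) * Real.logb 2 ((∑ x, P c x * K x y) * (∑ c, ∑ x, P c x) /
        ((∑ x, P c x) * ∑ c, ∑ x, P c x * K x y)) := by
  have e1 : scaledInfo (fun x => ∑ c, P c x) K = ∑ c, ∑ y, ∑ x, P c x * K x y *
      Real.logb 2 (K x y * (∑ c, ∑ x, P c x) / ∑ c, ∑ x, P c x * K x y) := by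
    simp only [scaledInfo, sum_mul]
    rw [sum_comm, sum_comm (γ := C)]
    refine sum_congr rfl fun y _ => ?_
    rw [sum_comm]
    simp only [sum_comm (s := (univ : Finset A)) (t := (univ : Finset C))]
  rw [e1]
  simp only [scaledInfo]
  rw [← sum_sub_distrib]
  refine sum_congr rfl fun c _ => ?_
  rw [sum_comm (s := (univ : Finset A)), ← sum_sub_distrib]
  refine sum_congr rfl fun y _ => ?_
  rw [sum_mul, ← sum_sub_distrib]
  refine sum_congr rfl fun x _ => ?_
  rw [← mul_sub]
  rcases (mul_nonneg (hP c x) (hK x y)).eq_or_lt with h | h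
  · simp [← h]
  congr 1
  have h1 : 0 < P c x := (hP c x).lt_of_ne fun e => h.ne' (by rw [← e, zero_mul])
  have h2 : 0 < K x y := (hK x y).lt_of_ne fun e => h.ne' (by rw [← e, mul_zero])
  have h3 : 0 < ∑ x, P c x := sum_pos' (fun x _ => hP c x) ⟨x, mem_univ _, h1⟩
  have h4 : 0 < ∑ x, P c x * K x y :=
    sum_pos' (fun x _ => mul_nonneg (hP c x) (hK x y)) ⟨x, mem_univ _, h⟩
  have h5 : 0 < ∑ c, ∑ x, P c x :=
    sum_pos' (fun c _ => sum_nonneg fun x _ => hP c x) ⟨c, mem_univ _, h3⟩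
  have h6 : 0 < ∑ c, ∑ x, P c x * K x y :=
    sum_pos' (fun c _ => sum_nonneg fun x _ => mul_nonneg (hP c x) (hK x y)) ⟨c, mem_univ _, h4⟩
  -- `K x y` cancels in the difference of the logarithms, so the ratio left depends on `c` and `y`
  -- only.
  rw [← Real.logb_div (by positivity) (by positivity)]
  congr 1
  field_simp

/-- Concavity of mutual information in the input law, stated for unnormalised slices. By
`scaledInfo_sum_sub` the gain is itself the information of a channel, the one from `c` to the
output. -/
theorem sum_scaledInfo_le {P : C → A → ℝ} (hP : ∀ c x, 0 ≤ P c x) {K : A → Y → ℝ}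
    (hK : ∀ x, K x ∈ stdSimplex ℝ Y) :
    ∑ c, scaledInfo (P c) K ≤ scaledInfo (fun x => ∑ c, P c x) K := by
  have hK0 : ∀ x y, 0 ≤ K x y := fun x => (hK x).1
  rw [← sub_nonneg, scaledInfo_sum_sub hP hK0]
  have hnn : ∀ c y, 0 ≤ ∑ x, P c x * K x y :=
    fun c y => sum_nonneg fun x _ => mul_nonneg (hP c x) (hK0 x y)
  rcases isEmpty_or_nonempty A with hA | hA
  · simp
  let x₀ := Classical.arbitrary A
  -- A slice of mass zero has no conditional output law; any row of `K` serves there, as its weight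
  -- is zero.
  have := scaledInfo_nonneg (P := fun c => ∑ x, P c x)
    (K := fun c y => if ∑ x, P c x = 0 then K x₀ y else
      (∑ x, P c x * K x y) / ∑ x, P c x) (fun c => sum_nonneg fun x _ => hP c x)
  have h2 := this (fun c => by
    by_cases h0 : ∑ x, P c x = 0
    · simp only [h0, if_true]; exact hK _
    · simp only [h0, if_false]
      refine ⟨fun y => div_nonneg (hnn c y) (sum_nonneg fun x _ => hP c x), ?_⟩
      rw [← sum_div, sum_comm]
      simp only [← mul_sum, (hK _).2, mul_one]
      exact div_self h0)
  refine h2.trans (le_of_eq ?_)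
  have hz : ∀ c, ∑ x, P c x = 0 → ∀ x, P c x = 0 := fun c h x =>
    (sum_eq_zero_iff_of_nonneg fun x _ => hP c x).1 h x (mem_univ x)
  have e : ∀ c y, (∑ x, P c x) * (if ∑ x, P c x = 0 then K x₀ y
      else (∑ x, P c x * K x y) / ∑ x, P c x) = ∑ x, P c x * K x y := by
    intro c y
    split_ifs with h0
    · simp [hz c h0]
    · field_simp
  simp only [scaledInfo, e]
  refine sum_congr rfl fun c _ => sum_congr rfl fun y _ => ?_
  by_cases h0 : ∑ x, P c x = 0
  · simp [hz c h0]
  · rw [if_neg h0]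
    congr 2
    field_simp

/-- Data processing: merging inputs gains less information about a degraded output. -/
theorem scaledInfo_sum_sub_le {P : C → A → ℝ} (hP : ∀ c x, 0 ≤ P c x) {K : A → Y → ℝ}
    (hK : ∀ x, K x ∈ stdSimplex ℝ Y) {L : Y → B → ℝ} (hL : ∀ y, L y ∈ stdSimplex ℝ B) :
    scaledInfo (fun x => ∑ c, P c x) (fun x z => ∑ y, K x y * L y z) -
        ∑ c, scaledInfo (P c) (fun x z => ∑ y, K x y * L y z) ≤
      scaledInfo (fun x => ∑ c, P c x) K - ∑ c, scaledInfo (P c) K := by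
  have hK0 : ∀ x y, 0 ≤ K x y := fun x => (hK x).1
  have hL0 : ∀ y z, 0 ≤ L y z := fun y => (hL y).1
  rw [scaledInfo_sum_sub hP hK0,
    scaledInfo_sum_sub hP fun x z => sum_nonneg fun y _ => mul_nonneg (hK0 x y) (hL0 y z)]
  set m : C → ℝ := fun c => ∑ x, P c x with hm
  set a : C → Y → ℝ := fun c y => ∑ x, P c x * K x y with ha
  have ea : ∀ c z, ∑ x, P c x * ∑ y, K x y * L y z = ∑ y, a c y * L y z := by
    intro c z
    simp only [ha, mul_sum, sum_mul]
    rw [sum_comm]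
    simp only [mul_assoc]
  simp only [ea]
  have e0 : ∀ c y, ∑ x, P c x * K x y = a c y := fun _ _ => rfl
  have e0' : ∀ c, ∑ x, P c x = m c := fun _ => rfl
  simp only [e0, e0']
  set a₂ : C → B → ℝ := fun c z => ∑ y, a c y * L y z with ha₂
  have e2 : ∀ c z, ∑ y, a c y * L y z = a₂ c z := fun _ _ => rfl
  simp only [e2]
  set M := ∑ c, m c
  set b : Y → ℝ := fun y => ∑ c, a c y with hb
  set b₂ : B → ℝ := fun z => ∑ c, a₂ c z with hb₂
  have a0 : ∀ c y, 0 ≤ a c y := fun c y => sum_nonneg fun x _ => mul_nonneg (hP c x) (hK0 x y)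
  have a20 : ∀ c z, 0 ≤ a₂ c z := fun c z => sum_nonneg fun y _ => mul_nonneg (a0 c y) (hL0 y z)
  have b0 : ∀ y, 0 ≤ b y := fun y => sum_nonneg fun c _ => a0 c y
  have b20 : ∀ z, 0 ≤ b₂ z := fun z => sum_nonneg fun c _ => a20 c z
  have m0 : ∀ c, 0 ≤ m c := fun c => sum_nonneg fun x _ => hP c x
  have hb₂' : ∀ z, b₂ z = ∑ y, b y * L y z := by
    intro z
    simp only [hb₂, ha₂, hb, sum_mul]
    exact sum_comm
  have hpos : ∀ c y z, 0 < a c y * L y z →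
      0 < a c y ∧ 0 < L y z ∧ 0 < b y ∧ 0 < a₂ c z ∧ 0 < b₂ z ∧ 0 < m c ∧ 0 < M := by
    intro c y z h
    have h1 : 0 < a c y := (a0 c y).lt_of_ne fun e => h.ne' (by rw [← e, zero_mul])
    have h2 : 0 < L y z := (hL0 y z).lt_of_ne fun e => h.ne' (by rw [← e, mul_zero])
    have h3 : 0 < a₂ c z := sum_pos' (fun y _ => mul_nonneg (a0 c y) (hL0 y z)) ⟨y, mem_univ _, h⟩
    have hm : 0 < m c := (m0 c).lt_of_ne fun e => h1.ne' (by
      refine sum_eq_zero fun x hx => ?_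
      rw [(sum_eq_zero_iff_of_nonneg fun x _ => hP c x).1 e.symm x hx, zero_mul])
    exact ⟨h1, h2, sum_pos' (fun c _ => a0 c y) ⟨c, mem_univ _, h1⟩, h3,
      sum_pos' (fun c _ => a20 c z) ⟨c, mem_univ _, h3⟩, hm,
      sum_pos' (fun c _ => m0 c) ⟨c, mem_univ _, hm⟩⟩
  -- The difference of the two gains is `I(C; Y | Z)`: Gibbs' inequality compares the weights of
  -- `(c, y, z)` with those that make `c` and `y` conditionally independent given `z`.
  have := sum_mul_logb_div_nonneg (a := fun t : C × Y × B => a t.1 t.2.1 * L t.2.1 t.2.2)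
    (b := fun t => a₂ t.1 t.2.2 * (b t.2.1 * L t.2.1 t.2.2) / b₂ t.2.2)
    (fun t => mul_nonneg (a0 _ _) (hL0 _ _))
    (fun t => div_nonneg (mul_nonneg (a20 _ _) (mul_nonneg (b0 _) (hL0 _ _))) (b20 _))
    (fun t h => by
      obtain ⟨h1, h2, h3, h4, h5, -, -⟩ := hpos _ _ _ h
      positivity) (le_of_eq (by
      simp only [Fintype.sum_prod_type]
      refine sum_congr rfl fun c _ => ?_
      rw [sum_comm]
      simp only [← mul_sum, ← sum_div, ← hb₂', (hL _).2, mul_one]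
      have : ∀ z, a₂ c z * b₂ z / b₂ z = a₂ c z := by
        intro z
        rcases (b20 z).eq_or_lt with h | h
        · have := (sum_eq_zero_iff_of_nonneg fun c _ => a20 c z).1 h.symm c (mem_univ c)
          rw [this]; simp
        · field_simp
      rw [sum_congr rfl fun z _ => this z, sum_comm (s := (univ : Finset B))]
      simp only [← mul_sum, (hL _).2, mul_one]))
  rw [← sub_nonneg]
  refine this.trans (le_of_eq ?_)
  simp only [Fintype.sum_prod_type]
  rw [← sum_sub_distrib]
  refine sum_congr rfl fun c _ => ?_
  have hl : ∀ y, a c y * Real.logb 2 (a c y * M / (m c * b y)) =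
      ∑ z, a c y * L y z * Real.logb 2 (a c y * M / (m c * b y)) := by
    intro y; rw [← sum_mul, ← mul_sum, (hL y).2, mul_one]
  have hr : ∑ z, a₂ c z * Real.logb 2 (a₂ c z * M / (m c * b₂ z)) =
      ∑ y, ∑ z, a c y * L y z * Real.logb 2 (a₂ c z * M / (m c * b₂ z)) := by
    rw [sum_comm]; simp only [← sum_mul, e2]
  have hl' := sum_congr rfl fun y (_ : y ∈ (univ : Finset Y)) => hl y
  refine Eq.trans ?_ (congrArg₂ (· - ·) hl'.symm hr.symm)
  rw [← sum_sub_distrib]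
  refine sum_congr rfl fun y _ => ?_
  rw [← sum_sub_distrib]
  refine sum_congr rfl fun z _ => ?_
  rw [← mul_sub]
  rcases (mul_nonneg (a0 c y) (hL0 y z)).eq_or_lt with h | h
  · simp [← h]
  obtain ⟨h1, h2, h3, h4, h5, h6, h7⟩ := hpos _ _ _ h
  rw [← Real.logb_div (by positivity) (by positivity)]
  congr 2
  field_simp

variable {Ω : Type*} [Fintype Ω]

/-- By homogeneity the unnormalised weights `Q · c` encode both the conditional input law and the
probability of `c`. -/
theorem condMutualInfo_eq_sum_scaledInfo {p : Ω → ℝ} {X : Ω → A} {O : Ω → Y} {Z : Ω → C}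
    {Q : A → C → ℝ} {K : A → C → Y → ℝ} (hK : ∀ a c, K a c ∈ stdSimplex ℝ Y)
    (h : ∀ a y c, pmfLaw p (fun ω => (X ω, O ω, Z ω)) (a, y, c) = Q a c * K a c y) :
    condMutualInfo p X O Z = ∑ c, scaledInfo (fun a => Q a c) (fun a => K a c) := by
  have h1 : ∀ a c, pmfLaw p (fun ω => (X ω, Z ω)) (a, c) = Q a c := by
    intro a c
    rw [pmfLaw_fst_thd p X O Z]
    simp only [h, ← mul_sum, (hK _ _).2, mul_one]
  have h2 : ∀ y c, pmfLaw p (fun ω => (O ω, Z ω)) (y, c) = ∑ a, Q a c * K a c y := by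
    intro y c
    rw [pmfLaw_snd p X (fun ω => (O ω, Z ω))]
    simp only [h]
  have h3 : ∀ c, pmfLaw p Z c = ∑ a, Q a c := by
    intro c
    rw [pmfLaw_snd p X Z]
    simp only [h1]
  simp only [condMutualInfo, h, h1, h2, h3, scaledInfo]
  have : ∀ F : A → Y → C → ℝ, ∑ a, ∑ y, ∑ c, F a y c = ∑ c, ∑ a, ∑ y, F a y c := by
    intro F
    rw [sum_congr rfl fun a _ => sum_comm, sum_comm]
  rw [this]
  refine sum_congr rfl fun c _ => sum_congr rfl fun a _ => sum_congr rfl fun y _ => ?_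
  by_cases hQ : Q a c = 0
  · simp [hQ]
  · rw [mul_assoc (Q a c) (K a c y) (∑ a, Q a c), mul_div_mul_left _ _ hQ]

/-- For the Markov chain `V → X → O` one has `I(V; O) = I(X; O) - I(X; O | V)`; here `P` is the
joint law of `V` and `X`. -/
theorem mutualInfo_eq_scaledInfo_sub {p : Ω → ℝ} (hp : ∑ ω, p ω = 1) {V : Ω → C} {O : Ω → Y}
    {P : C → A → ℝ} {K : A → Y → ℝ} (hP : ∀ c x, 0 ≤ P c x) (hK : ∀ x, K x ∈ stdSimplex ℝ Y)
    (h : ∀ c y, pmfLaw p (fun ω => (V ω, O ω)) (c, y) = ∑ x, P c x * K x y) :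
    mutualInfo p V O = scaledInfo (fun x => ∑ c, P c x) K - ∑ c, scaledInfo (P c) K := by
  have h1 : ∀ c, pmfLaw p V c = ∑ x, P c x := by
    intro c
    rw [pmfLaw_fst p V O]
    simp only [h]
    rw [sum_comm]
    simp only [← mul_sum, (hK _).2, mul_one]
  have h2 : ∀ y, pmfLaw p O y = ∑ c, ∑ x, P c x * K x y := by
    intro y
    rw [pmfLaw_snd p V O]
    simp only [h]
  have h3 : ∑ c, ∑ x, P c x = 1 := by
    rw [← hp, ← sum_pmfLaw p V]
    simp only [h1]
  rw [scaledInfo_sum_sub hP fun x => (hK x).1, h3]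
  simp only [mutualInfo, h, h1, h2, mul_one]

end ScaledInfo

/-! ### The rate region in terms of two marginals of the input law. -/

namespace MADBChannel

variable {q : ℕ} [NeZero q] {𝒴 : Type*} [Fintype 𝒴]

/-- The law of the first user's output, less that user's input, given the input of the third. -/
def kernel₁ (W : MADBChannel q 𝒴) (x y : ZMod q) : ℝ := W.noise₁ (y - x)

/-- The degradation from the first to the second user. -/
def degradation (W : MADBChannel q 𝒴) (y z : ZMod q) : ℝ := W.noise₂ (z - y)

/-- The law of the second user's output, less that user's input, given the input of the third. -/
def kernel₂ (W : MADBChannel q 𝒴) (x z : ZMod q) : ℝ := ∑ y, W.kernel₁ x y * W.degradation y z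

theorem shift_mem {p : ZMod q → ℝ} (hp : p ∈ stdSimplex ℝ (ZMod q)) (x : ZMod q) :
    (fun y => p (y - x)) ∈ stdSimplex ℝ (ZMod q) :=
  ⟨fun _ => hp.1 _, by rw [← hp.2]; exact Fintype.sum_equiv (Equiv.subRight x) _ _ fun _ => rfl⟩

theorem kernel₁_mem (W : MADBChannel q 𝒴) (x : ZMod q) : W.kernel₁ x ∈ stdSimplex ℝ (ZMod q) :=
  shift_mem W.noise₁_mem x

theorem degradation_mem (W : MADBChannel q 𝒴) (y : ZMod q) :
    W.degradation y ∈ stdSimplex ℝ (ZMod q) :=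
  shift_mem W.noise₂_mem y

theorem kernel₂_mem (W : MADBChannel q 𝒴) (x : ZMod q) : W.kernel₂ x ∈ stdSimplex ℝ (ZMod q) := by
  refine ⟨fun z => sum_nonneg fun y _ => mul_nonneg ((W.kernel₁_mem x).1 y)
    ((W.degradation_mem y).1 z), ?_⟩
  simp only [kernel₂]
  rw [sum_comm]
  simp only [← mul_sum, (W.degradation_mem _).2, mul_one, (W.kernel₁_mem x).2]

theorem mac_nonneg (W : MADBChannel q 𝒴) (x₁ x₂ x₃ : ZMod q) (y : 𝒴) : 0 ≤ W.mac x₁ x₂ x₃ y :=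
  (W.mac_mem x₁ x₂ x₃).1 y

variable {𝒱 : Type*} [Fintype 𝒱]

/-- The law of the inputs when `P` is the law of the inputs and the auxiliary variable. -/
def inputMarginal (P : ZMod q × ZMod q × ZMod q × 𝒱 → ℝ) (x₁ x₂ x₃ : ZMod q) : ℝ :=
  ∑ v, P (x₁, x₂, x₃, v)

/-- The law of the auxiliary variable and the third input. -/
def auxMarginal (P : ZMod q × ZMod q × ZMod q × 𝒱 → ℝ) (v : 𝒱) (x₃ : ZMod q) : ℝ :=
  ∑ x₁, ∑ x₂, P (x₁, x₂, x₃, v)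

theorem jointLaw_mem (W : MADBChannel q 𝒴) {P : ZMod q × ZMod q × ZMod q × 𝒱 → ℝ}
    (hP : P ∈ stdSimplex ℝ (ZMod q × ZMod q × ZMod q × 𝒱)) :
    W.jointLaw P ∈ stdSimplex ℝ (ZMod q × ZMod q × ZMod q × 𝒱 × 𝒴 × ZMod q × ZMod q) := by
  refine ⟨fun ω => mul_nonneg (mul_nonneg (mul_nonneg (hP.1 _) (W.mac_nonneg _ _ _ _))
    (W.noise₁_mem.1 _)) (W.noise₂_mem.1 _), ?_⟩
  rw [← hP.2]
  simp only [Fintype.sum_prod_type, jointLaw, ← mul_sum, W.noise₁_mem.2, W.noise₂_mem.2, mul_one,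
    (W.mac_mem _ _ _).2]

/-- Here and in the next four lemmas, summing out the unused variables leaves a marginal and a
channel kernel. These factorizations feed the `scaledInfo` formulas and later the converse. -/
theorem jointLaw_law₁ (W : MADBChannel q 𝒴) (P : ZMod q × ZMod q × ZMod q × 𝒱 → ℝ)
    (a : ZMod q) (y : 𝒴) (c : ZMod q × ZMod q) :
    pmfLaw (W.jointLaw P) (fun ω => (ω.1, ω.2.2.2.2.1, ω.2.1, ω.2.2.1)) (a, y, c) =
      inputMarginal P a c.1 c.2 * W.mac a c.1 c.2 y := by
  classical
  obtain ⟨c, d⟩ := c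
  rw [pmfLaw_eq_sum_ite]
  simp only [Fintype.sum_prod_type, jointLaw, Prod.mk.injEq, ite_and, inputMarginal, sum_mul]
  simp [← mul_sum, W.noise₁_mem.2, W.noise₂_mem.2]

theorem jointLaw_law₂ (W : MADBChannel q 𝒴) (P : ZMod q × ZMod q × ZMod q × 𝒱 → ℝ)
    (a : ZMod q) (y : 𝒴) (c : ZMod q × ZMod q) :
    pmfLaw (W.jointLaw P) (fun ω => (ω.2.1, ω.2.2.2.2.1, ω.1, ω.2.2.1)) (a, y, c) =
      inputMarginal P c.1 a c.2 * W.mac c.1 a c.2 y := by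
  classical
  obtain ⟨c, d⟩ := c
  rw [pmfLaw_eq_sum_ite]
  simp only [Fintype.sum_prod_type, jointLaw, Prod.mk.injEq, ite_and, inputMarginal, sum_mul]
  simp [← mul_sum, W.noise₁_mem.2, W.noise₂_mem.2]

theorem jointLaw_law₁₂ (W : MADBChannel q 𝒴) (P : ZMod q × ZMod q × ZMod q × 𝒱 → ℝ)
    (a : ZMod q × ZMod q) (y : 𝒴) (c : ZMod q) :
    pmfLaw (W.jointLaw P) (fun ω => ((ω.1, ω.2.1), ω.2.2.2.2.1, ω.2.2.1)) (a, y, c) =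
      inputMarginal P a.1 a.2 c * W.mac a.1 a.2 c y := by
  classical
  obtain ⟨a, b⟩ := a
  rw [pmfLaw_eq_sum_ite]
  simp only [Fintype.sum_prod_type, jointLaw, Prod.mk.injEq, ite_and, inputMarginal, sum_mul]
  simp [← mul_sum, W.noise₁_mem.2, W.noise₂_mem.2]

theorem jointLaw_law₃₁ (W : MADBChannel q 𝒴) (P : ZMod q × ZMod q × ZMod q × 𝒱 → ℝ)
    (x y : ZMod q) (v : 𝒱) :
    pmfLaw (W.jointLaw P) (fun ω => (ω.2.2.1, ω.2.2.1 + ω.2.2.2.2.2.1, ω.2.2.2.1)) (x, y, v) =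
      auxMarginal P v x * W.kernel₁ x y := by
  classical
  rw [pmfLaw_eq_sum_ite]
  simp only [Fintype.sum_prod_type, jointLaw, Prod.mk.injEq, ite_and, auxMarginal, sum_mul, kernel₁]
  have : ∀ x z : ZMod q, (x + z = y) = (z = y - x) := fun x z => by
    rw [eq_sub_iff_add_eq']
  simp only [this]
  simp [← mul_sum, ← sum_mul, W.noise₂_mem.2, (W.mac_mem _ _ _).2]

theorem jointLaw_law₃₂ (W : MADBChannel q 𝒴) (P : ZMod q × ZMod q × ZMod q × 𝒱 → ℝ)
    (v : 𝒱) (z : ZMod q) :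
    pmfLaw (W.jointLaw P)
      (fun ω => (ω.2.2.2.1, ω.2.2.1 + ω.2.2.2.2.2.1 + ω.2.2.2.2.2.2)) (v, z) =
      ∑ x, auxMarginal P v x * W.kernel₂ x z := by
  classical
  rw [pmfLaw_eq_sum_ite]
  simp only [Fintype.sum_prod_type, jointLaw, Prod.mk.injEq, ite_and, auxMarginal, sum_mul, kernel₂,
    kernel₁, degradation]
  have : ∀ x y w : ZMod q, (x + y + w = z) = (w = z - (x + y)) := fun x y w => by
    rw [eq_sub_iff_add_eq']
  simp only [this]
  simp
  -- The substitution `y = x + z₁` turns the convolution of the noises into the composition of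
  -- `kernel₁` with `degradation`.
  have hs : ∀ x : ZMod q, ∑ i, W.noise₁ i * W.noise₂ (z - (x + i)) =
      ∑ i, W.noise₁ (i - x) * W.noise₂ (z - i) := by
    intro x
    refine Fintype.sum_equiv (Equiv.addLeft x) _ _ fun i => ?_
    simp
  simp only [mul_assoc, ← mul_sum]
  simp only [← sum_mul, (W.mac_mem _ _ _).2, one_mul, hs]
  rw [sum_congr rfl fun a _ => sum_comm, sum_comm]
  refine sum_congr rfl fun c _ => ?_
  simp only [sum_mul]

/-- Three bounds involve only `inputMarginal`, two only `auxMarginal`. So `(X₁, X₂)` can be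
decoupled from `(V, X₃)` without changing the broadcast bounds. -/
theorem mem_rateRegion (W : MADBChannel q 𝒴) {P : ZMod q × ZMod q × ZMod q × 𝒱 → ℝ}
    (hP : P ∈ stdSimplex ℝ (ZMod q × ZMod q × ZMod q × 𝒱)) (R₁₃ R₂₃ R₃₁ R₃₂ : ℝ) :
    (R₁₃, R₂₃, R₃₁, R₃₂) ∈ W.rateRegion P ↔ 0 ≤ R₁₃ ∧ 0 ≤ R₂₃ ∧ 0 ≤ R₃₁ ∧ 0 ≤ R₃₂ ∧
      R₁₃ ≤ ∑ x₂, ∑ x₃, scaledInfo (fun x₁ => inputMarginal P x₁ x₂ x₃)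
        (fun x₁ => W.mac x₁ x₂ x₃) ∧
      R₂₃ ≤ ∑ x₁, ∑ x₃, scaledInfo (fun x₂ => inputMarginal P x₁ x₂ x₃)
        (fun x₂ => W.mac x₁ x₂ x₃) ∧
      R₁₃ + R₂₃ ≤ ∑ x₃, scaledInfo (fun x : ZMod q × ZMod q => inputMarginal P x.1 x.2 x₃)
        (fun x => W.mac x.1 x.2 x₃) ∧
      R₃₁ ≤ ∑ v, scaledInfo (auxMarginal P v) W.kernel₁ ∧
      R₃₂ ≤ scaledInfo (fun x => ∑ v, auxMarginal P v x) W.kernel₂ -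
        ∑ v, scaledInfo (auxMarginal P v) W.kernel₂ := by
  have h1 := condMutualInfo_eq_sum_scaledInfo (K := fun a (c : ZMod q × ZMod q) => W.mac a c.1 c.2)
    (fun a c => W.mac_mem a c.1 c.2) (W.jointLaw_law₁ P)
  have h2 := condMutualInfo_eq_sum_scaledInfo (K := fun a (c : ZMod q × ZMod q) => W.mac c.1 a c.2)
    (fun a c => W.mac_mem c.1 a c.2) (W.jointLaw_law₂ P)
  have h3 := condMutualInfo_eq_sum_scaledInfo (K := fun (a : ZMod q × ZMod q) c => W.mac a.1 a.2 c)
    (fun a c => W.mac_mem a.1 a.2 c) (W.jointLaw_law₁₂ P)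
  have h4 := condMutualInfo_eq_sum_scaledInfo (K := fun a _ => W.kernel₁ a)
    (fun a _ => W.kernel₁_mem a) (W.jointLaw_law₃₁ P)
  have h5 := mutualInfo_eq_scaledInfo_sub (W.jointLaw_mem hP).2
    (fun v x => sum_nonneg fun _ _ => sum_nonneg fun _ _ => hP.1 _) W.kernel₂_mem
    (W.jointLaw_law₃₂ P)
  simp only [Fintype.sum_prod_type] at h1 h2
  simp only [rateRegion, Set.mem_ofPred_eq]
  rw [h1, h2, h3, h4, h5]
  rfl

end MADBChannel

/-! ### Reduction of the auxiliary alphabet and use of the symmetry conditions. -/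

/-- Homogeneity carries an assumption about probability laws over to unnormalised slices; slices of
mass zero carry no information. The next lemma is the analogue for equalities. -/
theorem scaledInfo_le_of_channelInfo_le {A Y : Type*} [Fintype A] [Fintype Y] {K : A → Y → ℝ}
    {c : ℝ} (h : ∀ P ∈ stdSimplex ℝ A, channelInfo P K ≤ c) {P : A → ℝ} (hP : ∀ x, 0 ≤ P x) :
    scaledInfo P K ≤ (∑ x, P x) * c := by
  by_cases h0 : ∑ x, P x = 0
  · rw [h0, zero_mul, scaledInfo_zero]
    exact fun x => (sum_eq_zero_iff_of_nonneg fun x _ => hP x).1 h0 x (mem_univ x)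
  · have h1 : 0 ≤ ∑ x, P x := sum_nonneg fun x _ => hP x
    rw [scaledInfo_eq_mul_channelInfo h0]
    refine mul_le_mul_of_nonneg_left (h _ ⟨fun x => mul_nonneg (inv_nonneg.2 h1) (hP x), ?_⟩) h1
    rw [← mul_sum, inv_mul_cancel₀ h0]

theorem scaledInfo_congr_of_channelInfo {A Y : Type*} [Fintype A] [Fintype Y] {K K' : A → Y → ℝ}
    (h : ∀ P ∈ stdSimplex ℝ A, channelInfo P K = channelInfo P K') {P : A → ℝ}
    (hP : ∀ x, 0 ≤ P x) : scaledInfo P K = scaledInfo P K' := by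
  by_cases h0 : ∑ x, P x = 0
  · have := fun x => (sum_eq_zero_iff_of_nonneg fun x _ => hP x).1 h0 x (mem_univ x)
    rw [scaledInfo_zero this, scaledInfo_zero this]
  · have h1 : 0 ≤ ∑ x, P x := sum_nonneg fun x _ => hP x
    rw [scaledInfo_eq_mul_channelInfo h0, scaledInfo_eq_mul_channelInfo h0, h]
    refine ⟨fun x => mul_nonneg (inv_nonneg.2 h1) (hP x), ?_⟩
    rw [← mul_sum, inv_mul_cancel₀ h0]

/-- A finite conic combination can be rewritten with at most as many terms as the dimension,
without increasing a given linear cost. -/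
theorem exists_weights_card_support_le {E ι : Type*} [AddCommGroup E] [Module ℝ E]
    [FiniteDimensional ℝ E] [Fintype ι] (f : ι → E) (ℓ : E →ₗ[ℝ] ℝ) (hℓ : ∀ i, 0 < ℓ (f i))
    (c : ι → ℝ) :
    ∃ w : ι → ℝ, (∀ i, 0 ≤ w i) ∧ ∑ i, w i • f i = ∑ i, f i ∧ ∑ i, w i * c i ≤ ∑ i, c i ∧
      #{i | w i ≠ 0} ≤ Module.finrank ℝ E := by
  classical
  let good : (ι → ℝ) → Prop := fun w =>
    (∀ i, 0 ≤ w i) ∧ ∑ i, w i • f i = ∑ i, f i ∧ ∑ i, w i * c i ≤ ∑ i, c i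
  have hex : ∃ m, ∃ w, good w ∧ #{i | w i ≠ 0} = m :=
    ⟨_, fun _ => 1, ⟨fun _ => zero_le_one, by simp, by simp⟩, rfl⟩
  -- Admissible weights of smallest support: if the support exceeded the dimension, a linear
  -- dependence would allow it to shrink.
  obtain ⟨w, ⟨hw0, hwf, hwc⟩, hcard⟩ := Nat.find_spec hex
  refine ⟨w, hw0, hwf, hwc, ?_⟩
  by_contra hlt
  push Not at hlt
  let s : Finset ι := {i | w i ≠ 0}
  have hdep : ¬ LinearIndependent ℝ (fun i : s => f i) := by
    intro hli
    have := hli.fintype_card_le_finrank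
    rw [Fintype.card_coe] at this
    exact absurd this (not_le.2 hlt)
  -- The sign of the dependence is chosen so that moving along `d` does not raise the cost.
  have hd : ∃ d : ι → ℝ, (∀ i, w i = 0 → d i = 0) ∧ ∑ i, d i • f i = 0 ∧ (∃ i, d i ≠ 0) ∧
      ∑ i, d i * c i ≤ 0 := by
    rw [Fintype.not_linearIndependent_iff] at hdep
    obtain ⟨g, hg, i₀, hi₀⟩ := hdep
    let d : ι → ℝ := fun i => if h : i ∈ s then g ⟨i, h⟩ else 0
    have h1 : ∀ i, w i = 0 → d i = 0 := fun i hi => by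
      have : i ∉ s := by simp [s, hi]
      simp [d, this]
    have h2 : ∑ i, d i • f i = 0 := by
      rw [← hg, ← sum_subset (subset_univ s) (fun i _ hi => by simp [d, hi]), ← sum_coe_sort s]
      exact sum_congr rfl fun i _ => by simp [d]
    have h3 : d i₀ ≠ 0 := by simpa [d] using hi₀
    rcases le_total (∑ i, d i * c i) 0 with h | h
    · exact ⟨d, h1, h2, ⟨i₀, h3⟩, h⟩
    · exact ⟨-d, fun i hi => by simp [h1 i hi], by simp [h2], ⟨i₀, by simpa using h3⟩, by simpa using h⟩
  obtain ⟨d, hd1, hd2, ⟨i₀, hi₀⟩, hd4⟩ := hd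
  -- A nonzero dependence without negative entries would contradict the positivity of `ℓ`. So moving
  -- along `d` must reach the boundary of the orthant.
  have hneg : ∃ i, d i < 0 := by
    by_contra hno
    push Not at hno
    have h := congrArg ℓ hd2
    simp only [map_sum, map_smul, smul_eq_mul, map_zero] at h
    rw [sum_eq_zero_iff_of_nonneg fun i _ => mul_nonneg (hno i) (hℓ i).le] at h
    rcases mul_eq_zero.1 (h i₀ (mem_univ _)) with h | h
    · exact hi₀ h
    · exact (hℓ i₀).ne' h
  -- The smallest ratio is the first time at which a weight reaches zero.
  obtain ⟨j, hj, hmin⟩ := exists_min_image ({i | d i < 0} : Finset ι) (fun i => w i / (-d i))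
    (by obtain ⟨i, hi⟩ := hneg; exact ⟨i, by simp [hi]⟩)
  simp only [mem_filter, mem_univ, true_and] at hj hmin
  set t := w j / (-d j) with ht
  have ht0 : 0 ≤ t := div_nonneg (hw0 j) (by linarith)
  have hzero : w j + t * d j = 0 := by
    rw [ht, div_neg, neg_mul, div_mul_cancel₀ _ hj.ne, add_neg_cancel]
  have hwj : w j ≠ 0 := fun h => hj.ne (hd1 j h)
  have hgood : good (fun i => w i + t * d i) := by
    refine ⟨fun i => ?_, ?_, ?_⟩
    · rcases le_or_gt 0 (d i) with h | h
      · have := hw0 i; positivity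
      · have := hmin i h
        rw [le_div_iff₀ (by linarith)] at this
        linarith
    · simp only [add_smul, sum_add_distrib, mul_smul, ← smul_sum, hwf, hd2, smul_zero, add_zero]
    · simp only [add_mul, sum_add_distrib, mul_assoc, ← mul_sum]
      nlinarith [mul_nonneg ht0 (neg_nonneg.2 hd4)]
  have hlt' : #{i | w i + t * d i ≠ 0} < #{i | w i ≠ 0} := by
    refine card_lt_card ⟨fun i hi => ?_, fun hsub => ?_⟩
    · simp only [mem_filter, mem_univ, true_and] at hi ⊢
      intro h
      exact hi (by rw [h, hd1 i h]; simp)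
    · have := hsub (show j ∈ _ by simpa using hwj)
      simp [hzero] at this
  exact Nat.find_min hex (hlt'.trans_eq hcard) ⟨_, hgood, rfl⟩

namespace MADBChannel

variable {q : ℕ} [NeZero q] {𝒴 : Type*} [Fintype 𝒴] {𝒱 : Type*} [Fintype 𝒱]

/-- The count `q + 1` is the dimension of what is kept exactly: the `q` values of the law of `X₃`
and one conditional information for user 1. The conditional information for user 2 is the cost and
may decrease, because it enters the bound on `R₃₂` with a minus sign. -/
theorem exists_small_alphabet (W : MADBChannel q 𝒴) {P : 𝒱 × ZMod q → ℝ}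
    (hP : P ∈ stdSimplex ℝ (𝒱 × ZMod q)) :
    ∃ k ≤ q + 1, ∃ P' ∈ stdSimplex ℝ (Fin k × ZMod q),
      (∀ x, ∑ j, P' (j, x) = ∑ v, P (v, x)) ∧
      ∑ j, scaledInfo (fun x => P' (j, x)) W.kernel₁ = ∑ v, scaledInfo (fun x => P (v, x)) W.kernel₁ ∧
      ∑ j, scaledInfo (fun x => P' (j, x)) W.kernel₂ ≤
        ∑ v, scaledInfo (fun x => P (v, x)) W.kernel₂ := by
  classical
  -- Symbols of mass zero are dropped so that the total mass `F` is a strictly positive functional.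
  let ι := {v : 𝒱 // 0 < ∑ x, P (v, x)}
  let F : ((ZMod q → ℝ) × ℝ) →ₗ[ℝ] ℝ :=
    (∑ x, LinearMap.proj x : (ZMod q → ℝ) →ₗ[ℝ] ℝ) ∘ₗ LinearMap.fst ℝ _ _
  obtain ⟨w, hw0, hwf, hwc, hcard⟩ := exists_weights_card_support_le
    (fun v : ι => ((fun x => P (v, x), scaledInfo (fun x => P (v, x)) W.kernel₁) :
      (ZMod q → ℝ) × ℝ)) F (fun v => by simpa [F] using v.2)
    (fun v => scaledInfo (fun x => P (v, x)) W.kernel₂)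
  have hz : ∀ v, v ∉ ({v | 0 < ∑ x, P (v, x)} : Finset 𝒱) → ∀ x, P (v, x) = 0 := by
    intro v hv x
    simp only [mem_filter, mem_univ, true_and, not_lt] at hv
    have := le_antisymm hv (sum_nonneg fun x _ => hP.1 (v, x))
    exact (sum_eq_zero_iff_of_nonneg fun x _ => hP.1 (v, x)).1 this x (mem_univ x)
  have hrestrict : ∀ G : 𝒱 → ℝ, (∀ v, (∀ x, P (v, x) = 0) → G v = 0) →
      ∑ v : ι, G v = ∑ v, G v := by
    intro G hG
    rw [← sum_subset (subset_univ ({v | 0 < ∑ x, P (v, x)} : Finset 𝒱))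
      fun v _ hv => hG v (hz v hv)]
    exact (sum_subtype _ (by simp) G).symm
  let s : Finset ι := {i | w i ≠ 0}
  have hs : s.card ≤ q + 1 := by simpa using hcard
  let e : Fin s.card ≃ s := s.equivFin.symm
  have htransfer : ∀ G : ι → ℝ, ∑ j, w (e j) * G (e j) = ∑ v : ι, w v * G v := by
    intro G
    rw [e.sum_comp (fun v : s => w v * G v), sum_coe_sort s (fun v => w v * G v)]
    refine sum_subset (subset_univ s) fun v _ hv => ?_
    have : w v = 0 := by simpa [s] using hv
    rw [this, zero_mul]
  have hmarg : ∀ x, ∑ j, w (e j) * P ((e j : ι), x) = ∑ v, P (v, x) := by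
    intro x
    rw [htransfer (fun v => P (v, x)), ← hrestrict (fun v => P (v, x)) fun v h => h x]
    have := congrFun (congrArg Prod.fst hwf) x
    simpa [Prod.fst_sum] using this
  refine ⟨s.card, hs, fun t => w (e t.1) * P ((e t.1 : ι), t.2),
    ⟨fun t => mul_nonneg (hw0 _) (hP.1 _), ?_⟩, hmarg, ?_, ?_⟩
  · rw [Fintype.sum_prod_type_right]
    simp only [hmarg]
    rw [← hP.2, Fintype.sum_prod_type_right]
  · simp only [scaledInfo_const_mul]
    rw [htransfer (fun v => scaledInfo (fun x => P (v, x)) W.kernel₁),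
      ← hrestrict (fun v => scaledInfo (fun x => P (v, x)) W.kernel₁)
        fun v h => scaledInfo_zero h _]
    have := congrArg Prod.snd hwf
    simpa [Prod.snd_sum] using this
  · simp only [scaledInfo_const_mul]
    rw [htransfer (fun v => scaledInfo (fun x => P (v, x)) W.kernel₂),
      ← hrestrict (fun v => scaledInfo (fun x => P (v, x)) W.kernel₂)
        fun v h => scaledInfo_zero h _]
    exact hwc

theorem productInput_mem {P₁ P₂ : ZMod q → ℝ} {P₃ : 𝒱 × ZMod q → ℝ}
    (h₁ : P₁ ∈ stdSimplex ℝ (ZMod q)) (h₂ : P₂ ∈ stdSimplex ℝ (ZMod q))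
    (h₃ : P₃ ∈ stdSimplex ℝ (𝒱 × ZMod q)) :
    productInput P₁ P₂ P₃ ∈ stdSimplex ℝ (ZMod q × ZMod q × ZMod q × 𝒱) := by
  refine ⟨fun ω => mul_nonneg (mul_nonneg (h₁.1 _) (h₂.1 _)) (h₃.1 _), ?_⟩
  have h := h₃.2
  rw [Fintype.sum_prod_type_right] at h
  simp only [Fintype.sum_prod_type, productInput, ← mul_sum, h, mul_one, h₂.2, h₁.2]

theorem mem_rateRegion_productInput (W : MADBChannel q 𝒴) {P₁ P₂ : ZMod q → ℝ}
    {P₃ : 𝒱 × ZMod q → ℝ} (h₁ : P₁ ∈ stdSimplex ℝ (ZMod q)) (h₂ : P₂ ∈ stdSimplex ℝ (ZMod q))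
    (h₃ : P₃ ∈ stdSimplex ℝ (𝒱 × ZMod q)) (R₁₃ R₂₃ R₃₁ R₃₂ : ℝ) :
    (R₁₃, R₂₃, R₃₁, R₃₂) ∈ W.rateRegion (productInput P₁ P₂ P₃) ↔
      0 ≤ R₁₃ ∧ 0 ≤ R₂₃ ∧ 0 ≤ R₃₁ ∧ 0 ≤ R₃₂ ∧
      R₁₃ ≤ ∑ x₂, ∑ x₃, (P₂ x₂ * ∑ v, P₃ (v, x₃)) * channelInfo P₁ (fun x₁ => W.mac x₁ x₂ x₃) ∧
      R₂₃ ≤ ∑ x₁, ∑ x₃, (P₁ x₁ * ∑ v, P₃ (v, x₃)) * channelInfo P₂ (fun x₂ => W.mac x₁ x₂ x₃) ∧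
      R₁₃ + R₂₃ ≤ ∑ x₃, (∑ v, P₃ (v, x₃)) *
        channelInfo (fun x : ZMod q × ZMod q => P₁ x.1 * P₂ x.2) (fun x => W.mac x.1 x.2 x₃) ∧
      R₃₁ ≤ ∑ v, scaledInfo (fun x => P₃ (v, x)) W.kernel₁ ∧
      R₃₂ ≤ scaledInfo (fun x => ∑ v, P₃ (v, x)) W.kernel₂ -
        ∑ v, scaledInfo (fun x => P₃ (v, x)) W.kernel₂ := by
  have hin : ∀ x₁ x₂ x₃, inputMarginal (productInput P₁ P₂ P₃) x₁ x₂ x₃ =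
      P₁ x₁ * P₂ x₂ * ∑ v, P₃ (v, x₃) := by
    intro x₁ x₂ x₃
    simp only [inputMarginal, productInput, mul_sum]
  have haux : auxMarginal (productInput P₁ P₂ P₃) = fun v x₃ => P₃ (v, x₃) := by
    ext v x₃
    simp only [auxMarginal, productInput, ← sum_mul, ← mul_sum, h₁.2, h₂.2, one_mul]
  have e1 : ∀ x₂ x₃, scaledInfo (fun x₁ => P₁ x₁ * P₂ x₂ * ∑ v, P₃ (v, x₃))
      (fun x₁ => W.mac x₁ x₂ x₃) =
      (P₂ x₂ * ∑ v, P₃ (v, x₃)) * channelInfo P₁ (fun x₁ => W.mac x₁ x₂ x₃) := by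
    intro x₂ x₃
    rw [← scaledInfo_eq_channelInfo h₁.2, ← scaledInfo_const_mul]
    congr 1; ext x; ring
  have e2 : ∀ x₁ x₃, scaledInfo (fun x₂ => P₁ x₁ * P₂ x₂ * ∑ v, P₃ (v, x₃))
      (fun x₂ => W.mac x₁ x₂ x₃) =
      (P₁ x₁ * ∑ v, P₃ (v, x₃)) * channelInfo P₂ (fun x₂ => W.mac x₁ x₂ x₃) := by
    intro x₁ x₃
    rw [← scaledInfo_eq_channelInfo h₂.2, ← scaledInfo_const_mul]
    congr 1; ext x; ring
  have h12 : ∑ x : ZMod q × ZMod q, P₁ x.1 * P₂ x.2 = 1 := by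
    simp only [Fintype.sum_prod_type, ← mul_sum, h₁.2, h₂.2, mul_one]
  have e3 : ∀ x₃, scaledInfo (fun x : ZMod q × ZMod q => P₁ x.1 * P₂ x.2 * ∑ v, P₃ (v, x₃))
      (fun x => W.mac x.1 x.2 x₃) = (∑ v, P₃ (v, x₃)) *
        channelInfo (fun x : ZMod q × ZMod q => P₁ x.1 * P₂ x.2) (fun x => W.mac x.1 x.2 x₃) := by
    intro x₃
    rw [← scaledInfo_eq_channelInfo h12, ← scaledInfo_const_mul]
    congr 1; ext x; ring
  rw [W.mem_rateRegion (productInput_mem h₁ h₂ h₃)]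
  simp only [hin, haux, e1, e2, e3]

/-- Under the symmetry conditions, the rates of any joint input are also allowed by a product input
whose first factor is the distinguished law. -/
theorem rateRegion_subset_of_symmetry (W : MADBChannel q 𝒴) {Pstar : ZMod q → ℝ}
    (hPstar : Pstar ∈ stdSimplex ℝ (ZMod q))
    (hi_max : ∀ x₂ x₃ : ZMod q, ∀ P ∈ stdSimplex ℝ (ZMod q),
      channelInfo P (fun x₁ => W.mac x₁ x₂ x₃) ≤ channelInfo Pstar (fun x₁ => W.mac x₁ x₂ x₃))
    (hi_inv : ∀ x₃ x₂ x₂' : ZMod q,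
      channelInfo Pstar (fun x₁ => W.mac x₁ x₂ x₃) =
        channelInfo Pstar (fun x₁ => W.mac x₁ x₂' x₃))
    (hii : ∀ P ∈ stdSimplex ℝ (ZMod q), ∀ x₁ x₃ x₁' x₃' : ZMod q,
      channelInfo P (fun x₂ => W.mac x₁ x₂ x₃) = channelInfo P (fun x₂ => W.mac x₁' x₂ x₃'))
    (hiii_inv : ∀ P ∈ stdSimplex ℝ (ZMod q × ZMod q), ∀ x₃ x₃' : ZMod q,
      channelInfo P (fun x : ZMod q × ZMod q => W.mac x.1 x.2 x₃) =
        channelInfo P (fun x : ZMod q × ZMod q => W.mac x.1 x.2 x₃'))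
    (hiii_dom : ∀ P ∈ stdSimplex ℝ (ZMod q × ZMod q), ∀ x₃ : ZMod q,
      channelInfo P (fun x : ZMod q × ZMod q => W.mac x.1 x.2 x₃) ≤
        channelInfo (fun x : ZMod q × ZMod q => Pstar x.1 * ∑ x₁, P (x₁, x.2))
          (fun x : ZMod q × ZMod q => W.mac x.1 x.2 x₃))
    {P : ZMod q × ZMod q × ZMod q × 𝒱 → ℝ}
    (hP : P ∈ stdSimplex ℝ (ZMod q × ZMod q × ZMod q × 𝒱)) :
    ∃ P₂ ∈ stdSimplex ℝ (ZMod q), ∃ k ≤ q + 1, ∃ P₃ ∈ stdSimplex ℝ (Fin k × ZMod q),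
      W.rateRegion P ⊆ W.rateRegion (productInput Pstar P₂ P₃) := by
  set Q := inputMarginal P with hQ
  have hQ0 : ∀ x₁ x₂ x₃, 0 ≤ Q x₁ x₂ x₃ := fun x₁ x₂ x₃ => sum_nonneg fun v _ => hP.1 _
  have hQ1 : ∑ x₁, ∑ x₂, ∑ x₃, Q x₁ x₂ x₃ = 1 := by
    rw [← hP.2]; simp only [hQ, inputMarginal, Fintype.sum_prod_type]
  let P₂ : ZMod q → ℝ := fun x₂ => ∑ x₁, ∑ x₃, Q x₁ x₂ x₃
  have hP₂ : P₂ ∈ stdSimplex ℝ (ZMod q) :=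
    ⟨fun x₂ => sum_nonneg fun _ _ => sum_nonneg fun _ _ => hQ0 _ _ _, by
      rw [← hQ1]; exact sum_comm⟩
  let P₀ : 𝒱 × ZMod q → ℝ := fun t => auxMarginal P t.1 t.2
  have hP₀Q : ∀ x₃, ∑ v, P₀ (v, x₃) = ∑ x₁, ∑ x₂, Q x₁ x₂ x₃ := by
    intro x₃
    simp only [P₀, auxMarginal, hQ, inputMarginal]
    rw [sum_comm]
    exact sum_congr rfl fun _ _ => sum_comm
  have hP₀ : P₀ ∈ stdSimplex ℝ (𝒱 × ZMod q) := by
    refine ⟨fun t => sum_nonneg fun _ _ => sum_nonneg fun _ _ => hP.1 _, ?_⟩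
    rw [Fintype.sum_prod_type_right]
    simp only [hP₀Q]
    rw [← hQ1, sum_comm]
    exact sum_congr rfl fun _ _ => sum_comm
  obtain ⟨k, hk, P₃, hP₃, hm, hk1, hk2⟩ := W.exists_small_alphabet hP₀
  refine ⟨P₂, hP₂, k, hk, P₃, hP₃, ?_⟩
  rintro ⟨R₁₃, R₂₃, R₃₁, R₃₂⟩ hR
  rw [W.mem_rateRegion hP] at hR
  obtain ⟨r1, r2, r3, r4, h13, h23, h12, h31, h32⟩ := hR
  rw [W.mem_rateRegion_productInput hPstar hP₂ hP₃]
  simp only [hm]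
  have hP₀1 : ∑ x₃, ∑ v, P₀ (v, x₃) = 1 := by rw [← hP₀.2, Fintype.sum_prod_type_right]
  refine ⟨r1, r2, r3, r4, h13.trans ?_, h23.trans ?_, h12.trans ?_, h31.trans (le_of_eq hk1.symm),
    h32.trans ?_⟩
  -- Given `x₂` and `x₃`, no input beats `Pstar`, and its information depends on `x₃` alone; only
  -- the marginal of `X₃` matters, and the product input has the same one.
  · have e : ∀ x₂ x₃, channelInfo Pstar (fun x₁ => W.mac x₁ x₂ x₃) =
      channelInfo Pstar (fun x₁ => W.mac x₁ 0 x₃) := fun x₂ x₃ => hi_inv _ _ _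
    calc _ ≤ ∑ x₂, ∑ x₃, (∑ x₁, Q x₁ x₂ x₃) * channelInfo Pstar (fun x₁ => W.mac x₁ 0 x₃) := by
          refine sum_le_sum fun x₂ _ => sum_le_sum fun x₃ _ => ?_
          rw [← e x₂ x₃]
          exact scaledInfo_le_of_channelInfo_le (hi_max x₂ x₃) fun x₁ => hQ0 _ _ _
      _ = _ := by
          simp only [e]
          rw [sum_comm]
          conv_rhs => rw [sum_comm]
          refine sum_congr rfl fun x₃ _ => ?_
          rw [← sum_mul, ← sum_mul, ← sum_mul, hP₂.2, one_mul, hP₀Q, sum_comm]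
  -- All the channels from `X₂` may be exchanged for the one at `(0, 0)`; concavity then merges the
  -- conditional laws of `X₂` into the marginal `P₂`.
  · have e : ∀ x₁ x₃, channelInfo P₂ (fun x₂ => W.mac x₁ x₂ x₃) =
      channelInfo P₂ (fun x₂ => W.mac 0 x₂ 0) := fun x₁ x₃ => hii _ hP₂ _ _ _ _
    have e' : ∀ x₁ x₃, scaledInfo (fun x₂ => Q x₁ x₂ x₃) (fun x₂ => W.mac x₁ x₂ x₃) =
        scaledInfo (fun x₂ => Q x₁ x₂ x₃) (fun x₂ => W.mac 0 x₂ 0) := fun x₁ x₃ =>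
      scaledInfo_congr_of_channelInfo (fun P hP => hii P hP _ _ _ _) fun x₂ => hQ0 _ _ _
    simp only [e, ← hQ, e', ← sum_mul, ← mul_sum, hP₀1, hPstar.2, one_mul]
    have := sum_scaledInfo_le (P := fun (c : ZMod q × ZMod q) x₂ => Q c.1 x₂ c.2)
      (K := fun x₂ => W.mac 0 x₂ 0) (fun _ _ => hQ0 _ _ _) (fun x₂ => W.mac_mem 0 x₂ 0)
    simp only [Fintype.sum_prod_type] at this
    rwa [scaledInfo_eq_channelInfo hP₂.2] at this
  -- Invariance in `x₃` and concavity reduce to the marginal of `(X₁, X₂)`, and domination replaces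
  -- it by `Pstar · P₂`.
  · let P₁₂ : ZMod q × ZMod q → ℝ := fun x => ∑ x₃, Q x.1 x.2 x₃
    have hP₁₂ : P₁₂ ∈ stdSimplex ℝ (ZMod q × ZMod q) :=
      ⟨fun x => sum_nonneg fun _ _ => hQ0 _ _ _, by rw [← hQ1, Fintype.sum_prod_type]⟩
    have hprod : (fun x : ZMod q × ZMod q => Pstar x.1 * P₂ x.2) ∈ stdSimplex ℝ (ZMod q × ZMod q) :=
      ⟨fun x => mul_nonneg (hPstar.1 _) (hP₂.1 _), by
        simp only [Fintype.sum_prod_type, ← mul_sum, hPstar.2, hP₂.2, mul_one]⟩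
    have e : ∀ x₃, channelInfo (fun x : ZMod q × ZMod q => Pstar x.1 * P₂ x.2)
        (fun x => W.mac x.1 x.2 x₃) = channelInfo (fun x : ZMod q × ZMod q => Pstar x.1 * P₂ x.2)
        (fun x => W.mac x.1 x.2 0) := fun x₃ => hiii_inv _ hprod _ _
    have e' : ∀ x₃, scaledInfo (fun x : ZMod q × ZMod q => Q x.1 x.2 x₃)
        (fun x => W.mac x.1 x.2 x₃) = scaledInfo (fun x : ZMod q × ZMod q => Q x.1 x.2 x₃)
        (fun x => W.mac x.1 x.2 0) := fun x₃ =>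
      scaledInfo_congr_of_channelInfo (fun P hP => hiii_inv P hP _ _) fun x₂ => hQ0 _ _ _
    simp only [e, ← hQ, e', ← sum_mul, hP₀1, one_mul]
    have := sum_scaledInfo_le (P := fun x₃ (x : ZMod q × ZMod q) => Q x.1 x.2 x₃)
      (K := fun x => W.mac x.1 x.2 0) (fun _ _ => hQ0 _ _ _) (fun x => W.mac_mem x.1 x.2 0)
    rw [scaledInfo_eq_channelInfo hP₁₂.2] at this
    exact this.trans (hiii_dom P₁₂ hP₁₂ 0)
  · exact sub_le_sub_left hk2 _

end MADBChannel

/-! ### Achievability by random codes and superposition. -/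

theorem pmfLaw_mem {Ω A : Type*} [Fintype Ω] [Fintype A] {p : Ω → ℝ} (hp : p ∈ stdSimplex ℝ Ω)
    (f : Ω → A) : pmfLaw p f ∈ stdSimplex ℝ A :=
  ⟨pmfLaw_nonneg hp.1 f, by rw [sum_pmfLaw, hp.2]⟩

theorem pmfLaw_prodPmf {ι A B : Type*} [Fintype ι] [DecidableEq ι] [Fintype A] [Fintype B]
    (p : ι → A → ℝ) (φ : A → B) (s : ι → B) :
    pmfLaw (prodPmf p) (fun x i => φ (x i)) s = prodPmf (fun i => pmfLaw (p i) φ) s := by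
  classical
  have h := sum_prodPmf_mul_prod p (fun i a => if φ a = s i then 1 else 0)
  rw [pmfLaw_eq_sum_ite]
  simp only [mul_ite, mul_one, mul_zero, ← pmfLaw_eq_sum_ite] at h
  rw [prodPmf, ← h]
  refine sum_congr rfl fun x _ => ?_
  rw [prod_boole]
  simp [funext_iff]

/-- A letterwise function of two independent i.i.d. words is again an i.i.d. word; this gives the
law of a superposed codeword. -/
theorem sum_prodPmf_mul_map₂ {ι A B C : Type*} [Fintype ι] [DecidableEq ι] [Fintype A] [Fintype B]
    [Fintype C] (pA : A → ℝ) (pB : B → ℝ) (φ : A → B → C) (G : (ι → C) → ℝ) :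
    ∑ a : ι → A, ∑ b : ι → B, prodPmf (fun _ => pA) a * prodPmf (fun _ => pB) b *
      G (fun i => φ (a i) (b i)) =
    ∑ s : ι → C, prodPmf (fun _ => pmfLaw (fun t : A × B => pA t.1 * pB t.2)
      (fun t => φ t.1 t.2)) s * G s := by
  simp only [← pmfLaw_prodPmf]
  rw [sum_pmfLaw_mul]
  rw [← sum_arrow_prod (ι := ι) (F := fun a b => prodPmf (fun _ => pA) a * prodPmf (fun _ => pB) b *
    G (fun i => φ (a i) (b i)))]
  refine sum_congr rfl fun x _ => ?_
  simp only [prodPmf, prod_mul_distrib]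

theorem exists_le_of_average_le {C : Type*} [Fintype C] {w f : C → ℝ} (hw : w ∈ stdSimplex ℝ C)
    {ε : ℝ} (h : ∑ c, w c * f c ≤ ε) : ∃ c, f c ≤ ε := by
  by_contra! hlt
  have h1 : ∑ c, w c * (f c - ε) ≤ 0 := by
    simp only [mul_sub, sum_sub_distrib, ← sum_mul, hw.2]; linarith
  have hnn : ∀ c ∈ univ, 0 ≤ w c * (f c - ε) :=
    fun c _ => mul_nonneg (hw.1 c) (sub_nonneg.2 (hlt c).le)
  have h2 := (sum_eq_zero_iff_of_nonneg hnn).1 (le_antisymm h1 (sum_nonneg hnn))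
  have h3 : ∀ c, w c = 0 := fun c => by
    rcases mul_eq_zero.1 (h2 c (mem_univ c)) with h | h
    · exact h
    · exact absurd h (sub_pos.2 (hlt c)).ne'
  have := hw.2
  simp [h3] at this

theorem mul_mem_stdSimplex_prod {A B : Type*} [Fintype A] [Fintype B] {p : A → ℝ} {r : B → ℝ}
    (hp : p ∈ stdSimplex ℝ A) (hr : r ∈ stdSimplex ℝ B) :
    (fun t : A × B => p t.1 * r t.2) ∈ stdSimplex ℝ (A × B) :=
  ⟨fun _ => mul_nonneg (hp.1 _) (hr.1 _), by
    simp only [Fintype.sum_prod_type, ← mul_sum, hr.2, mul_one, hp.2]⟩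

namespace MADBChannel

variable {q : ℕ} [NeZero q] {𝒴 : Type*} [Fintype 𝒴]

theorem sum_prod_kernel {A B : Type*} [Fintype B] {K : A → B → ℝ}
    (hK : ∀ a, K a ∈ stdSimplex ℝ B) {n : ℕ} (a : Fin n → A) :
    ∑ y : Fin n → B, ∏ i, K (a i) (y i) = 1 := by
  have := sum_prodPmf (fun i => K (a i))
  simpa only [prodPmf, (hK _).2, prod_const_one] using this

theorem sum_prod_kernel_mul_degradation (W : MADBChannel q 𝒴) {n : ℕ} (x z : Fin n → ZMod q) :
    ∑ y : Fin n → ZMod q, (∏ i, W.kernel₁ (x i) (y i)) * ∏ i, W.degradation (y i) (z i) =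
      ∏ i, W.kernel₂ (x i) (z i) :=
  sum_prodPmf_mul_prod (fun i => W.kernel₁ (x i)) fun i y => W.degradation y (z i)

/-- For a code without feedback the error probability is at most the sum of the individual error
probabilities over the four component channels. -/
theorem sum_error_le (W : MADBChannel q 𝒴) {n : ℕ} (x₁ x₂ x₃ : Fin n → ZMod q)
    (E₁ E₂ : (Fin n → 𝒴) → Prop) (E₃ E₄ : (Fin n → ZMod q) → Prop)
    [DecidablePred E₁] [DecidablePred E₂] [DecidablePred E₃] [DecidablePred E₄]
    (bad : (Fin n → ZMod q) → (Fin n → ZMod q) → (Fin n → 𝒴) → Prop)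
    [∀ y₁ y₂ y₃, Decidable (bad y₁ y₂ y₃)]
    (hbad : ∀ y₁ y₂ y₃, bad y₁ y₂ y₃ → ¬ E₁ y₃ ∨ ¬ E₂ y₃ ∨ ¬ E₃ (y₁ - x₁) ∨ ¬ E₄ (y₂ - x₂)) :
    ∑ y₁ : Fin n → ZMod q, ∑ y₂ : Fin n → ZMod q, ∑ y₃ : Fin n → 𝒴, (if bad y₁ y₂ y₃ then
      ∏ i, W.transition (x₁ i) (x₂ i) (x₃ i) (y₁ i) (y₂ i) (y₃ i) else 0) ≤
    (∑ y, (∏ i, W.mac (x₁ i) (x₂ i) (x₃ i) (y i)) * if E₁ y then 0 else 1) +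
    (∑ y, (∏ i, W.mac (x₁ i) (x₂ i) (x₃ i) (y i)) * if E₂ y then 0 else 1) +
    (∑ y, (∏ i, W.kernel₁ (x₃ i) (y i)) * if E₃ y then 0 else 1) +
    ∑ y, (∏ i, W.kernel₂ (x₃ i) (y i)) * if E₄ y then 0 else 1 := by
  let A : (Fin n → 𝒴) → ℝ := fun y => ∏ i, W.mac (x₁ i) (x₂ i) (x₃ i) (y i)
  let B : (Fin n → ZMod q) → ℝ := fun y => ∏ i, W.kernel₁ (x₃ i) (y i)
  let D : (Fin n → ZMod q) → (Fin n → ZMod q) → ℝ := fun y z => ∏ i, W.degradation (y i) (z i)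
  have hA : ∀ y, 0 ≤ A y := fun y => prod_nonneg fun i _ => W.mac_nonneg _ _ _ _
  have hB : ∀ y, 0 ≤ B y := fun y => prod_nonneg fun i _ => (W.kernel₁_mem _).1 _
  have hD : ∀ y z, 0 ≤ D y z := fun y z => prod_nonneg fun i _ => (W.degradation_mem _).1 _
  have sA : ∑ y, A y = 1 := sum_prod_kernel
    (K := fun t : ZMod q × ZMod q × ZMod q => W.mac t.1 t.2.1 t.2.2)
    (fun t => W.mac_mem t.1 t.2.1 t.2.2) (fun i => (x₁ i, x₂ i, x₃ i))
  have sB : ∑ y, B y = 1 := sum_prod_kernel W.kernel₁_mem x₃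
  have sD : ∀ y, ∑ z, D y z = 1 := fun y => sum_prod_kernel W.degradation_mem y
  have sBD : ∀ z, ∑ y, B y * D y z = ∏ i, W.kernel₂ (x₃ i) (z i) := fun z =>
    W.sum_prod_kernel_mul_degradation x₃ z
  let i₁ : (Fin n → 𝒴) → ℝ := fun y => if E₁ y then 0 else 1
  let i₂ : (Fin n → 𝒴) → ℝ := fun y => if E₂ y then 0 else 1
  let i₃ : (Fin n → ZMod q) → ℝ := fun y => if E₃ y then 0 else 1
  let i₄ : (Fin n → ZMod q) → ℝ := fun y => if E₄ y then 0 else 1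
  -- Once the own inputs are subtracted, the output of user 3 is independent of the other two, and
  -- these form the Markov chain `x₃ → y₁ - x₁ → y₂ - x₂`.
  have hfac : ∀ y₁ y₂ y₃, ∏ i, W.transition (x₁ i) (x₂ i) (x₃ i) (y₁ i) (y₂ i) (y₃ i) =
      A y₃ * B (y₁ - x₁) * D (y₁ - x₁) (y₂ - x₂) := by
    intro y₁ y₂ y₃
    simp only [A, B, D, ← prod_mul_distrib, transition, kernel₁, degradation, Pi.sub_apply]
    refine prod_congr rfl fun i _ => ?_
    congr 2
    abel
  have hpt : ∀ y₁ y₂ y₃, (if bad y₁ y₂ y₃ then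
      ∏ i, W.transition (x₁ i) (x₂ i) (x₃ i) (y₁ i) (y₂ i) (y₃ i) else 0) ≤
      A y₃ * B (y₁ - x₁) * D (y₁ - x₁) (y₂ - x₂) * (i₁ y₃ + i₂ y₃ + i₃ (y₁ - x₁) + i₄ (y₂ - x₂)) := by
    intro y₁ y₂ y₃
    have h0 : 0 ≤ A y₃ * B (y₁ - x₁) * D (y₁ - x₁) (y₂ - x₂) :=
      mul_nonneg (mul_nonneg (hA _) (hB _)) (hD _ _)
    have hi : ∀ (p : Prop) [Decidable p], (0 : ℝ) ≤ if p then 0 else 1 := fun p _ => by split_ifs <;> norm_num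
    have n1 : 0 ≤ i₁ y₃ := hi _
    have n2 : 0 ≤ i₂ y₃ := hi _
    have n3 : 0 ≤ i₃ (y₁ - x₁) := hi _
    have n4 : 0 ≤ i₄ (y₂ - x₂) := hi _
    split_ifs with h
    · rw [hfac]
      refine le_mul_of_one_le_right h0 ?_
      rcases hbad _ _ _ h with h | h | h | h
      · have : i₁ y₃ = 1 := if_neg h
        linarith
      · have : i₂ y₃ = 1 := if_neg h
        linarith
      · have : i₃ (y₁ - x₁) = 1 := if_neg h
        linarith
      · have : i₄ (y₂ - x₂) = 1 := if_neg h
        linarith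
    · exact mul_nonneg h0 (by linarith)
  refine (sum_le_sum fun y₁ _ => sum_le_sum fun y₂ _ => sum_le_sum fun y₃ _ => hpt y₁ y₂ y₃).trans
    (le_of_eq ?_)
  calc _ = ∑ s₁, ∑ s₂, ∑ y₃, A y₃ * B s₁ * D s₁ s₂ * (i₁ y₃ + i₂ y₃ + i₃ s₁ + i₄ s₂) := by
        rw [← (Equiv.subRight x₁).sum_comp (fun s₁ => ∑ s₂, ∑ y₃, A y₃ * B s₁ * D s₁ s₂ *
          (i₁ y₃ + i₂ y₃ + i₃ s₁ + i₄ s₂))]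
        refine sum_congr rfl fun y₁ _ => ?_
        exact (Equiv.subRight x₂).sum_comp (fun s₂ => ∑ y₃, A y₃ * B (y₁ - x₁) * D (y₁ - x₁) s₂ *
          (i₁ y₃ + i₂ y₃ + i₃ (y₁ - x₁) + i₄ s₂))
    _ = ∑ s₁, ∑ s₂, B s₁ * D s₁ s₂ * ((∑ y, A y * i₁ y) + (∑ y, A y * i₂ y) + i₃ s₁ + i₄ s₂) := by
        refine sum_congr rfl fun s₁ _ => sum_congr rfl fun s₂ _ => ?_
        have : ∀ y₃, A y₃ * B s₁ * D s₁ s₂ * (i₁ y₃ + i₂ y₃ + i₃ s₁ + i₄ s₂) =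
          B s₁ * D s₁ s₂ * (A y₃ * i₁ y₃ + A y₃ * i₂ y₃ + A y₃ * i₃ s₁ + A y₃ * i₄ s₂) :=
          fun y₃ => by ring
        simp only [this, ← mul_sum, sum_add_distrib, ← sum_mul, sA, one_mul]
    _ = _ := by
        have h4 : ∑ s₁, ∑ s₂, B s₁ * D s₁ s₂ * i₄ s₂ = ∑ s₂, (∏ i, W.kernel₂ (x₃ i) (s₂ i)) * i₄ s₂ := by
          rw [sum_comm]
          simp only [← sum_mul, sBD]
        have h3 : ∑ s₁, ∑ s₂, B s₁ * D s₁ s₂ * i₃ s₁ = ∑ s₁, B s₁ * i₃ s₁ := by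
          simp only [← sum_mul, ← mul_sum, sD, mul_one]
        have h1 : ∀ c : ℝ, ∑ s₁, ∑ s₂, B s₁ * D s₁ s₂ * c = c := by
          intro c
          simp only [← sum_mul, ← mul_sum, sD, mul_one, sB, one_mul]
        simp only [mul_add, sum_add_distrib, h1, h3, h4]
        rfl

end MADBChannel

namespace MADBChannel

variable {q : ℕ} [NeZero q] {𝒴 : Type*} [Fintype 𝒴]

theorem sum_four_weights {C₁ C₂ C₃ C₄ : Type*} [Fintype C₁] [Fintype C₂] [Fintype C₃] [Fintype C₄]
    (w₁ : C₁ → ℝ) (w₂ : C₂ → ℝ) (w₃ : C₃ → ℝ) (w₄ : C₄ → ℝ) (f : C₁ → C₂ → C₃ → C₄ → ℝ) :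
    ∑ c : C₁ × C₂ × C₃ × C₄, (w₁ c.1 * (w₂ c.2.1 * (w₃ c.2.2.1 * w₄ c.2.2.2))) *
      f c.1 c.2.1 c.2.2.1 c.2.2.2 =
    ∑ c₁, ∑ c₂, w₁ c₁ * w₂ c₂ * ∑ c₃, ∑ c₄, w₃ c₃ * w₄ c₄ * f c₁ c₂ c₃ c₄ := by
  simp only [Fintype.sum_prod_type, mul_sum, mul_assoc]

theorem weighted_sum_comm₄ {C M₁ M₂ M₃ M₄ : Type*} [Fintype C] [Fintype M₁] [Fintype M₂]
    [Fintype M₃] [Fintype M₄] (w : C → ℝ) (F : C → M₁ → M₂ → M₃ → M₄ → ℝ) :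
    ∑ c, w c * ∑ m₁, ∑ m₂, ∑ m₃, ∑ m₄, F c m₁ m₂ m₃ m₄ =
      ∑ m₁, ∑ m₂, ∑ m₃, ∑ m₄, ∑ c, w c * F c m₁ m₂ m₃ m₄ := by
  simp only [mul_sum]
  rw [sum_comm]
  refine sum_congr rfl fun _ _ => ?_
  rw [sum_comm]
  refine sum_congr rfl fun _ _ => ?_
  rw [sum_comm]
  exact sum_congr rfl fun _ _ => sum_comm

/-- The code without feedback with the codebooks `c₁`, `c₂`, `c₃`. The decoders of the first two users
see the channel output less the own input, that of the third knows its own input. -/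
def openLoopCode {n k₁₃ k₂₃ k₃₁ k₃₂ : ℕ} (c₁ : Fin k₁₃ → Fin n → ZMod q)
    (c₂ : Fin k₂₃ → Fin n → ZMod q) (c₃ : Fin k₃₁ → Fin k₃₂ → Fin n → ZMod q)
    (d₁₃ : (Fin n → ZMod q) → (Fin n → 𝒴) → Fin k₁₃) (d₂₃ : (Fin n → ZMod q) → (Fin n → 𝒴) → Fin k₂₃)
    (d₃₁ : (Fin n → ZMod q) → Fin k₃₁) (d₃₂ : (Fin n → ZMod q) → Fin k₃₂) :
    MADBCode q 𝒴 n k₁₃ k₂₃ k₃₁ k₃₂ where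
  enc₁ i m _ := c₁ m i
  enc₂ i m _ := c₂ m i
  enc₃ i m m' _ := c₃ m m' i
  dec₁ m y := d₃₁ (y - c₁ m)
  dec₂ m y := d₃₂ (y - c₂ m)
  dec₃ m m' y := (d₁₃ (c₃ m m') y, d₂₃ (c₃ m m') y)

open Classical in
theorem errorProb_openLoopCode_le (W : MADBChannel q 𝒴) {n k₁₃ k₂₃ k₃₁ k₃₂ : ℕ}
    (c₁ : Fin k₁₃ → Fin n → ZMod q)
    (c₂ : Fin k₂₃ → Fin n → ZMod q) (c₃ : Fin k₃₁ → Fin k₃₂ → Fin n → ZMod q)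
    (d₁₃ : (Fin n → ZMod q) → (Fin n → 𝒴) → Fin k₁₃) (d₂₃ : (Fin n → ZMod q) → (Fin n → 𝒴) → Fin k₂₃)
    (d₃₁ : (Fin n → ZMod q) → Fin k₃₁) (d₃₂ : (Fin n → ZMod q) → Fin k₃₂) :
    W.errorProb (openLoopCode c₁ c₂ c₃ d₁₃ d₂₃ d₃₁ d₃₂) ≤
      ∑ m₁₃, ∑ m₂₃, ∑ m₃₁, ∑ m₃₂, ((k₁₃ : ℝ) * k₂₃ * k₃₁ * k₃₂)⁻¹ *
        ((∑ y, (∏ i, W.mac (c₁ m₁₃ i) (c₂ m₂₃ i) (c₃ m₃₁ m₃₂ i) (y i)) *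
          if d₁₃ (c₃ m₃₁ m₃₂) y = m₁₃ then 0 else 1) +
        (∑ y, (∏ i, W.mac (c₁ m₁₃ i) (c₂ m₂₃ i) (c₃ m₃₁ m₃₂ i) (y i)) *
          if d₂₃ (c₃ m₃₁ m₃₂) y = m₂₃ then 0 else 1) +
        (∑ y, (∏ i, W.kernel₁ (c₃ m₃₁ m₃₂ i) (y i)) * if d₃₁ y = m₃₁ then 0 else 1) +
        ∑ y, (∏ i, W.kernel₂ (c₃ m₃₁ m₃₂ i) (y i)) * if d₃₂ y = m₃₂ then 0 else 1) := by
  refine sum_le_sum fun m₁₃ _ => sum_le_sum fun m₂₃ _ => sum_le_sum fun m₃₁ _ =>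
    sum_le_sum fun m₃₂ _ => mul_le_mul_of_nonneg_left ?_ (by positivity)
  refine W.sum_error_le (c₁ m₁₃) (c₂ m₂₃) (c₃ m₃₁ m₃₂) (fun y => d₁₃ (c₃ m₃₁ m₃₂) y = m₁₃)
    (fun y => d₂₃ (c₃ m₃₁ m₃₂) y = m₂₃) (fun y => d₃₁ y = m₃₁) (fun y => d₃₂ y = m₃₂)
    (fun y₁ y₂ y₃ => (d₁₃ (c₃ m₃₁ m₃₂) y₃, d₂₃ (c₃ m₃₁ m₃₂) y₃) ≠ (m₁₃, m₂₃) ∨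
      d₃₁ (y₁ - c₁ m₁₃) ≠ m₃₁ ∨ d₃₂ (y₂ - c₂ m₂₃) ≠ m₃₂) fun y₁ y₂ y₃ h => ?_
  simp only [Prod.mk.injEq, ne_eq, not_and_or] at h
  tauto

open Classical in
/-- Superposition coding for the broadcast part together with independent random codes for the two
transmitting users. The third input is `u v` where `u : 𝒱 → ZMod q` has law `pU` and `v` has law
`pV`. -/
theorem achievable_of_independent_inputs (W : MADBChannel q 𝒴) {𝒱 : Type*} [Fintype 𝒱]
    {P₁ P₂ : ZMod q → ℝ} {pU : (𝒱 → ZMod q) → ℝ} {pV : 𝒱 → ℝ} {pX : ZMod q → ℝ}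
    (h₁ : P₁ ∈ stdSimplex ℝ (ZMod q)) (h₂ : P₂ ∈ stdSimplex ℝ (ZMod q))
    (hU : pU ∈ stdSimplex ℝ (𝒱 → ZMod q)) (hV : pV ∈ stdSimplex ℝ 𝒱)
    (hX : pmfLaw (fun t : (𝒱 → ZMod q) × 𝒱 => pU t.1 * pV t.2) (fun t => t.1 t.2) = pX)
    {R₁₃ R₂₃ R₃₁ R₃₂ : ℝ} (r₁₃ : 0 ≤ R₁₃) (r₂₃ : 0 ≤ R₂₃) (r₃₁ : 0 ≤ R₃₁) (r₃₂ : 0 ≤ R₃₂)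
    (h13 : R₁₃ = 0 ∨
      R₁₃ < ∑ a, ∑ b, ∑ s, ∑ y, P₁ a * P₂ b * pX s * W.mac a b s y *
        Real.logb 2 (W.mac a b s y / ∑ a', P₁ a' * W.mac a' b s y) ∧
      R₁₃ + R₂₃ < ∑ a, ∑ b, ∑ s, ∑ y, P₁ a * P₂ b * pX s * W.mac a b s y *
        Real.logb 2 (W.mac a b s y / ∑ a', ∑ b', P₁ a' * P₂ b' * W.mac a' b' s y))
    (h23 : R₂₃ = 0 ∨
      R₂₃ < ∑ b, ∑ a, ∑ s, ∑ y, P₂ b * P₁ a * pX s * W.mac a b s y *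
        Real.logb 2 (W.mac a b s y / ∑ b', P₂ b' * W.mac a b' s y) ∧
      R₂₃ + R₁₃ < ∑ b, ∑ a, ∑ s, ∑ y, P₂ b * P₁ a * pX s * W.mac a b s y *
        Real.logb 2 (W.mac a b s y / ∑ b', ∑ a', P₂ b' * P₁ a' * W.mac a' b' s y))
    (h31 : R₃₁ = 0 ∨
      R₃₁ < ∑ u, ∑ v, ∑ _s : Unit, ∑ y, pU u * pV v * 1 * W.kernel₁ (u v) y *
        Real.logb 2 (W.kernel₁ (u v) y / ∑ u', pU u' * W.kernel₁ (u' v) y) ∧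
      R₃₁ + R₃₂ < ∑ u, ∑ v, ∑ _s : Unit, ∑ y, pU u * pV v * 1 * W.kernel₁ (u v) y *
        Real.logb 2 (W.kernel₁ (u v) y / ∑ u', ∑ v', pU u' * pV v' * W.kernel₁ (u' v') y))
    (h32 : R₃₂ = 0 ∨
      R₃₂ < ∑ v, ∑ _b : Unit, ∑ _s : Unit, ∑ y, pV v * 1 * 1 * (∑ u, pU u * W.kernel₂ (u v) y) *
        Real.logb 2 ((∑ u, pU u * W.kernel₂ (u v) y) /
          ∑ v', pV v' * ∑ u, pU u * W.kernel₂ (u v') y) ∧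
      R₃₂ + 0 < ∑ v, ∑ _b : Unit, ∑ _s : Unit, ∑ y, pV v * 1 * 1 *
        (∑ u, pU u * W.kernel₂ (u v) y) *
        Real.logb 2 ((∑ u, pU u * W.kernel₂ (u v) y) /
          ∑ v', ∑ _b' : Unit, pV v' * 1 * ∑ u, pU u * W.kernel₂ (u v') y)) :
    W.Achievable R₁₃ R₂₃ R₃₁ R₃₂ := by
  have hpX : pX ∈ stdSimplex ℝ (ZMod q) := hX ▸ pmfLaw_mem (mul_mem_stdSimplex_prod hU hV) _
  have hunit : (fun _ : Unit => (1 : ℝ)) ∈ stdSimplex ℝ Unit := ⟨fun _ => zero_le_one, by simp⟩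
  have hKbar : ∀ v, (fun y => ∑ u, pU u * W.kernel₂ (u v) y) ∈ stdSimplex ℝ (ZMod q) := fun v =>
    ⟨fun y => sum_nonneg fun u _ => mul_nonneg (hU.1 u) ((W.kernel₂_mem _).1 y), by
      rw [sum_comm]; simp only [← mul_sum, (W.kernel₂_mem _).2, mul_one, hU.2]⟩
  -- User 3 knows its own codeword, which plays the role of an i.i.d. state of law `pX`.
  obtain ⟨d₁₃, ε₁₃, l₁₃, b₁₃⟩ := random_coding_tendsto (K := fun a b s => W.mac a b s) h₁ h₂ hpX
    (fun a b s => W.mac_mem a b s) h13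
  obtain ⟨d₂₃, ε₂₃, l₂₃, b₂₃⟩ := random_coding_tendsto (K := fun b a s => W.mac a b s) h₂ h₁ hpX
    (fun b a s => W.mac_mem a b s) h23
  -- User 1 sees a multiple-access channel with inputs `U` and `V` and trivial state.
  obtain ⟨d₃₁, ε₃₁, l₃₁, b₃₁⟩ := random_coding_tendsto (pS := fun _ : Unit => (1 : ℝ))
    (K := fun (u : 𝒱 → ZMod q) v _ => W.kernel₁ (u v)) hU hV hunit
    (fun u v _ => W.kernel₁_mem (u v)) h31
  -- User 2 treats `U` as noise: its channel is averaged over `pU`, and the second sender is a dummy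
  -- of rate zero.
  obtain ⟨d₃₂, ε₃₂, l₃₂, b₃₂⟩ := random_coding_tendsto (pB := fun _ : Unit => (1 : ℝ))
    (pS := fun _ : Unit => (1 : ℝ))
    (K := fun (v : 𝒱) _ _ y => ∑ u, pU u * W.kernel₂ (u v) y) hV hunit hunit
    (fun v _ _ => hKbar v) h32
  let w₁ := fun n => prodPmf (fun _ : Fin (numMessages n R₁₃) => prodPmf fun _ : Fin n => P₁)
  let w₂ := fun n => prodPmf (fun _ : Fin (numMessages n R₂₃) => prodPmf fun _ : Fin n => P₂)
  let w₃ := fun n => prodPmf (fun _ : Fin (numMessages n R₃₁) => prodPmf fun _ : Fin n => pU)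
  let w₄ := fun n => prodPmf (fun _ : Fin (numMessages n R₃₂) => prodPmf fun _ : Fin n => pV)
  have hw₁ : ∀ n, w₁ n ∈ stdSimplex ℝ _ := fun n => prodPmf_mem fun _ => prodPmf_mem fun _ => h₁
  have hw₂ : ∀ n, w₂ n ∈ stdSimplex ℝ _ := fun n => prodPmf_mem fun _ => prodPmf_mem fun _ => h₂
  have hw₃ : ∀ n, w₃ n ∈ stdSimplex ℝ _ := fun n => prodPmf_mem fun _ => prodPmf_mem fun _ => hU
  have hw₄ : ∀ n, w₄ n ∈ stdSimplex ℝ _ := fun n => prodPmf_mem fun _ => prodPmf_mem fun _ => hV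
  have hsuper : ∀ (n : ℕ) (m₃₁ : Fin (numMessages n R₃₁)) (m₃₂ : Fin (numMessages n R₃₂))
      (G : (Fin n → ZMod q) → ℝ), ∑ cu, ∑ cv, w₃ n cu * w₄ n cv * G (fun i => cu m₃₁ i (cv m₃₂ i)) =
        ∑ s, prodPmf (fun _ => pX) s * G s := by
    intro n m₃₁ m₃₂ G
    rw [← hX, ← sum_prodPmf_mul_map₂ pU pV (fun u v => u v) G]
    exact sum_codebooks (prodPmf_mem fun _ => hU).2 (prodPmf_mem fun _ => hV).2 m₃₁ m₃₂
      (fun u v => G fun i => u i (v i))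
  let code : (n : ℕ) →
      (Fin (numMessages n R₁₃) → Fin n → ZMod q) × (Fin (numMessages n R₂₃) → Fin n → ZMod q) ×
      (Fin (numMessages n R₃₁) → Fin n → 𝒱 → ZMod q) × (Fin (numMessages n R₃₂) → Fin n → 𝒱) →
      MADBCode q 𝒴 n (numMessages n R₁₃) (numMessages n R₂₃) (numMessages n R₃₁)
        (numMessages n R₃₂) := fun n c =>
    openLoopCode c.1 c.2.1 (fun m m' i => c.2.2.1 m i (c.2.2.2 m' i)) (d₁₃ n c.1 c.2.1)
      (d₂₃ n c.2.1 c.1) (d₃₁ n c.2.2.1 c.2.2.2 fun _ => ())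
      (d₃₂ n c.2.2.2 (fun _ _ => ()) fun _ => ())
  let w := fun n (c : (Fin (numMessages n R₁₃) → Fin n → ZMod q) ×
      (Fin (numMessages n R₂₃) → Fin n → ZMod q) ×
      (Fin (numMessages n R₃₁) → Fin n → 𝒱 → ZMod q) × (Fin (numMessages n R₃₂) → Fin n → 𝒱)) =>
    w₁ n c.1 * (w₂ n c.2.1 * (w₃ n c.2.2.1 * w₄ n c.2.2.2))
  have hw : ∀ n, w n ∈ stdSimplex ℝ _ := fun n => mul_mem_stdSimplex_prod (hw₁ n)
    (mul_mem_stdSimplex_prod (hw₂ n) (mul_mem_stdSimplex_prod (hw₃ n) (hw₄ n)))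
  -- The bounds are uniform in the messages, so one average over all four codebooks controls the
  -- four errors together and a single choice of codebooks is good for all of them.
  have hmain : ∀ n, ∃ c, W.errorProb (code n c) ≤ ε₁₃ n + ε₂₃ n + ε₃₁ n + ε₃₂ n := by
    intro n
    refine exists_le_of_average_le (hw n) ?_
    set κ : ℝ := ((numMessages n R₁₃ : ℝ) * (numMessages n R₂₃) * (numMessages n R₃₁) *
      (numMessages n R₃₂))⁻¹ with hκ
    have hκ0 : 0 ≤ κ := by positivity
    have hκ1 : ∀ e : ℝ, ∑ _m₁₃ : Fin (numMessages n R₁₃), ∑ _m₂₃ : Fin (numMessages n R₂₃),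
        ∑ _m₃₁ : Fin (numMessages n R₃₁), ∑ _m₃₂ : Fin (numMessages n R₃₂), κ * e = e := by
      intro e
      have := one_le_numMessages n R₁₃
      have := one_le_numMessages n R₂₃
      have := one_le_numMessages n R₃₁
      have := one_le_numMessages n R₃₂
      simp only [sum_const, card_univ, Fintype.card_fin, nsmul_eq_mul, hκ]
      field_simp
    rw [← hκ1 (ε₁₃ n + ε₂₃ n + ε₃₁ n + ε₃₂ n)]
    refine (sum_le_sum fun c _ => mul_le_mul_of_nonneg_left
      (W.errorProb_openLoopCode_le _ _ _ _ _ _ _) ((hw n).1 c)).trans ?_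
    rw [weighted_sum_comm₄]
    refine sum_le_sum fun m₁₃ _ => sum_le_sum fun m₂₃ _ => sum_le_sum fun m₃₁ _ =>
      sum_le_sum fun m₃₂ _ => ?_
    simp only [← hκ, mul_left_comm _ κ, ← mul_sum]
    refine mul_le_mul_of_nonneg_left ?_ hκ0
    simp only [mul_add, sum_add_distrib]
    refine add_le_add (add_le_add (add_le_add ?_ ?_) ?_) ?_
    · rw [sum_four_weights (w₁ n) (w₂ n) (w₃ n) (w₄ n) (fun c₁ c₂ c₃ c₄ =>
        ∑ y : Fin n → 𝒴, (∏ i, W.mac (c₁ m₁₃ i) (c₂ m₂₃ i) (c₃ m₃₁ i (c₄ m₃₂ i)) (y i)) *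
          if d₁₃ n c₁ c₂ (fun i => c₃ m₃₁ i (c₄ m₃₂ i)) y = m₁₃ then 0 else 1)]
      refine le_trans (le_of_eq ?_) (b₁₃ n m₁₃ m₂₃)
      refine sum_congr rfl fun c₁ _ => sum_congr rfl fun c₂ _ => ?_
      congr 1
      simp only [← mul_sum]
      exact hsuper n m₃₁ m₃₂ (fun s => ∑ y : Fin n → 𝒴,
        (∏ i, W.mac (c₁ m₁₃ i) (c₂ m₂₃ i) (s i) (y i)) * if d₁₃ n c₁ c₂ s y = m₁₃ then 0 else 1)
    · rw [sum_four_weights (w₁ n) (w₂ n) (w₃ n) (w₄ n) (fun c₁ c₂ c₃ c₄ =>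
        ∑ y : Fin n → 𝒴, (∏ i, W.mac (c₁ m₁₃ i) (c₂ m₂₃ i) (c₃ m₃₁ i (c₄ m₃₂ i)) (y i)) *
          if d₂₃ n c₂ c₁ (fun i => c₃ m₃₁ i (c₄ m₃₂ i)) y = m₂₃ then 0 else 1), sum_comm]
      refine le_trans (le_of_eq ?_) (b₂₃ n m₂₃ m₁₃)
      refine sum_congr rfl fun c₂ _ => sum_congr rfl fun c₁ _ => ?_
      rw [mul_comm (w₁ n c₁)]
      congr 1
      simp only [← mul_sum]
      exact hsuper n m₃₁ m₃₂ (fun s => ∑ y : Fin n → 𝒴,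
        (∏ i, W.mac (c₁ m₁₃ i) (c₂ m₂₃ i) (s i) (y i)) * if d₂₃ n c₂ c₁ s y = m₂₃ then 0 else 1)
    · rw [sum_four_weights (w₁ n) (w₂ n) (w₃ n) (w₄ n) (fun _ _ c₃ c₄ =>
        ∑ y : Fin n → ZMod q, (∏ i, W.kernel₁ (c₃ m₃₁ i (c₄ m₃₂ i)) (y i)) *
          if d₃₁ n c₃ c₄ (fun _ => ()) y = m₃₁ then 0 else 1)]
      simp only [← sum_mul, ← mul_sum, (hw₂ n).2, (hw₁ n).2, one_mul]
      refine le_trans (le_of_eq ?_) (b₃₁ n m₃₁ m₃₂)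
      refine sum_congr rfl fun c₃ _ => sum_congr rfl fun c₄ _ => ?_
      congr 1
      rw [Fintype.sum_unique (ι := Fin n → Unit)]
      simp only [prodPmf, prod_const_one, one_mul]
    · rw [sum_four_weights (w₁ n) (w₂ n) (w₃ n) (w₄ n) (fun _ _ c₃ c₄ =>
        ∑ y : Fin n → ZMod q, (∏ i, W.kernel₂ (c₃ m₃₁ i (c₄ m₃₂ i)) (y i)) *
          if d₃₂ n c₄ (fun _ _ => ()) (fun _ => ()) y = m₃₂ then 0 else 1)]
      simp only [← sum_mul, ← mul_sum, (hw₂ n).2, (hw₁ n).2, one_mul]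
      refine le_trans (le_of_eq ?_) (b₃₂ n m₃₂ ⟨0, numMessages_pos n 0⟩)
      rw [sum_comm]
      refine sum_congr rfl fun c₄ _ => ?_
      rw [Fintype.sum_unique (ι := Fin (numMessages n 0) → Fin n → Unit),
        Fintype.sum_unique (ι := Fin n → Unit)]
      -- The decoder of user 2 does not look at the `U`-codebook, so averaging over it produces
      -- exactly the averaged channel.
      have hu : ∀ (v y : Fin n → _), ∑ c₃, w₃ n c₃ * ∏ i, W.kernel₂ (c₃ m₃₁ i (v i)) (y i) =
          ∏ i, ∑ u, pU u * W.kernel₂ (u (v i)) (y i) := by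
        intro v y
        rw [← sum_prodPmf_mul_prod (fun _ : Fin n => pU) (fun i u => W.kernel₂ (u (v i)) (y i))]
        exact sum_prodPmf_mul_apply (p := fun _ : Fin (numMessages n R₃₁) =>
          prodPmf fun _ : Fin n => pU) (fun _ => (prodPmf_mem fun _ => hU).2) m₃₁
          (fun u => ∏ i, W.kernel₂ (u i (v i)) (y i))
      simp only [prodPmf, prod_const_one, mul_one, one_mul]
      simp only [mul_sum]
      rw [sum_comm]
      refine sum_congr rfl fun y _ => ?_
      rw [← hu, sum_mul, mul_sum]
      refine sum_congr rfl fun c₃ _ => ?_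
      simp only [w₃, w₄, prodPmf]
      ring_nf
  choose c hc using hmain
  refine ⟨r₁₃, r₂₃, r₃₁, r₃₂, fun n => code n (c n), ?_⟩
  have hlim := ((l₁₃.add l₂₃).add l₃₁).add l₃₂
  simp only [add_zero] at hlim
  refine squeeze_zero (fun n => ?_) hc hlim
  refine sum_nonneg fun _ _ => sum_nonneg fun _ _ => sum_nonneg fun _ _ => sum_nonneg fun _ _ =>
    mul_nonneg (by positivity) (sum_nonneg fun _ _ => sum_nonneg fun _ _ => sum_nonneg fun _ _ => ?_)
  split_ifs
  · exact prod_nonneg fun i _ => mul_nonneg (mul_nonneg (W.mac_nonneg _ _ _ _) (W.noise₁_mem.1 _))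
      (W.noise₂_mem.1 _)
  · exact le_rfl

end MADBChannel

section ChannelInfo

variable {A B S Y : Type*} [Fintype A] [Fintype B] [Fintype S] [Fintype Y]

theorem sum_channelInfo_given_second (pA : A → ℝ) (pB : B → ℝ) (pS : S → ℝ)
    (K : A → B → S → Y → ℝ) :
    ∑ b, ∑ s, (pB b * pS s) * channelInfo pA (fun a => K a b s) =
      ∑ a, ∑ b, ∑ s, ∑ y, pA a * pB b * pS s * K a b s y *
        Real.logb 2 (K a b s y / ∑ a', pA a' * K a' b s y) := by
  rw [sum_comm (s := (univ : Finset A))]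
  refine sum_congr rfl fun b _ => ?_
  rw [sum_comm (s := (univ : Finset A))]
  refine sum_congr rfl fun s _ => ?_
  simp only [channelInfo, mul_sum]
  refine sum_congr rfl fun a _ => sum_congr rfl fun y _ => ?_
  ring

theorem sum_channelInfo_pair (pA : A → ℝ) (pB : B → ℝ) (pS : S → ℝ) (K : A → B → S → Y → ℝ) :
    ∑ s, pS s * channelInfo (fun x : A × B => pA x.1 * pB x.2) (fun x => K x.1 x.2 s) =
      ∑ a, ∑ b, ∑ s, ∑ y, pA a * pB b * pS s * K a b s y *
        Real.logb 2 (K a b s y / ∑ a', ∑ b', pA a' * pB b' * K a' b' s y) := by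
  simp only [channelInfo, Fintype.sum_prod_type, mul_sum]
  rw [sum_comm]
  refine sum_congr rfl fun a _ => ?_
  rw [sum_comm]
  refine sum_congr rfl fun b _ => sum_congr rfl fun s _ => sum_congr rfl fun y _ => ?_
  ring

end ChannelInfo

namespace MADBChannel

variable {q : ℕ} [NeZero q] {𝒴 : Type*} [Fintype 𝒴] {𝒱 : Type*}

open Classical in
/-- The conditional law of the second coordinate given the first one. -/
noncomputable def condLaw (P : 𝒱 × ZMod q → ℝ) (v : 𝒱) (x : ZMod q) : ℝ :=
  -- The point mass is an arbitrary choice that keeps this a probability law when `v` has mass zero.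
  if ∑ x', P (v, x') = 0 then (if x = 0 then 1 else 0) else P (v, x) / ∑ x', P (v, x')

theorem sum_mul_condLaw {P : 𝒱 × ZMod q → ℝ} (hP : ∀ t, 0 ≤ P t) (v : 𝒱) (x : ZMod q) :
    (∑ x', P (v, x')) * condLaw P v x = P (v, x) := by
  unfold condLaw
  split_ifs with h h'
  · rw [h, zero_mul, (sum_eq_zero_iff_of_nonneg fun x _ => hP (v, x)).1 h x (mem_univ x)]
  · rw [h, zero_mul, (sum_eq_zero_iff_of_nonneg fun x _ => hP (v, x)).1 h x (mem_univ x)]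
  · rw [mul_div_cancel₀ _ h]

theorem condLaw_mem {P : 𝒱 × ZMod q → ℝ} (hP : ∀ t, 0 ≤ P t) (v : 𝒱) :
    condLaw P v ∈ stdSimplex ℝ (ZMod q) := by
  by_cases h : ∑ x', P (v, x') = 0
  · refine ⟨fun x => ?_, ?_⟩
    · simp only [condLaw, h, if_true]; split_ifs <;> norm_num
    · simp [condLaw, h]
  · refine ⟨fun x => ?_, ?_⟩
    · simp only [condLaw, h, if_false]; exact div_nonneg (hP _) (sum_nonneg fun _ _ => hP _)
    · simp only [condLaw, h, if_false]; rw [← sum_div, div_self h]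

variable [Fintype 𝒱]

/-- Shrinking by `t < 1` makes the inequalities strict for each positive rate, while rates equal to
zero need no decoding. -/
theorem scaled_rates_achievable (W : MADBChannel q 𝒴) {P₁ P₂ : ZMod q → ℝ}
    {P₃ : 𝒱 × ZMod q → ℝ} (h₁ : P₁ ∈ stdSimplex ℝ (ZMod q)) (h₂ : P₂ ∈ stdSimplex ℝ (ZMod q))
    (h₃ : P₃ ∈ stdSimplex ℝ (𝒱 × ZMod q)) {R₁₃ R₂₃ R₃₁ R₃₂ : ℝ}
    (hR : (R₁₃, R₂₃, R₃₁, R₃₂) ∈ W.rateRegion (productInput P₁ P₂ P₃)) {t : ℝ} (ht0 : 0 < t)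
    (ht1 : t < 1) : W.Achievable (t * R₁₃) (t * R₂₃) (t * R₃₁) (t * R₃₂) := by
  classical
  rw [W.mem_rateRegion_productInput h₁ h₂ h₃] at hR
  obtain ⟨r13, r23, r31, r32, h13, h23, h12, h31, h32⟩ := hR
  have h₃0 := h₃.1
  set pX : ZMod q → ℝ := fun x => ∑ v, P₃ (v, x) with hpX
  set pV : 𝒱 → ℝ := fun v => ∑ x, P₃ (v, x) with hpV
  have hV : pV ∈ stdSimplex ℝ 𝒱 := ⟨fun v => sum_nonneg fun _ _ => h₃0 _, by
    rw [← h₃.2, Fintype.sum_prod_type]⟩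
  -- Functional representation: draw `U(v)` from the conditional law of `X₃` given `v`,
  -- independently over `v`. Then `(V, U(V))` has law `P₃` although `U` and `V` are independent.
  set pU : (𝒱 → ZMod q) → ℝ := prodPmf (condLaw P₃) with hpU
  have hU : pU ∈ stdSimplex ℝ (𝒱 → ZMod q) := prodPmf_mem fun v => condLaw_mem h₃0 v
  have hcond : ∀ v x, pV v * condLaw P₃ v x = P₃ (v, x) := sum_mul_condLaw h₃0
  have hev : ∀ v (f : ZMod q → ℝ), ∑ u, pU u * f (u v) = ∑ x, condLaw P₃ v x * f x := fun v f =>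
    sum_prodPmf_mul_apply (fun v => (condLaw_mem h₃0 v).2) v f
  have hUlaw : ∀ v, pmfLaw pU (fun u => u v) = condLaw P₃ v := by
    intro v
    ext x
    rw [pmfLaw_eq_sum_ite]
    simpa using hev v (fun x' => if x' = x then 1 else 0)
  have hX : pmfLaw (fun t : (𝒱 → ZMod q) × 𝒱 => pU t.1 * pV t.2) (fun t => t.1 t.2) = pX := by
    ext x
    rw [pmfLaw_eq_sum_ite, Fintype.sum_prod_type, sum_comm]
    refine sum_congr rfl fun v _ => ?_
    rw [← hcond, ← hUlaw, pmfLaw_eq_sum_ite, mul_sum]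
    refine sum_congr rfl fun u _ => ?_
    split_ifs <;> ring
  -- Degradedness: `V` tells user 1 at least as much as user 2. Hence `R₃₁ + R₃₂ ≤ I(X₃; X₃ + Z₁)`,
  -- the sum condition that user 1 needs.
  have hdp := scaledInfo_sum_sub_le (P := fun v x => P₃ (v, x)) (fun _ _ => h₃0 _) W.kernel₁_mem
    W.degradation_mem
  have hdp' : scaledInfo pX W.kernel₂ - ∑ v, scaledInfo (fun x => P₃ (v, x)) W.kernel₂ ≤
    scaledInfo pX W.kernel₁ - ∑ v, scaledInfo (fun x => P₃ (v, x)) W.kernel₁ := hdp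
  have strict : ∀ {r c : ℝ}, 0 < r → r ≤ c → t * r < c := fun {r c} h h' => by nlinarith
  refine W.achievable_of_independent_inputs h₁ h₂ hU hV hX (by positivity) (by positivity)
    (by positivity) (by positivity) ?_ ?_ ?_ ?_
  · rcases r13.eq_or_lt with h0 | h0
    · left; rw [← h0, mul_zero]
    right
    constructor
    · refine (strict h0 h13).trans_le (le_of_eq ?_)
      exact sum_channelInfo_given_second P₁ P₂ pX W.mac
    · rw [← mul_add]
      refine (strict (by linarith) h12).trans_le (le_of_eq ?_)
      exact sum_channelInfo_pair P₁ P₂ pX W.mac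
  · rcases r23.eq_or_lt with h0 | h0
    · left; rw [← h0, mul_zero]
    right
    constructor
    · refine (strict h0 h23).trans_le (le_of_eq ?_)
      exact sum_channelInfo_given_second P₂ P₁ pX fun b a s => W.mac a b s
    · rw [← mul_add, add_comm]
      refine (strict (by linarith) h12).trans_le (le_of_eq ?_)
      refine (sum_channelInfo_pair P₁ P₂ pX W.mac).trans ?_
      rw [sum_comm]
      refine sum_congr rfl fun b _ => sum_congr rfl fun a _ => sum_congr rfl fun s _ =>
        sum_congr rfl fun y _ => ?_
      rw [sum_comm]
      simp only [mul_comm (P₁ _) (P₂ _)]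
  · rcases r31.eq_or_lt with h0 | h0
    · left; rw [← h0, mul_zero]
    right
    constructor
    · refine (strict h0 h31).trans_le (le_of_eq ?_)
      have := sum_channelInfo_given_second pU pV (fun _ : Unit => 1) fun u v _ => W.kernel₁ (u v)
      rw [← this]
      refine sum_congr rfl fun v _ => ?_
      simp only [univ_unique, sum_const, card_singleton, one_smul, mul_one]
      rw [← scaledInfo_eq_channelInfo hU.2, scaledInfo_comp pU (fun u => u v) W.kernel₁, hUlaw,
        ← scaledInfo_const_mul]
      simp only [hcond]
    · rw [← mul_add]
      refine (strict (c := scaledInfo pX W.kernel₁) (by linarith) (by linarith)).trans_le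
        (le_of_eq ?_)
      have := sum_channelInfo_pair pU pV (fun _ : Unit => 1) fun u v _ => W.kernel₁ (u v)
      rw [← this]
      simp only [univ_unique, sum_const, card_singleton, one_smul, one_mul]
      rw [← scaledInfo_eq_channelInfo (mul_mem_stdSimplex_prod hU hV).2,
        scaledInfo_comp (fun t : (𝒱 → ZMod q) × 𝒱 => pU t.1 * pV t.2) (fun t => t.1 t.2) W.kernel₁,
        hX]
  · rcases r32.eq_or_lt with h0 | h0
    · left; rw [← h0, mul_zero]
    right
    suffices h : scaledInfo pX W.kernel₂ - ∑ v, scaledInfo (fun x => P₃ (v, x)) W.kernel₂ =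
        ∑ v, ∑ y, pV v * (∑ u, pU u * W.kernel₂ (u v) y) *
        Real.logb 2 ((∑ u, pU u * W.kernel₂ (u v) y) /
          ∑ v', pV v' * ∑ u, pU u * W.kernel₂ (u v') y) by
      have := (strict h0 h32).trans_le h.le
      simpa only [univ_unique, sum_const, card_singleton, one_smul, mul_one, add_zero, and_self]
        using this
    have hk : ∀ v y, ∑ x, P₃ (v, x) * W.kernel₂ x y = pV v * ∑ u, pU u * W.kernel₂ (u v) y := by
      intro v y
      rw [hev v (fun x => W.kernel₂ x y), mul_sum]
      simp only [← mul_assoc, hcond]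
    rw [hpX, scaledInfo_sum_sub (P := fun v x => P₃ (v, x)) (fun _ _ => h₃0 _)
      (fun x => (W.kernel₂_mem x).1)]
    simp only [hk]
    refine sum_congr rfl fun v _ => sum_congr rfl fun y _ => ?_
    have e : ∀ v, ∑ x, P₃ (v, x) = pV v := fun _ => rfl
    simp only [e, hV.2, mul_one]
    by_cases h : pV v = 0
    · simp [h]
    · rw [mul_div_mul_left _ _ h]

theorem rateRegion_productInput_subset_capacityRegion (W : MADBChannel q 𝒴) {P₁ P₂ : ZMod q → ℝ}
    {P₃ : 𝒱 × ZMod q → ℝ} (h₁ : P₁ ∈ stdSimplex ℝ (ZMod q)) (h₂ : P₂ ∈ stdSimplex ℝ (ZMod q))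
    (h₃ : P₃ ∈ stdSimplex ℝ (𝒱 × ZMod q)) :
    W.rateRegion (productInput P₁ P₂ P₃) ⊆ W.capacityRegion := by
  rintro r hr
  -- The shift by two keeps every factor strictly between zero and one.
  have hlim : Tendsto (fun n : ℕ => (1 - 1 / ((n : ℝ) + 2)) • r) atTop (𝓝 r) := by
    have h : Tendsto (fun n : ℕ => 1 / ((n : ℝ) + 2)) atTop (𝓝 0) := by
      have := (tendsto_add_atTop_iff_nat 2).2 (tendsto_one_div_atTop_nhds_zero_nat (𝕜 := ℝ))
      simpa using this
    have h' := (h.const_sub 1).smul_const r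
    rwa [sub_zero, one_smul] at h'
  refine isClosed_closure.mem_of_tendsto hlim (Eventually.of_forall fun n => ?_)
  refine subset_closure (subset_convexHull ℝ _ ?_)
  have hpos : (0 : ℝ) < 1 / ((n : ℝ) + 2) := by positivity
  have hlt : 1 / ((n : ℝ) + 2) < 1 := by rw [div_lt_one (by positivity)]; linarith
  exact W.scaled_rates_achievable h₁ h₂ h₃ hr (by linarith) (by linarith)

end MADBChannel

/-! ### Laws generated by causal kernels. -/

section Causal

variable {O : Type*}

theorem sum_snoc [Fintype O] {n : ℕ} (F : (Fin (n + 1) → O) → ℝ) :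
    ∑ o, F o = ∑ o : Fin n → O, ∑ a, F (Fin.snoc o a) := by
  rw [← (Fin.snocEquiv fun _ : Fin (n + 1) => O).sum_comp, Fintype.sum_prod_type, sum_comm]
  rfl

theorem pastOf_snoc_castSucc {n : ℕ} (o : Fin n → O) (a : O) (i : Fin n) :
    pastOf (Fin.snoc o a : Fin (n + 1) → O) i.castSucc = pastOf o i := by
  ext j
  have : (Fin.castLE i.castSucc.isLt.le j : Fin (n + 1)) = (Fin.castLE i.isLt.le j).castSucc := rfl
  simp only [pastOf]
  rw [this]
  exact Fin.snoc_castSucc (α := fun _ => O) _ _ _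

theorem pastOf_snoc_last {n : ℕ} (o : Fin n → O) (a : O) :
    pastOf (Fin.snoc o a : Fin (n + 1) → O) (Fin.last n) = o := by
  ext j
  have : (Fin.castLE (Fin.last n).isLt.le j : Fin (n + 1)) = Fin.castSucc j := rfl
  simp only [pastOf]
  rw [this]
  exact Fin.snoc_castSucc (α := fun _ => O) _ _ _

/-- The law of the sequence generated by the causal kernels `K`. -/
def causalLaw {n : ℕ} (K : (i : Fin n) → (Fin i → O) → O → ℝ) (o : Fin n → O) : ℝ :=
  ∏ i, K i (pastOf o i) (o i)

theorem causalLaw_nonneg {n : ℕ} {K : (i : Fin n) → (Fin i → O) → O → ℝ}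
    (hK : ∀ i h a, 0 ≤ K i h a) (o : Fin n → O) : 0 ≤ causalLaw K o :=
  prod_nonneg fun i _ => hK i _ _

theorem causalLaw_snoc {n : ℕ} (K : (i : Fin (n + 1)) → (Fin i → O) → O → ℝ) (o : Fin n → O)
    (a : O) : causalLaw K (Fin.snoc o a : Fin (n + 1) → O) =
      causalLaw (fun i => K i.castSucc) o * K (Fin.last n) o a := by
  rw [causalLaw, Fin.prod_univ_castSucc]
  congr 1
  · refine prod_congr rfl fun i _ => ?_
    have h := pastOf_snoc_castSucc o a i
    have h' : (Fin.snoc o a : Fin (n + 1) → O) i.castSucc = o i :=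
      Fin.snoc_castSucc (α := fun _ => O) _ _ _
    rw [h, h']
  · have h := pastOf_snoc_last o a
    have h' : (Fin.snoc o a : Fin (n + 1) → O) (Fin.last n) = a :=
      Fin.snoc_last (α := fun _ => O) _ _
    rw [h, h']

variable [Fintype O]

/-- Mass below one must be allowed, because the conditional laws used as reference kernels vanish
where they are undefined. -/
theorem sum_causalLaw_le_one : ∀ {n : ℕ} {K : (i : Fin n) → (Fin i → O) → O → ℝ},
    (∀ i h a, 0 ≤ K i h a) → (∀ i h, ∑ a, K i h a ≤ 1) → ∑ o, causalLaw K o ≤ 1 := by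
  intro n
  induction n with
  | zero => intro K _ _; simp [causalLaw]
  | succ n ih =>
    intro K h0 h1
    rw [sum_snoc]
    simp only [causalLaw_snoc, ← mul_sum]
    refine le_trans (sum_le_sum fun o _ => ?_)
      (ih (fun i => h0 i.castSucc) (fun i => h1 i.castSucc))
    exact mul_le_of_le_one_right (causalLaw_nonneg (fun i => h0 i.castSucc) o) (h1 (Fin.last n) o)

theorem sum_causalLaw : ∀ {n : ℕ} {K : (i : Fin n) → (Fin i → O) → O → ℝ},
    (∀ i h, ∑ a, K i h a = 1) → ∑ o, causalLaw K o = 1 := by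
  intro n
  induction n with
  | zero => intro K _; simp [causalLaw]
  | succ n ih =>
    intro K h1
    rw [sum_snoc]
    simp only [causalLaw_snoc, ← mul_sum, h1, mul_one]
    exact ih fun i => h1 i.castSucc

/-- Averaging over the symbol at time `j` given its past does not change an expectation. -/
theorem sum_causalLaw_mul : ∀ {n : ℕ} {K : (i : Fin n) → (Fin i → O) → O → ℝ},
    (∀ i h, ∑ a, K i h a = 1) → ∀ (j : Fin n) (g : (Fin j → O) → O → ℝ),
    ∑ o, causalLaw K o * g (pastOf o j) (o j) =
      ∑ o, causalLaw K o * ∑ a, K j (pastOf o j) a * g (pastOf o j) a := by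
  intro n
  induction n with
  | zero => intro K _ j; exact j.elim0
  | succ n ih =>
    intro K h1 j
    refine Fin.lastCases ?_ (fun j => ?_) j
    · intro g
      simp only [sum_snoc (n := n), causalLaw_snoc, pastOf_snoc_last]
      refine sum_congr rfl fun o _ => ?_
      rw [← sum_mul, ← mul_sum, h1, mul_one, mul_sum]
      refine sum_congr rfl fun a _ => ?_
      have h' : (Fin.snoc o a : Fin (n + 1) → O) (Fin.last n) = a :=
        Fin.snoc_last (α := fun _ => O) _ _
      rw [h', mul_assoc]
    · intro g
      simp only [sum_snoc (n := n), causalLaw_snoc, pastOf_snoc_castSucc]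
      have h' : ∀ (o : Fin n → O) a, (Fin.snoc o a : Fin (n + 1) → O) j.castSucc = o j :=
        fun o a => Fin.snoc_castSucc (α := fun _ => O) _ _ _
      simp only [h', ← sum_mul, ← mul_sum, h1, mul_one]
      exact ih (fun i => h1 i.castSucc) j g

/-- The image under `φ` of the law generated by `K` is dominated by the law generated by kernels which
dominate the images of `K`. -/
theorem sum_causalLaw_fiber_le {B : Type*} [DecidableEq B] (φ : O → B) : ∀ {n : ℕ}
    {K : (i : Fin n) → (Fin i → O) → O → ℝ} {L : (i : Fin n) → (Fin i → B) → B → ℝ},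
    (∀ i h a, 0 ≤ K i h a) → (∀ i h b, 0 ≤ L i h b) →
    (∀ i h b, ∑ a, (if φ a = b then K i h a else 0) ≤ L i (fun j => φ (h j)) b) →
    ∀ u : Fin n → B, ∑ o, (if (fun i => φ (o i)) = u then causalLaw K o else 0) ≤
      causalLaw L u := by
  intro n
  induction n with
  | zero =>
    intro K L _ _ _ u
    simp only [causalLaw, univ_eq_empty, prod_empty, Fintype.sum_unique]
    split_ifs <;> norm_num
  | succ n ih =>
    intro K L hK hL0 hL u
    obtain ⟨⟨b, v⟩, rfl⟩ := (Fin.snocEquiv fun _ : Fin (n + 1) => B).surjective u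
    change ∑ o, (if (fun i => φ (o i)) = (Fin.snoc v b : Fin (n + 1) → B) then causalLaw K o else 0)
      ≤ causalLaw L (Fin.snoc v b : Fin (n + 1) → B)
    have hsn : ∀ (o : Fin n → O) a, ((fun i => φ ((Fin.snoc o a : Fin (n + 1) → O) i)) =
        (Fin.snoc v b : Fin (n + 1) → B)) ↔ (fun i => φ (o i)) = v ∧ φ a = b := by
      intro o a
      have h1 := Fin.snoc_last (α := fun _ : Fin (n + 1) => O) a o
      have h2 := Fin.snoc_castSucc (α := fun _ : Fin (n + 1) => O) a o
      have h3 := Fin.snoc_last (α := fun _ : Fin (n + 1) => B) b v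
      have h4 := Fin.snoc_castSucc (α := fun _ : Fin (n + 1) => B) b v
      simp only [funext_iff, Fin.forall_fin_succ', h1, h2, h3, h4]
    rw [sum_snoc, causalLaw_snoc]
    simp only [hsn, causalLaw_snoc]
    refine le_trans ?_ (mul_le_mul_of_nonneg_right
      (ih (fun i => hK i.castSucc) (fun i => hL0 i.castSucc) (fun i => hL i.castSucc) v)
      (hL0 (Fin.last n) v b))
    rw [sum_mul]
    refine sum_le_sum fun o _ => ?_
    split_ifs with h
    · subst h
      simp only [true_and]
      refine le_trans (le_of_eq ?_) (mul_le_mul_of_nonneg_left (hL (Fin.last n) o b)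
        (causalLaw_nonneg (fun i => hK i.castSucc) o))
      rw [mul_sum]
      exact sum_congr rfl fun a _ => by rw [mul_ite, mul_zero]
    · simp [h]

end Causal

/-! ### Replacing conditional laws along a sequence. -/

section ConditionalRatio

variable {U B : Type*} [Fintype U] [Fintype B] [DecidableEq U] [DecidableEq B]

/-- Replacing the conditional laws of `π u` given the past of `u` by causal kernels `r` bounds the law
of the sequence of the `π u` by the law which `r` generates. -/
theorem sum_mul_prod_ratio_le (π : U → B) : ∀ {n : ℕ} {r : (i : Fin n) → (Fin i → B) → B → ℝ},
    (∀ i h b, 0 ≤ r i h b) → ∀ {L : (Fin n → U) → ℝ} {N : (i : Fin n) → (Fin i → U) → ℝ}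
    {c : (i : Fin n) → (Fin i → U) → B → ℝ}, (∀ u, 0 ≤ L u) →
    (∀ i h, N i h = ∑ u, if pastOf u i = h then L u else 0) →
    (∀ i h b, c i h b = ∑ u, if pastOf u i = h ∧ π (u i) = b then L u else 0) →
    ∀ {G : (Fin n → B) → ℝ}, (∀ b, 0 ≤ G b) →
    ∑ u, L u * (∏ i, r i (fun j => π (pastOf u i j)) (π (u i)) * N i (pastOf u i) /
      c i (pastOf u i) (π (u i))) *
      G (fun i => π (u i)) ≤ (∑ u, L u) * ∑ b : Fin n → B, causalLaw r b * G b := by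
  intro n
  induction n with
  | zero =>
    intro r hr L N c hL hN hc G hG
    refine le_of_eq ?_
    simp only [Fintype.sum_unique, causalLaw, univ_eq_empty, prod_empty, mul_one, one_mul]
    congr 2
    exact Subsingleton.elim _ _
  | succ n ih =>
    intro r hr L N c hL hN hc G hG
    -- Induction on the last symbol: `L'` is the law of the prefix, and `G'` below absorbs the last
    -- reference kernel into the test function.
    let L' : (Fin n → U) → ℝ := fun h => ∑ a, L (Fin.snoc h a)
    have hL' : ∀ h, 0 ≤ L' h := fun h => sum_nonneg fun a _ => hL _
    have hlast : ∀ (h : Fin n → U) a, (Fin.snoc h a : Fin (n + 1) → U) (Fin.last n) = a :=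
      fun h a => Fin.snoc_last (α := fun _ => U) _ _
    have hcast : ∀ (h : Fin n → U) a (j : Fin n),
        (Fin.snoc h a : Fin (n + 1) → U) j.castSucc = h j :=
      fun h a j => Fin.snoc_castSucc (α := fun _ => U) _ _ _
    have hN' : ∀ (i : Fin n) h, N i.castSucc h = ∑ u, if pastOf u i = h then L' u else 0 := by
      intro i h
      rw [hN, sum_snoc]
      simp only [pastOf_snoc_castSucc]
      refine sum_congr rfl fun u _ => ?_
      split_ifs with hu
      · rfl
      · exact sum_const_zero
    have hc' : ∀ (i : Fin n) h b, c i.castSucc h b =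
        ∑ u, if pastOf u i = h ∧ π (u i) = b then L' u else 0 := by
      intro i h b
      rw [hc, sum_snoc]
      simp only [pastOf_snoc_castSucc, hcast]
      refine sum_congr rfl fun u _ => ?_
      split_ifs with hu
      · rfl
      · exact sum_const_zero
    have hNl : ∀ h : Fin n → U, N (Fin.last n) h = L' h := by
      intro h
      rw [hN, sum_snoc]
      simp only [pastOf_snoc_last]
      refine (Fintype.sum_eq_single h fun u hu => ?_).trans ?_
      · simp [hu]
      · simp [L']
    have hcl : ∀ (h : Fin n → U) b, c (Fin.last n) h b = ∑ a, if π a = b then L (Fin.snoc h a) else 0 := by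
      intro h b
      rw [hc, sum_snoc]
      simp only [pastOf_snoc_last, hlast]
      refine (Fintype.sum_eq_single h fun u hu => ?_).trans ?_
      · simp [hu]
      · simp
    let G' : (Fin n → B) → ℝ := fun b => ∑ b', r (Fin.last n) b b' * G (Fin.snoc b b')
    have hG' : ∀ b, 0 ≤ G' b := fun b => sum_nonneg fun b' _ => mul_nonneg (hr _ _ _) (hG _)
    have hsn : ∀ (h : Fin n → U) a, (fun i => π ((Fin.snoc h a : Fin (n + 1) → U) i)) =
        (Fin.snoc (fun i => π (h i)) (π a) : Fin (n + 1) → B) := by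
      intro h a
      ext i
      refine Fin.lastCases ?_ (fun j => ?_) i
      · rw [hlast]; exact (Fin.snoc_last (α := fun _ => B) _ _).symm
      · rw [hcast]; exact (Fin.snoc_castSucc (α := fun _ => B) (π a) (fun i => π (h i)) j).symm
    let X : (Fin n → U) → ℝ := fun h => ∏ i : Fin n, r i.castSucc (fun j => π (pastOf h i j)) (π (h i)) *
      N i.castSucc (pastOf h i) / c i.castSucc (pastOf h i) (π (h i))
    have hX : ∀ h, 0 ≤ X h := by
      intro h
      refine prod_nonneg fun i _ => ?_
      rw [hN', hc']
      refine div_nonneg (mul_nonneg (hr _ _ _) (sum_nonneg fun u _ => ?_)) (sum_nonneg fun u _ => ?_) <;>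
      · split_ifs
        · exact hL' _
        · exact le_rfl
    have hprod : ∀ (h : Fin n → U) a, ∏ i,
        r i (fun j => π (pastOf (Fin.snoc h a : Fin (n + 1) → U) i j))
          (π ((Fin.snoc h a : Fin (n + 1) → U) i)) *
        N i (pastOf (Fin.snoc h a : Fin (n + 1) → U) i) /
        c i (pastOf (Fin.snoc h a : Fin (n + 1) → U) i) (π ((Fin.snoc h a : Fin (n + 1) → U) i)) =
        X h * (r (Fin.last n) (fun j => π (h j)) (π a) * L' h / c (Fin.last n) h (π a)) := by
      intro h a
      rw [Fin.prod_univ_castSucc]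
      simp only [pastOf_snoc_castSucc, pastOf_snoc_last, hlast, hcast, hNl, X]
    rw [sum_snoc]
    simp only [hprod, hsn]
    have hstep : ∀ h : Fin n → U, ∑ a, L (Fin.snoc h a) *
        (X h * (r (Fin.last n) (fun j => π (h j)) (π a) * L' h / c (Fin.last n) h (π a))) *
          G (Fin.snoc (fun i => π (h i)) (π a) : Fin (n + 1) → B) ≤
        L' h * X h * G' (fun i => π (h i)) := by
      intro h
      have e : ∀ a, L (Fin.snoc h a) * (X h * (r (Fin.last n) (fun j => π (h j)) (π a) * L' h / c (Fin.last n) h (π a))) *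
          G (Fin.snoc (fun i => π (h i)) (π a) : Fin (n + 1) → B) =
          ∑ b, (if π a = b then L (Fin.snoc h a) else 0) *
            ((X h * (r (Fin.last n) (fun j => π (h j)) b * L' h / c (Fin.last n) h b)) *
              G (Fin.snoc (fun i => π (h i)) b : Fin (n + 1) → B)) := by
        intro a
        simp only [ite_mul, zero_mul, sum_ite_eq, mem_univ, if_true]
        ring
      simp only [e]
      rw [sum_comm]
      simp only [← sum_mul, ← hcl, G', mul_sum]
      refine sum_le_sum fun b _ => ?_
      have hcb : 0 ≤ c (Fin.last n) h b := by
        rw [hcl]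
        exact sum_nonneg fun a _ => by split_ifs; exacts [hL _, le_rfl]
      -- A symbol of conditional probability zero contributes nothing on the left, which is why only
      -- an inequality holds; otherwise `c` cancels.
      rcases hcb.eq_or_lt with h0 | h0
      · rw [← h0, zero_mul]
        exact mul_nonneg (mul_nonneg (hL' h) (hX h)) (mul_nonneg (hr _ _ b) (hG _))
      · have e' : ∀ x y l g k : ℝ, 0 < k → k * (x * (y * l / k) * g) = l * x * (y * g) := by
          intro x y l g k hk
          field_simp
        exact (e' _ _ _ _ _ h0).le
    refine (sum_le_sum fun h _ => hstep h).trans ((ih (fun i => hr i.castSucc) hL' hN' hc' hG').trans (le_of_eq ?_))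
    rw [sum_snoc (F := L), sum_snoc (F := fun b : Fin (n + 1) → B => causalLaw r b * G b)]
    congr 1
    refine sum_congr rfl fun b _ => ?_
    simp only [G', mul_sum]
    refine sum_congr rfl fun b' _ => ?_
    rw [causalLaw_snoc, ← mul_assoc]

end ConditionalRatio

/-! ### A hypothesis-testing converse. -/

section MetaConverse

variable {Ω : Type*} [Fintype Ω]

/-- A binary hypothesis testing bound: if the reference measure `p t` gives an event mass at most
`1 / k`, then `p` gives it mass bounded through the divergence. -/
theorem event_mul_logb_sub_one_le {p t : Ω → ℝ} (hp : p ∈ stdSimplex ℝ Ω) (ht : ∀ ω, 0 ≤ t ω)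
    (hpt : ∀ ω, 0 < p ω → 0 < t ω) (A : Ω → Prop) [DecidablePred A] {k : ℝ} (hk : 0 < k)
    (hA : ∑ ω, (if A ω then p ω * t ω else 0) ≤ k⁻¹) (h1 : ∑ ω, p ω * t ω ≤ 1) :
    (∑ ω, if A ω then p ω else 0) * Real.logb 2 k - 1 ≤ ∑ ω, p ω * Real.logb 2 (t ω)⁻¹ := by
  have hp0 := hp.1
  have hnn : ∀ ω, 0 ≤ p ω * t ω := fun ω => mul_nonneg (hp0 ω) (ht ω)
  -- The reference measure is enlarged by `k` on `A` and halved everywhere, which keeps its mass at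
  -- most one. The halving is the bit lost in the conclusion.
  have gibbs := sum_mul_logb_div_nonneg (a := p)
    (b := fun ω => p ω * t ω * ((if A ω then k else 1) / 2)) hp0
    (fun ω => mul_nonneg (hnn ω) (by split_ifs <;> positivity))
    (fun ω h => mul_pos (mul_pos h (hpt ω h)) (by split_ifs <;> positivity)) (by
      rw [hp.2]
      have e : ∀ ω, p ω * t ω * ((if A ω then k else 1) / 2) ≤
          (if A ω then p ω * t ω else 0) * (k / 2) + p ω * t ω * (1 / 2) := by
        intro ω
        have := hnn ω
        split_ifs <;> linarith
      refine (sum_le_sum fun ω _ => e ω).trans ?_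
      rw [sum_add_distrib, ← sum_mul, ← sum_mul]
      have h3 : (∑ ω, if A ω then p ω * t ω else 0) * (k / 2) ≤ k⁻¹ * (k / 2) :=
        mul_le_mul_of_nonneg_right hA (by positivity)
      have h4 : k⁻¹ * (k / 2) = 1 / 2 := by field_simp
      linarith)
  have e : ∀ ω, p ω * Real.logb 2 (p ω / (p ω * t ω * ((if A ω then k else 1) / 2))) =
      p ω * Real.logb 2 (t ω)⁻¹ - (if A ω then p ω else 0) * Real.logb 2 k + p ω := by
    intro ω
    rcases (hp0 ω).eq_or_lt with h | h
    · simp [← h]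
    have htω := hpt ω h
    have hl2 : Real.logb 2 2 = 1 := Real.logb_self_eq_one one_lt_two
    split_ifs
    · have : p ω / (p ω * t ω * (k / 2)) = (t ω)⁻¹ / k * 2 := by field_simp
      rw [this, Real.logb_mul (by positivity) two_ne_zero, Real.logb_div (by positivity) hk.ne', hl2]
      ring
    · have : p ω / (p ω * t ω * (1 / 2)) = (t ω)⁻¹ * 2 := by field_simp
      rw [this, Real.logb_mul (by positivity) two_ne_zero, hl2]
      ring
  simp only [e, sum_add_distrib, sum_sub_distrib, ← sum_mul, hp.2] at gibbs
  linarith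

/-- If tilting `p` by `t` makes the message `J` independent of the data `ρ`, `π` of the decoder `δ`,
then the divergence bounds the probability of correct decoding. -/
theorem decoding_converse {ι M U : Type*} [Fintype ι] [DecidableEq ι] [Fintype M] [Fintype U] [Nonempty ι]
    [Nonempty M] {p t : Ω → ℝ}
    (hp : p ∈ stdSimplex ℝ Ω) (ht : ∀ ω, 0 ≤ t ω) (hpt : ∀ ω, 0 < p ω → 0 < t ω)
    (J : Ω → ι) (ρ : Ω → M) (π : Ω → U) (δ : M → U → ι) {G : M → U → ℝ}
    (hG1 : ∀ m, ∑ u, G m u ≤ 1)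
    (hdom : ∀ j m u, pmfLaw (fun ω => p ω * t ω) (fun ω => (J ω, ρ ω, π ω)) (j, m, u) ≤
      ((Fintype.card ι : ℝ) * Fintype.card M)⁻¹ * G m u) :
    (∑ ω, if δ (ρ ω) (π ω) = J ω then p ω else 0) * Real.logb 2 (Fintype.card ι) - 1 ≤
      ∑ ω, p ω * Real.logb 2 (t ω)⁻¹ := by
  classical
  have hι : (0 : ℝ) < Fintype.card ι := by exact_mod_cast Fintype.card_pos
  have hM : (0 : ℝ) < Fintype.card M := by exact_mod_cast Fintype.card_pos
  refine event_mul_logb_sub_one_le hp ht hpt _ hι ?_ ?_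
  · have := sum_pmfLaw_mul (fun ω => p ω * t ω) (fun ω => (J ω, ρ ω, π ω))
      (fun x => if δ x.2.1 x.2.2 = x.1 then (1 : ℝ) else 0)
    simp only [mul_ite, mul_one, mul_zero] at this
    rw [← this]
    -- For each observation `δ` names one message only, so correct guesses carry at most the
    -- fraction `1 / card ι` of the dominating mass.
    calc _ ≤ ∑ x : ι × M × U, if δ x.2.1 x.2.2 = x.1 then
          ((Fintype.card ι : ℝ) * Fintype.card M)⁻¹ * G x.2.1 x.2.2 else 0 := by
          refine sum_le_sum fun x _ => ?_
          split_ifs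
          · exact hdom _ _ _
          · exact le_rfl
      _ = ∑ m, ((Fintype.card ι : ℝ) * Fintype.card M)⁻¹ * ∑ u, G m u := by
          simp only [Fintype.sum_prod_type]
          rw [sum_comm]
          refine sum_congr rfl fun m _ => ?_
          rw [sum_comm, mul_sum]
          simp
      _ ≤ ∑ m : M, ((Fintype.card ι : ℝ) * Fintype.card M)⁻¹ * 1 :=
          sum_le_sum fun m _ => mul_le_mul_of_nonneg_left (hG1 m) (by positivity)
      _ = _ := by
          simp only [sum_const, card_univ, nsmul_eq_mul]
          field_simp
  · rw [← sum_pmfLaw (fun ω => p ω * t ω) (fun ω => (J ω, ρ ω, π ω))]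
    calc _ ≤ ∑ x : ι × M × U, ((Fintype.card ι : ℝ) * Fintype.card M)⁻¹ * G x.2.1 x.2.2 :=
          sum_le_sum fun x _ => hdom _ _ _
      _ = ∑ _j : ι, ∑ m, ((Fintype.card ι : ℝ) * Fintype.card M)⁻¹ * ∑ u, G m u := by
          simp only [Fintype.sum_prod_type, mul_sum]
      _ ≤ ∑ _j : ι, ∑ m : M, ((Fintype.card ι : ℝ) * Fintype.card M)⁻¹ * 1 :=
          sum_le_sum fun j _ => sum_le_sum fun m _ =>
            mul_le_mul_of_nonneg_left (hG1 m) (by positivity)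
      _ = 1 := by
          simp only [sum_const, card_univ, nsmul_eq_mul]
          field_simp

end MetaConverse

/-! ### The input law generated by a code with feedback. -/

namespace MADBChannel

variable {q : ℕ} [NeZero q] {𝒴 : Type*} [Fintype 𝒴] {n k₁₃ k₂₃ k₃₁ k₃₂ : ℕ}

/-- The law of the outputs at time `i` given the messages and the earlier outputs. -/
def stepKernel (W : MADBChannel q 𝒴) (c : MADBCode q 𝒴 n k₁₃ k₂₃ k₃₁ k₃₂)
    (m : Fin k₁₃ × Fin k₂₃ × Fin k₃₁ × Fin k₃₂) (i : Fin n)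
    (h : Fin i → (ZMod q × ZMod q) × 𝒴) (a : (ZMod q × ZMod q) × 𝒴) : ℝ :=
  W.transition (c.enc₁ i m.1 fun j => (h j).1.1) (c.enc₂ i m.2.1 fun j => (h j).1.2)
    (c.enc₃ i m.2.2.1 m.2.2.2 fun j => (h j).2) a.1.1 a.1.2 a.2

/-- The joint law of the messages and the outputs of all users. -/
noncomputable def codeLaw (W : MADBChannel q 𝒴) (c : MADBCode q 𝒴 n k₁₃ k₂₃ k₃₁ k₃₂)
    (ω : (Fin k₁₃ × Fin k₂₃ × Fin k₃₁ × Fin k₃₂) × (Fin n → (ZMod q × ZMod q) × 𝒴)) : ℝ :=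
  ((k₁₃ : ℝ) * k₂₃ * k₃₁ * k₃₂)⁻¹ * causalLaw (W.stepKernel c ω.1) ω.2

/-- The auxiliary variable: the time, the messages `M₁₃`, `M₂₃`, `M₃₂` and the earlier outputs of the
users 1 and 2. -/
abbrev CodeAux (q n k₁₃ k₂₃ k₃₂ : ℕ) : Type :=
  (i : Fin n) × ((Fin k₁₃ × Fin k₂₃ × Fin k₃₂) × (Fin i → ZMod q × ZMod q))

/-- The inputs and the auxiliary variable at time `i`. -/
def codeInput (c : MADBCode q 𝒴 n k₁₃ k₂₃ k₃₁ k₃₂) (m : Fin k₁₃ × Fin k₂₃ × Fin k₃₁ × Fin k₃₂)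
    (i : Fin n) (h : Fin i → (ZMod q × ZMod q) × 𝒴) :
    ZMod q × ZMod q × ZMod q × CodeAux q n k₁₃ k₂₃ k₃₂ :=
  (c.enc₁ i m.1 fun j => (h j).1.1, c.enc₂ i m.2.1 fun j => (h j).1.2,
    c.enc₃ i m.2.2.1 m.2.2.2 fun j => (h j).2, ⟨i, (m.1, m.2.1, m.2.2.2), fun j => (h j).1⟩)

/-- The inputs, the auxiliary variable, the third output and the noises at time `i`. -/
def codeState (c : MADBCode q 𝒴 n k₁₃ k₂₃ k₃₁ k₃₂) (m : Fin k₁₃ × Fin k₂₃ × Fin k₃₁ × Fin k₃₂)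
    (i : Fin n) (h : Fin i → (ZMod q × ZMod q) × 𝒴) (a : (ZMod q × ZMod q) × 𝒴) :
    ZMod q × ZMod q × ZMod q × CodeAux q n k₁₃ k₂₃ k₃₂ × 𝒴 × ZMod q × ZMod q :=
  let x := codeInput c m i h
  (x.1, x.2.1, x.2.2.1, x.2.2.2, a.2, a.1.1 - x.1 - x.2.2.1, a.1.2 - x.2.1 - a.1.1 + x.1)

/-- The law of the inputs and the auxiliary variable at a uniformly distributed time. -/
noncomputable def meanInput (W : MADBChannel q 𝒴) (c : MADBCode q 𝒴 n k₁₃ k₂₃ k₃₁ k₃₂)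
    (x : ZMod q × ZMod q × ZMod q × CodeAux q n k₁₃ k₂₃ k₃₂) : ℝ :=
  (n : ℝ)⁻¹ * ∑ i, pmfLaw (W.codeLaw c) (fun ω => codeInput c ω.1 i (pastOf ω.2 i)) x

theorem transition_nonneg (W : MADBChannel q 𝒴) (x₁ x₂ x₃ y₁ y₂ : ZMod q) (y₃ : 𝒴) :
    0 ≤ W.transition x₁ x₂ x₃ y₁ y₂ y₃ :=
  mul_nonneg (mul_nonneg (W.mac_nonneg _ _ _ _) (W.noise₁_mem.1 _)) (W.noise₂_mem.1 _)

theorem sum_transition_mul (W : MADBChannel q 𝒴) (x₁ x₂ x₃ : ZMod q) (g : 𝒴 → ZMod q → ZMod q → ℝ) :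
    ∑ a : (ZMod q × ZMod q) × 𝒴, W.transition x₁ x₂ x₃ a.1.1 a.1.2 a.2 *
      g a.2 (a.1.1 - x₁ - x₃) (a.1.2 - x₂ - a.1.1 + x₁) =
    ∑ y, ∑ z₁, ∑ z₂, W.mac x₁ x₂ x₃ y * W.noise₁ z₁ * W.noise₂ z₂ * g y z₁ z₂ := by
  simp only [transition]
  rw [Fintype.sum_prod_type, sum_comm]
  refine sum_congr rfl fun y _ => ?_
  rw [Fintype.sum_prod_type]
  refine Fintype.sum_equiv ((Equiv.subRight x₁).trans (Equiv.subRight x₃)) _ _ fun y₁ => ?_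
  refine Fintype.sum_equiv (((Equiv.subRight x₂).trans (Equiv.subRight y₁)).trans
    (Equiv.addRight x₁)) _ _ fun y₂ => ?_
  rfl

theorem sum_transition (W : MADBChannel q 𝒴) (x₁ x₂ x₃ : ZMod q) :
    ∑ a : (ZMod q × ZMod q) × 𝒴, W.transition x₁ x₂ x₃ a.1.1 a.1.2 a.2 = 1 := by
  have := W.sum_transition_mul x₁ x₂ x₃ fun _ _ _ => 1
  simp only [mul_one] at this
  rw [this]
  simp only [← mul_sum, W.noise₁_mem.2, W.noise₂_mem.2, mul_one, (W.mac_mem _ _ _).2]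

variable (W : MADBChannel q 𝒴) (c : MADBCode q 𝒴 n k₁₃ k₂₃ k₃₁ k₃₂)

theorem stepKernel_nonneg (m i h a) : 0 ≤ W.stepKernel c m i h a := W.transition_nonneg _ _ _ _ _ _

theorem sum_stepKernel (m i h) : ∑ a, W.stepKernel c m i h a = 1 := W.sum_transition _ _ _

theorem codeLaw_mem [NeZero k₁₃] [NeZero k₂₃] [NeZero k₃₁] [NeZero k₃₂] :
    W.codeLaw c ∈ stdSimplex ℝ
      ((Fin k₁₃ × Fin k₂₃ × Fin k₃₁ × Fin k₃₂) × (Fin n → (ZMod q × ZMod q) × 𝒴)) := by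
  refine ⟨fun ω => mul_nonneg (by positivity) (causalLaw_nonneg (W.stepKernel_nonneg c ω.1) _), ?_⟩
  simp only [codeLaw]
  rw [Fintype.sum_prod_type]
  simp only [← mul_sum, sum_causalLaw (W.sum_stepKernel c _), sum_const, card_univ,
    Fintype.card_prod, Fintype.card_fin, nsmul_eq_mul, mul_one]
  have h1 : (k₁₃ : ℝ) ≠ 0 := NeZero.ne _
  have h2 : (k₂₃ : ℝ) ≠ 0 := NeZero.ne _
  have h3 : (k₃₁ : ℝ) ≠ 0 := NeZero.ne _
  have h4 : (k₃₂ : ℝ) ≠ 0 := NeZero.ne _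
  push_cast
  field_simp

/-- Memorylessness: given messages and past, each time step is a fresh channel use with inputs
`codeInput`. Averaging over time gives the single-letter law. -/
theorem sum_codeLaw_mul_state [NeZero n]
    (g : ZMod q × ZMod q × ZMod q × CodeAux q n k₁₃ k₂₃ k₃₂ × 𝒴 × ZMod q × ZMod q → ℝ) :
    ∑ ω, W.codeLaw c ω * ∑ i, g (codeState c ω.1 i (pastOf ω.2 i) (ω.2 i)) =
      n * ∑ t, W.jointLaw (W.meanInput c) t * g t := by
  let E : ZMod q × ZMod q × ZMod q × CodeAux q n k₁₃ k₂₃ k₃₂ → ℝ := fun x =>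
    ∑ y, ∑ z₁, ∑ z₂, W.mac x.1 x.2.1 x.2.2.1 y * W.noise₁ z₁ * W.noise₂ z₂ *
      g (x.1, x.2.1, x.2.2.1, x.2.2.2, y, z₁, z₂)
  have hE : ∀ m i h, ∑ a, W.stepKernel c m i h a * g (codeState c m i h a) = E (codeInput c m i h) :=
    fun m i h => W.sum_transition_mul _ _ _ fun y z₁ z₂ => g ((codeInput c m i h).1,
      (codeInput c m i h).2.1, (codeInput c m i h).2.2.1, (codeInput c m i h).2.2.2, y, z₁, z₂)
  have h1 : ∀ i, ∑ ω, W.codeLaw c ω * g (codeState c ω.1 i (pastOf ω.2 i) (ω.2 i)) =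
      ∑ x, pmfLaw (W.codeLaw c) (fun ω => codeInput c ω.1 i (pastOf ω.2 i)) x * E x := by
    intro i
    rw [sum_pmfLaw_mul]
    refine (Fintype.sum_prod_type _).trans (Eq.trans ?_ (Fintype.sum_prod_type _).symm)
    refine sum_congr rfl fun m _ => ?_
    simp only [codeLaw, mul_assoc, ← mul_sum]
    congr 1
    rw [sum_causalLaw_mul (W.sum_stepKernel c m) i fun h a => g (codeState c m i h a)]
    simp only [hE]
  have h2 : ∑ t, W.jointLaw (W.meanInput c) t * g t = ∑ x, W.meanInput c x * E x := by
    simp only [Fintype.sum_prod_type, jointLaw, E, mul_sum, mul_assoc]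
  have hn : (n : ℝ) ≠ 0 := NeZero.ne _
  rw [h2]
  simp only [meanInput, mul_sum, sum_mul]
  rw [sum_comm]
  simp only [h1]
  rw [sum_comm]
  refine sum_congr rfl fun x _ => sum_congr rfl fun i _ => ?_
  field_simp

theorem meanInput_mem [NeZero n] [NeZero k₁₃] [NeZero k₂₃] [NeZero k₃₁] [NeZero k₃₂] :
    W.meanInput c ∈ stdSimplex ℝ (ZMod q × ZMod q × ZMod q × CodeAux q n k₁₃ k₂₃ k₃₂) := by
  have hp := W.codeLaw_mem c
  refine ⟨fun x => mul_nonneg (by positivity) (sum_nonneg fun i _ => pmfLaw_nonneg hp.1 _ _), ?_⟩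
  have hn : (n : ℝ) ≠ 0 := NeZero.ne _
  simp only [meanInput, ← mul_sum]
  rw [sum_comm]
  simp only [sum_pmfLaw, hp.2, sum_const, card_univ, Fintype.card_fin, nsmul_eq_mul, mul_one]
  exact inv_mul_cancel₀ hn

theorem mul_pmfLaw_jointLaw_meanInput [NeZero n] {A : Type*}
    (f : ZMod q × ZMod q × ZMod q × CodeAux q n k₁₃ k₂₃ k₃₂ × 𝒴 × ZMod q × ZMod q → A) (a : A) :
    n * pmfLaw (W.jointLaw (W.meanInput c)) f a =
      ∑ i, pmfLaw (W.codeLaw c) (fun ω => f (codeState c ω.1 i (pastOf ω.2 i) (ω.2 i))) a := by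
  classical
  have := W.sum_codeLaw_mul_state c fun t => if f t = a then 1 else 0
  simp only [pmfLaw_eq_sum_ite]
  simp only [mul_sum, mul_ite, mul_one, mul_zero] at this ⊢
  rw [← this, sum_comm]

/-- Makes the densities positive along trajectories of positive probability, so the logarithm of
their product splits. -/
theorem jointLaw_codeState_pos [NeZero n] [NeZero k₁₃] [NeZero k₂₃] [NeZero k₃₁] [NeZero k₃₂] {ω}
    (h : 0 < W.codeLaw c ω) (i : Fin n) :
    0 < W.jointLaw (W.meanInput c) (codeState c ω.1 i (pastOf ω.2 i) (ω.2 i)) := by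
  classical
  have hp := W.codeLaw_mem c
  have h1 := W.mul_pmfLaw_jointLaw_meanInput c id (codeState c ω.1 i (pastOf ω.2 i) (ω.2 i))
  have h2 : 0 < ∑ j, pmfLaw (W.codeLaw c) (fun ω => id (codeState c ω.1 j (pastOf ω.2 j) (ω.2 j)))
      (codeState c ω.1 i (pastOf ω.2 i) (ω.2 i)) :=
    sum_pos' (fun j _ => pmfLaw_nonneg hp.1 _ _) ⟨i, mem_univ _, pmfLaw_pos hp.1 _ h⟩
  rw [← h1, pmfLaw_eq_sum_ite] at h2
  simp only [id, sum_ite_eq', mem_univ, if_true] at h2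
  exact pos_of_mul_pos_right h2 (by positivity)

variable [NeZero n] [NeZero k₁₃] [NeZero k₂₃] [NeZero k₃₁] [NeZero k₃₂]

/-- The converse for a message whose receiver's reference law makes it independent of what the
receiver observes. `D` is the density of an information quantity. -/
theorem converse_of_density
    {D : ZMod q × ZMod q × ZMod q × CodeAux q n k₁₃ k₂₃ k₃₂ × 𝒴 × ZMod q × ZMod q → ℝ}
    (hD : ∀ t, 0 ≤ D t) (hDpos : ∀ t, 0 < W.jointLaw (W.meanInput c) t → 0 < D t)
    {ι M U : Type*} [Fintype ι] [Fintype M] [Fintype U] [DecidableEq ι] [Nonempty ι] [Nonempty M]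
    (J : (Fin k₁₃ × Fin k₂₃ × Fin k₃₁ × Fin k₃₂) × (Fin n → (ZMod q × ZMod q) × 𝒴) → ι)
    (ρ : (Fin k₁₃ × Fin k₂₃ × Fin k₃₁ × Fin k₃₂) × (Fin n → (ZMod q × ZMod q) × 𝒴) → M)
    (π : (Fin k₁₃ × Fin k₂₃ × Fin k₃₁ × Fin k₃₂) × (Fin n → (ZMod q × ZMod q) × 𝒴) → U)
    (δ : M → U → ι) {G : M → U → ℝ} (hG1 : ∀ m, ∑ u, G m u ≤ 1)
    (hdom : ∀ j m u, pmfLaw (fun ω => W.codeLaw c ω *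
      ∏ i, (D (codeState c ω.1 i (pastOf ω.2 i) (ω.2 i)))⁻¹) (fun ω => (J ω, ρ ω, π ω)) (j, m, u) ≤
      ((Fintype.card ι : ℝ) * Fintype.card M)⁻¹ * G m u) :
    (∑ ω, if δ (ρ ω) (π ω) = J ω then W.codeLaw c ω else 0) * Real.logb 2 (Fintype.card ι) - 1 ≤
      n * ∑ t, W.jointLaw (W.meanInput c) t * Real.logb 2 (D t) := by
  have hpos : ∀ ω, 0 < W.codeLaw c ω → ∀ i, 0 < D (codeState c ω.1 i (pastOf ω.2 i) (ω.2 i)) := by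
    intro ω hω i
    exact hDpos _ (W.jointLaw_codeState_pos c hω i)
  let t : (Fin k₁₃ × Fin k₂₃ × Fin k₃₁ × Fin k₃₂) × (Fin n → (ZMod q × ZMod q) × 𝒴) → ℝ :=
    fun ω => ∏ i, (D (codeState c ω.1 i (pastOf ω.2 i) (ω.2 i)))⁻¹
  have ht : ∀ ω, 0 ≤ t ω := fun ω => prod_nonneg fun i _ => inv_nonneg.2 (hD _)
  have htpos : ∀ ω, 0 < W.codeLaw c ω → 0 < t ω :=
    fun ω hω => prod_pos fun i _ => inv_pos.2 (hpos ω hω i)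
  have hp := W.codeLaw_mem c
  have h := decoding_converse hp ht htpos J ρ π δ hG1 hdom
  have hs := W.sum_codeLaw_mul_state c fun t => Real.logb 2 (D t)
  rw [← hs]
  refine h.trans (le_of_eq ?_)
  refine sum_congr rfl fun ω _ => ?_
  rcases (hp.1 ω).eq_or_lt with h0 | h0
  · rw [← h0, zero_mul, zero_mul]
  · simp only [t]
    -- The logarithm of the inverse tilt is the sum over time of the log-densities, whose mean is
    -- `n` times the single-letter information.
    rw [prod_inv_distrib, inv_inv, Real.logb_prod _ _ fun i _ => (hpos ω h0 i).ne']

/-- The converse when the density bounds, step by step, the conditional law of what the receiver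
observes by kernels which do not depend on the message. -/
theorem converse_of_kernels
    {D : ZMod q × ZMod q × ZMod q × CodeAux q n k₁₃ k₂₃ k₃₂ × 𝒴 × ZMod q × ZMod q → ℝ}
    (hD : ∀ t, 0 ≤ D t) (hDpos : ∀ t, 0 < W.jointLaw (W.meanInput c) t → 0 < D t)
    {ι M B : Type*} [Fintype ι] [Fintype M] [Fintype B] [DecidableEq ι] [DecidableEq B]
    [Nonempty ι] [Nonempty M] (e : Fin k₁₃ × Fin k₂₃ × Fin k₃₁ × Fin k₃₂ ≃ ι × M) (φ : (ZMod q × ZMod q) × 𝒴 → B)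
    (δ : M → (Fin n → B) → ι) {L : M → (i : Fin n) → (Fin i → B) → B → ℝ}
    (hL0 : ∀ m i h b, 0 ≤ L m i h b) (hL1 : ∀ m i h, ∑ b, L m i h b ≤ 1)
    (hdom : ∀ m i h b, ∑ a, (if φ a = b then
      W.stepKernel c m i h a * (D (codeState c m i h a))⁻¹ else 0) ≤
      L (e m).2 i (fun j => φ (h j)) b) :
    (∑ ω, if δ (e ω.1).2 (fun i => φ (ω.2 i)) = (e ω.1).1 then W.codeLaw c ω else 0) *
        Real.logb 2 (Fintype.card ι) - 1 ≤
      n * ∑ t, W.jointLaw (W.meanInput c) t * Real.logb 2 (D t) := by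
  classical
  refine W.converse_of_density c hD hDpos (fun ω => (e ω.1).1) (fun ω => (e ω.1).2)
    (fun ω i => φ (ω.2 i)) δ (G := fun m => causalLaw (L m))
    (fun m => sum_causalLaw_le_one (hL0 m) (hL1 m)) fun j m u => ?_
  have hcard : (Fintype.card ι : ℝ) * Fintype.card M = (k₁₃ : ℝ) * k₂₃ * k₃₁ * k₃₂ := by
    have := Fintype.card_congr e
    simp only [Fintype.card_prod, Fintype.card_fin] at this
    rw [← Nat.cast_mul, ← this]
    push_cast
    ring
  -- As `e` is a bijection, `(j, m)` determines all four messages and one term of the sum over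
  -- messages survives.
  rw [hcard, pmfLaw_eq_sum_ite, Fintype.sum_prod_type, Fintype.sum_eq_single (e.symm (j, m))]
  · simp only [Equiv.apply_symm_apply, Prod.mk.injEq, true_and]
    refine le_trans (le_of_eq ?_) (mul_le_mul_of_nonneg_left (sum_causalLaw_fiber_le φ
      (K := fun i h a => W.stepKernel c (e.symm (j, m)) i h a *
        (D (codeState c (e.symm (j, m)) i h a))⁻¹)
      (fun i h a => mul_nonneg (W.stepKernel_nonneg c _ _ _ _) (inv_nonneg.2 (hD _)))
      (hL0 m) (fun i h b => (hdom (e.symm (j, m)) i h b).trans (by simp)) u) (by positivity))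
    rw [mul_sum]
    refine sum_congr rfl fun o _ => ?_
    rw [mul_ite, mul_zero]
    simp only [codeLaw, causalLaw, prod_mul_distrib, mul_assoc]
  · intro m' hm'
    refine sum_eq_zero fun o _ => if_neg fun h => hm' ?_
    rw [Prod.mk.injEq, Prod.mk.injEq] at h
    rw [Equiv.eq_symm_apply]
    exact Prod.ext h.1 h.2.1

end MADBChannel

/-! ### Information densities and conditional laws. -/

section Density

variable {Ω A B C : Type*} [Fintype Ω]

/-- The argument of the logarithm in the conditional mutual information. -/
noncomputable def condDensity (p : Ω → ℝ) (X : Ω → A) (Y : Ω → B) (Z : Ω → C) (ω : Ω) : ℝ :=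
  pmfLaw p (fun ω => (X ω, Y ω, Z ω)) (X ω, Y ω, Z ω) * pmfLaw p Z (Z ω) /
    (pmfLaw p (fun ω => (X ω, Z ω)) (X ω, Z ω) * pmfLaw p (fun ω => (Y ω, Z ω)) (Y ω, Z ω))

theorem condDensity_nonneg {p : Ω → ℝ} (hp : ∀ ω, 0 ≤ p ω) (X : Ω → A) (Y : Ω → B) (Z : Ω → C)
    (ω : Ω) : 0 ≤ condDensity p X Y Z ω :=
  div_nonneg (mul_nonneg (pmfLaw_nonneg hp _ _) (pmfLaw_nonneg hp _ _))
    (mul_nonneg (pmfLaw_nonneg hp _ _) (pmfLaw_nonneg hp _ _))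

theorem condDensity_pos {p : Ω → ℝ} (hp : ∀ ω, 0 ≤ p ω) (X : Ω → A) (Y : Ω → B) (Z : Ω → C)
    {ω : Ω} (h : 0 < p ω) : 0 < condDensity p X Y Z ω :=
  div_pos (mul_pos (pmfLaw_pos hp (fun ω => (X ω, Y ω, Z ω)) h) (pmfLaw_pos hp Z h))
    (mul_pos (pmfLaw_pos hp (fun ω => (X ω, Z ω)) h) (pmfLaw_pos hp (fun ω => (Y ω, Z ω)) h))

/-- The conditional law of `Y` given `Z`, zero where undefined. -/
noncomputable def conditionalLaw (p : Ω → ℝ) (Y : Ω → B) (Z : Ω → C) (y : B) (z : C) : ℝ :=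
  pmfLaw p (fun ω => (Y ω, Z ω)) (y, z) / pmfLaw p Z z

theorem conditionalLaw_nonneg {p : Ω → ℝ} (hp : ∀ ω, 0 ≤ p ω) (Y : Ω → B) (Z : Ω → C) (y : B) (z : C) :
    0 ≤ conditionalLaw p Y Z y z :=
  div_nonneg (pmfLaw_nonneg hp _ _) (pmfLaw_nonneg hp _ _)

variable [Fintype A] [Fintype B] [Fintype C]

theorem sum_conditionalLaw_le_one (p : Ω → ℝ) (Y : Ω → B) (Z : Ω → C) (z : C) :
    ∑ y, conditionalLaw p Y Z y z ≤ 1 := by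
  simp only [conditionalLaw]
  rw [← sum_div, ← pmfLaw_snd p Y Z]
  exact div_self_le_one _

/-- Dividing a channel by the information density leaves the conditional law of its output. -/
theorem kernel_mul_inv_condDensity_le {p : Ω → ℝ} (hp : ∀ ω, 0 ≤ p ω) {X : Ω → A} {Y : Ω → B}
    {Z : Ω → C} {Q : A → C → ℝ} {K : A → C → B → ℝ} (hK : ∀ a c, K a c ∈ stdSimplex ℝ B)
    (h : ∀ a y c, pmfLaw p (fun ω => (X ω, Y ω, Z ω)) (a, y, c) = Q a c * K a c y) (ω : Ω) :
    K (X ω) (Z ω) (Y ω) * (condDensity p X Y Z ω)⁻¹ ≤ conditionalLaw p Y Z (Y ω) (Z ω) := by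
  have h1 : ∀ a c, pmfLaw p (fun ω => (X ω, Z ω)) (a, c) = Q a c := by
    intro a c
    rw [pmfLaw_fst_thd p X Y Z]
    simp only [h, ← mul_sum, (hK _ _).2, mul_one]
  have h0 := conditionalLaw_nonneg hp Y Z (Y ω) (Z ω)
  rw [condDensity, h, h1, inv_div]
  -- Off the support the left side is zero by the convention for division, whence an inequality.
  by_cases hQ : Q (X ω) (Z ω) = 0
  · simpa [hQ] using h0
  by_cases hK0 : K (X ω) (Z ω) (Y ω) = 0
  · simpa [hK0] using h0
  refine le_of_eq ?_
  rw [mul_div_assoc', mul_comm (Q _ _) (K _ _ _), mul_assoc (K _ _ _), mul_div_mul_left _ _ hK0,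
    mul_div_mul_left _ _ hQ, conditionalLaw]

end Density

/-! ### The converse bounds for `M₁₃`, `M₂₃`, their pair and `M₃₁`. -/

namespace MADBChannel

variable {q : ℕ} [NeZero q] {𝒴 : Type*} [Fintype 𝒴] {n k₁₃ k₂₃ k₃₁ k₃₂ : ℕ}

theorem transition_eq (W : MADBChannel q 𝒴) (x₁ x₂ x₃ y₁ y₂ : ZMod q) (y₃ : 𝒴) :
    W.transition x₁ x₂ x₃ y₁ y₂ y₃ =
      W.mac x₁ x₂ x₃ y₃ * (W.kernel₁ x₃ (y₁ - x₁) * W.degradation (y₁ - x₁) (y₂ - x₂)) := by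
  rw [transition, kernel₁, degradation, mul_assoc]
  congr 3
  abel

theorem sum_degradation_sub (W : MADBChannel q 𝒴) (s x : ZMod q) :
    ∑ y, W.degradation s (y - x) = 1 := by
  rw [← (W.degradation_mem s).2]
  exact Fintype.sum_equiv (Equiv.subRight x) _ _ fun _ => rfl

theorem sum_kernel₁_sub (W : MADBChannel q 𝒴) (s x : ZMod q) :
    ∑ y, W.kernel₁ s (y - x) = 1 := by
  rw [← (W.kernel₁_mem s).2]
  exact Fintype.sum_equiv (Equiv.subRight x) _ _ fun _ => rfl

theorem sum_kernel₂_sub (W : MADBChannel q 𝒴) (s x : ZMod q) :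
    ∑ y, W.kernel₂ s (y - x) = 1 := by
  rw [← (W.kernel₂_mem s).2]
  exact Fintype.sum_equiv (Equiv.subRight x) _ _ fun _ => rfl

theorem noise_mul_nonneg (W : MADBChannel q 𝒴) (x s z : ZMod q) :
    0 ≤ W.kernel₁ x s * W.degradation s z :=
  mul_nonneg ((W.kernel₁_mem _).1 _) ((W.degradation_mem _).1 _)

variable (W : MADBChannel q 𝒴) (c : MADBCode q 𝒴 n k₁₃ k₂₃ k₃₁ k₃₂)
  [NeZero n] [NeZero k₁₃] [NeZero k₂₃] [NeZero k₃₁] [NeZero k₃₂]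

/-- The converse for a receiver whose observations are, up to a factor `N`, generated by the channel
`K` from `X` to `Y` given `Z`. -/
theorem converse_of_factorization {A B C : Type*} [Fintype A] [Fintype B] [Fintype C]
    {X : ZMod q × ZMod q × ZMod q × CodeAux q n k₁₃ k₂₃ k₃₂ × 𝒴 × ZMod q × ZMod q → A}
    {Y : ZMod q × ZMod q × ZMod q × CodeAux q n k₁₃ k₂₃ k₃₂ × 𝒴 × ZMod q × ZMod q → B}
    {Z : ZMod q × ZMod q × ZMod q × CodeAux q n k₁₃ k₂₃ k₃₂ × 𝒴 × ZMod q × ZMod q → C}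
    {Q : A → C → ℝ} {K : A → C → B → ℝ} (hK : ∀ a c, K a c ∈ stdSimplex ℝ B)
    (hlaw : ∀ a y z, pmfLaw (W.jointLaw (W.meanInput c)) (fun t => (X t, Y t, Z t)) (a, y, z) =
      Q a z * K a z y)
    {ι M S : Type*} [Fintype ι] [Fintype M] [Fintype S] [DecidableEq ι]
    [DecidableEq S] [Nonempty ι] [Nonempty M]
    (e : Fin k₁₃ × Fin k₂₃ × Fin k₃₁ × Fin k₃₂ ≃ ι × M) (φ : (ZMod q × ZMod q) × 𝒴 → S)
    (δ : M → (Fin n → S) → ι)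
    (N : Fin k₁₃ × Fin k₂₃ × Fin k₃₁ × Fin k₃₂ → (i : Fin n) →
      (Fin i → (ZMod q × ZMod q) × 𝒴) → (ZMod q × ZMod q) × 𝒴 → ℝ) (hN : ∀ m i h a, 0 ≤ N m i h a)
    (hstep : ∀ m i h a, W.stepKernel c m i h a =
      K (X (codeState c m i h a)) (Z (codeState c m i h a)) (Y (codeState c m i h a)) * N m i h a)
    (L : M → (i : Fin n) → (Fin i → S) → S → ℝ) (hL0 : ∀ m i h b, 0 ≤ L m i h b)
    (hL1 : ∀ m i h, ∑ b, L m i h b ≤ 1)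
    (hdom : ∀ m i h b, ∑ a, (if φ a = b then
      conditionalLaw (W.jointLaw (W.meanInput c)) Y Z (Y (codeState c m i h a))
        (Z (codeState c m i h a)) * N m i h a else 0) ≤ L (e m).2 i (fun j => φ (h j)) b) :
    (∑ ω, if δ (e ω.1).2 (fun i => φ (ω.2 i)) = (e ω.1).1 then W.codeLaw c ω else 0) *
        Real.logb 2 (Fintype.card ι) - 1 ≤
      n * condMutualInfo (W.jointLaw (W.meanInput c)) X Y Z := by
  have hP := W.jointLaw_mem (W.meanInput_mem c)
  have hK' := kernel_mul_inv_condDensity_le hP.1 hK hlaw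
  rw [condMutualInfo_eq_expectation]
  refine W.converse_of_kernels c (condDensity_nonneg hP.1 X Y Z)
    (fun t => condDensity_pos hP.1 X Y Z) e φ δ hL0 hL1 fun m i h b => ?_
  refine le_trans (sum_le_sum fun a _ => ?_) (hdom m i h b)
  split_ifs
  · rw [hstep, mul_right_comm]
    exact mul_le_mul_of_nonneg_right (hK' _) (hN _ _ _ _)
  · exact le_rfl

/-- Receiver 3 is also given `M₂₃` and the outputs of user 2. It can then compute `X₂` and `X₃` at
every time, so the reference law of `Y₃` given these inputs does not involve `M₁₃`. The output of
user 1 is summed out, leaving `kernel₂`. -/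
theorem converse₁₃ :
    (∑ ω, if (c.dec₃ ω.1.2.2.1 ω.1.2.2.2 fun i => (ω.2 i).2).1 = ω.1.1 then W.codeLaw c ω else 0) *
        Real.logb 2 k₁₃ - 1 ≤
      n * condMutualInfo (W.jointLaw (W.meanInput c)) (fun t => t.1) (fun t => t.2.2.2.2.1)
        (fun t => (t.2.1, t.2.2.1)) := by
  classical
  have hP := W.jointLaw_mem (W.meanInput_mem c)
  have := W.converse_of_factorization c
    (K := fun a (z : ZMod q × ZMod q) => W.mac a z.1 z.2) (fun a z => W.mac_mem a z.1 z.2)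
    (W.jointLaw_law₁ (W.meanInput c)) (Equiv.refl _) (fun a => (a.1.2, a.2))
    (fun m u => (c.dec₃ m.2.1 m.2.2 fun i => (u i).2).1)
    (fun m i h a => W.kernel₁ (c.enc₃ i m.2.2.1 m.2.2.2 fun j => (h j).2)
      (a.1.1 - c.enc₁ i m.1 fun j => (h j).1.1) *
      W.degradation (a.1.1 - c.enc₁ i m.1 fun j => (h j).1.1)
        (a.1.2 - c.enc₂ i m.2.1 fun j => (h j).1.2))
    (fun m i h a => W.noise_mul_nonneg _ _ _) (fun m i h a => W.transition_eq _ _ _ _ _ _)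
    (fun m i h b => conditionalLaw (W.jointLaw (W.meanInput c)) (fun t => t.2.2.2.2.1)
      (fun t => (t.2.1, t.2.2.1)) b.2
      (c.enc₂ i m.1 fun j => (h j).1, c.enc₃ i m.2.1 m.2.2 fun j => (h j).2) *
      W.kernel₂ (c.enc₃ i m.2.1 m.2.2 fun j => (h j).2) (b.1 - c.enc₂ i m.1 fun j => (h j).1))
    (fun m i h b => mul_nonneg (conditionalLaw_nonneg hP.1 _ _ _ _) ((W.kernel₂_mem _).1 _))
    (fun m i h => by
      rw [Fintype.sum_prod_type, sum_comm]
      simp only [← mul_sum, sum_kernel₂_sub, mul_one]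
      exact sum_conditionalLaw_le_one _ _ _ _)
    (fun m i h b => by
      obtain ⟨y₂, y₃⟩ := b
      simp only [Fintype.sum_prod_type, Prod.mk.injEq, ite_and, sum_ite_irrel, sum_const_zero,
        sum_ite_eq', mem_univ, if_true]
      simp only [codeState, codeInput, ← mul_sum, kernel₂]
      refine mul_le_mul_of_nonneg_left (le_of_eq ?_) (conditionalLaw_nonneg hP.1 _ _ _ _)
      exact Fintype.sum_equiv (Equiv.subRight _) _ _ fun _ => rfl)
  rw [Fintype.card_fin] at this
  exact this

/-- Receiver 3 is also given `M₁₃` and the outputs of user 1, hence knows `X₁` and `X₃`; the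
degradation to user 2 sums to one. -/
theorem converse₂₃ :
    (∑ ω, if (c.dec₃ ω.1.2.2.1 ω.1.2.2.2 fun i => (ω.2 i).2).2 = ω.1.2.1 then W.codeLaw c ω
        else 0) * Real.logb 2 k₂₃ - 1 ≤
      n * condMutualInfo (W.jointLaw (W.meanInput c)) (fun t => t.2.1) (fun t => t.2.2.2.2.1)
        (fun t => (t.1, t.2.2.1)) := by
  classical
  have hP := W.jointLaw_mem (W.meanInput_mem c)
  let e : Fin k₁₃ × Fin k₂₃ × Fin k₃₁ × Fin k₃₂ ≃ Fin k₂₃ × Fin k₁₃ × Fin k₃₁ × Fin k₃₂ :=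
    ⟨fun m => (m.2.1, m.1, m.2.2), fun m => (m.2.1, m.1, m.2.2), fun _ => rfl, fun _ => rfl⟩
  have := W.converse_of_factorization c
    (K := fun a (z : ZMod q × ZMod q) => W.mac z.1 a z.2) (fun a z => W.mac_mem z.1 a z.2)
    (W.jointLaw_law₂ (W.meanInput c)) e (fun a => (a.1.1, a.2))
    (fun m u => (c.dec₃ m.2.1 m.2.2 fun i => (u i).2).2)
    (fun m i h a => W.kernel₁ (c.enc₃ i m.2.2.1 m.2.2.2 fun j => (h j).2)
      (a.1.1 - c.enc₁ i m.1 fun j => (h j).1.1) *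
      W.degradation (a.1.1 - c.enc₁ i m.1 fun j => (h j).1.1)
        (a.1.2 - c.enc₂ i m.2.1 fun j => (h j).1.2))
    (fun m i h a => W.noise_mul_nonneg _ _ _) (fun m i h a => W.transition_eq _ _ _ _ _ _)
    (fun m i h b => conditionalLaw (W.jointLaw (W.meanInput c)) (fun t => t.2.2.2.2.1)
      (fun t => (t.1, t.2.2.1)) b.2
      (c.enc₁ i m.1 fun j => (h j).1, c.enc₃ i m.2.1 m.2.2 fun j => (h j).2) *
      W.kernel₁ (c.enc₃ i m.2.1 m.2.2 fun j => (h j).2) (b.1 - c.enc₁ i m.1 fun j => (h j).1))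
    (fun m i h b => mul_nonneg (conditionalLaw_nonneg hP.1 _ _ _ _) ((W.kernel₁_mem _).1 _))
    (fun m i h => by
      rw [Fintype.sum_prod_type, sum_comm]
      simp only [← mul_sum, sum_kernel₁_sub, mul_one]
      exact sum_conditionalLaw_le_one _ _ _ _)
    (fun m i h b => by
      obtain ⟨y₁, y₃⟩ := b
      simp only [Fintype.sum_prod_type, Prod.mk.injEq, ite_and, sum_ite_irrel, sum_const_zero,
        sum_ite_eq', mem_univ, if_true]
      simp only [codeState, codeInput, ← mul_sum, sum_degradation_sub, mul_one]
      exact le_rfl)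
  rw [Fintype.card_fin] at this
  exact this

/-- No side information is needed: `X₃` is a function of the messages and past outputs of user 3
itself. -/
theorem converse_sum :
    (∑ ω, if (c.dec₃ ω.1.2.2.1 ω.1.2.2.2 fun i => (ω.2 i).2) = (ω.1.1, ω.1.2.1) then W.codeLaw c ω
        else 0) * Real.logb 2 (k₁₃ * k₂₃) - 1 ≤
      n * condMutualInfo (W.jointLaw (W.meanInput c)) (fun t => (t.1, t.2.1)) (fun t => t.2.2.2.2.1)
        (fun t => t.2.2.1) := by
  classical
  have hP := W.jointLaw_mem (W.meanInput_mem c)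
  let e : Fin k₁₃ × Fin k₂₃ × Fin k₃₁ × Fin k₃₂ ≃ (Fin k₁₃ × Fin k₂₃) × Fin k₃₁ × Fin k₃₂ :=
    ⟨fun m => ((m.1, m.2.1), m.2.2), fun m => (m.1.1, m.1.2, m.2), fun _ => rfl, fun _ => rfl⟩
  have := W.converse_of_factorization c
    (K := fun (a : ZMod q × ZMod q) z => W.mac a.1 a.2 z) (fun a z => W.mac_mem a.1 a.2 z)
    (W.jointLaw_law₁₂ (W.meanInput c)) e (fun a => a.2)
    (fun m u => c.dec₃ m.1 m.2 u)
    (fun m i h a => W.kernel₁ (c.enc₃ i m.2.2.1 m.2.2.2 fun j => (h j).2)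
      (a.1.1 - c.enc₁ i m.1 fun j => (h j).1.1) *
      W.degradation (a.1.1 - c.enc₁ i m.1 fun j => (h j).1.1)
        (a.1.2 - c.enc₂ i m.2.1 fun j => (h j).1.2))
    (fun m i h a => W.noise_mul_nonneg _ _ _) (fun m i h a => W.transition_eq _ _ _ _ _ _)
    (fun m i h b => conditionalLaw (W.jointLaw (W.meanInput c)) (fun t => t.2.2.2.2.1)
      (fun t => t.2.2.1) b (c.enc₃ i m.1 m.2 h))
    (fun m i h b => conditionalLaw_nonneg hP.1 _ _ _ _)
    (fun m i h => sum_conditionalLaw_le_one _ _ _ _)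
    (fun m i h b => by
      simp only [Fintype.sum_prod_type, sum_ite_eq', mem_univ, if_true]
      simp only [codeState, codeInput, ← mul_sum, sum_degradation_sub, sum_kernel₁_sub, mul_one]
      exact le_rfl)
  rw [Fintype.card_prod, Fintype.card_fin, Fintype.card_fin, Nat.cast_mul] at this
  exact this

/-- Receiver 1 is also given `M₂₃`, `M₃₂` and the outputs of user 2, hence knows the auxiliary
variable at each time. The reference law is then free of `M₃₁`, and degradedness makes the factor
for user 2 depend on the output of user 1 and known inputs only. -/
theorem converse₃₁ :
    (∑ ω, if c.dec₁ ω.1.1 (fun i => (ω.2 i).1.1) = ω.1.2.2.1 then W.codeLaw c ω else 0) *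
        Real.logb 2 k₃₁ - 1 ≤
      n * condMutualInfo (W.jointLaw (W.meanInput c)) (fun t => t.2.2.1)
        (fun t => t.2.2.1 + t.2.2.2.2.2.1) (fun t => t.2.2.2.1) := by
  classical
  have hP := W.jointLaw_mem (W.meanInput_mem c)
  let e : Fin k₁₃ × Fin k₂₃ × Fin k₃₁ × Fin k₃₂ ≃ Fin k₃₁ × Fin k₁₃ × Fin k₂₃ × Fin k₃₂ :=
    ⟨fun m => (m.2.2.1, m.1, m.2.1, m.2.2.2), fun m => (m.2.1, m.2.2.1, m.1, m.2.2.2),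
      fun _ => rfl, fun _ => rfl⟩
  have := W.converse_of_factorization c
    (K := fun a _ => W.kernel₁ a) (fun a _ => W.kernel₁_mem a)
    (W.jointLaw_law₃₁ (W.meanInput c)) e (fun a => a.1)
    (fun m u => c.dec₁ m.1 fun i => (u i).1)
    (fun m i h a => W.mac (c.enc₁ i m.1 fun j => (h j).1.1) (c.enc₂ i m.2.1 fun j => (h j).1.2)
        (c.enc₃ i m.2.2.1 m.2.2.2 fun j => (h j).2) a.2 *
      W.degradation (a.1.1 - c.enc₁ i m.1 fun j => (h j).1.1)
        (a.1.2 - c.enc₂ i m.2.1 fun j => (h j).1.2))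
    (fun m i h a => mul_nonneg (W.mac_nonneg _ _ _ _) ((W.degradation_mem _).1 _))
    (fun m i h a => by
      rw [stepKernel, transition_eq, mul_left_comm]
      simp only [codeState, codeInput, add_sub_cancel])
    (fun m i h b => conditionalLaw (W.jointLaw (W.meanInput c)) (fun t => t.2.2.1 + t.2.2.2.2.2.1)
      (fun t => t.2.2.2.1) (b.1 - c.enc₁ i m.1 fun j => (h j).1) ⟨i, m, h⟩ *
      W.degradation (b.1 - c.enc₁ i m.1 fun j => (h j).1) (b.2 - c.enc₂ i m.2.1 fun j => (h j).2))
    (fun m i h b => mul_nonneg (conditionalLaw_nonneg hP.1 _ _ _ _) ((W.degradation_mem _).1 _))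
    (fun m i h => by
      rw [Fintype.sum_prod_type]
      simp only [← mul_sum, sum_degradation_sub, mul_one]
      refine le_trans (le_of_eq ?_) (sum_conditionalLaw_le_one (W.jointLaw (W.meanInput c))
        (fun t => t.2.2.1 + t.2.2.2.2.2.1) (fun t => t.2.2.2.1) ⟨i, m, h⟩)
      exact Fintype.sum_equiv (Equiv.subRight (c.enc₁ i m.1 fun j => (h j).1)) _ _ fun _ => rfl)
    (fun m i h b => by
      obtain ⟨y₁, y₂⟩ := b
      rw [Fintype.sum_prod_type]
      simp only [sum_ite_irrel, sum_const_zero, sum_ite_eq', mem_univ, if_true]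
      simp only [codeState, codeInput, add_sub_cancel, ← mul_sum, ← sum_mul, (W.mac_mem _ _ _).2,
        one_mul]
      exact le_rfl)
  rw [Fintype.card_fin] at this
  exact this

end MADBChannel

/-! ### The converse bound for `M₃₂`. -/

theorem sum_pmfLaw_pair_mul {Ω A B : Type*} [Fintype Ω] [Fintype A] [Fintype B] [DecidableEq A]
    (p : Ω → ℝ) (f : Ω → A) (g : Ω → B) (a : A) (F : B → ℝ) :
    ∑ b, pmfLaw p (fun ω => (f ω, g ω)) (a, b) * F b =
      ∑ ω, if f ω = a then p ω * F (g ω) else 0 := by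
  have := sum_pmfLaw_mul p (fun ω => (f ω, g ω)) (fun x => if x.1 = a then F x.2 else 0)
  rw [Fintype.sum_prod_type] at this
  simp only [mul_ite, mul_zero] at this
  rw [← this, Fintype.sum_eq_single a fun a' h => by simp [h]]
  simp

namespace MADBChannel

variable {q : ℕ} [NeZero q] {𝒴 : Type*} [Fintype 𝒴] {n k₁₃ k₂₃ k₃₁ k₃₂ : ℕ}
  (W : MADBChannel q 𝒴) (c : MADBCode q 𝒴 n k₁₃ k₂₃ k₃₁ k₃₂)

/-- The law of the messages `M₁₃`, `M₂₃`, `M₃₂` and the outputs of the users 1 and 2. -/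
noncomputable def visibleLaw (μ : Fin k₁₃ × Fin k₂₃ × Fin k₃₂) (u : Fin n → ZMod q × ZMod q) : ℝ :=
  pmfLaw (W.codeLaw c) (fun ω => ((ω.1.1, ω.1.2.1, ω.1.2.2.2), fun i => (ω.2 i).1)) (μ, u)

theorem sum_visibleLaw [NeZero k₁₃] [NeZero k₂₃] [NeZero k₃₁] [NeZero k₃₂]
    (μ : Fin k₁₃ × Fin k₂₃ × Fin k₃₂) :
    ∑ u, W.visibleLaw c μ u = ((k₃₂ : ℝ) * (k₁₃ * k₂₃))⁻¹ := by
  have := sum_pmfLaw_pair_mul (W.codeLaw c) (fun ω => (ω.1.1, ω.1.2.1, ω.1.2.2.2))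
    (fun ω i => (ω.2 i).1) μ (fun _ => 1)
  simp only [mul_one] at this
  simp only [visibleLaw]
  rw [this, Fintype.sum_prod_type]
  obtain ⟨a, b, d⟩ := μ
  simp only [Fintype.sum_prod_type, Prod.mk.injEq, ite_and, sum_ite_irrel, sum_const_zero,
    sum_ite_eq', mem_univ, if_true]
  simp only [codeLaw, ← mul_sum, sum_causalLaw (W.sum_stepKernel c _), sum_const, card_univ,
    Fintype.card_fin, nsmul_eq_mul, mul_one]
  have h1 : (k₁₃ : ℝ) ≠ 0 := NeZero.ne _
  have h2 : (k₂₃ : ℝ) ≠ 0 := NeZero.ne _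
  have h3 : (k₃₁ : ℝ) ≠ 0 := NeZero.ne _
  have h4 : (k₃₂ : ℝ) ≠ 0 := NeZero.ne _
  field_simp

/-- The auxiliary variable records the time, so one time contributes, and the factor `n` undoes the
probability of that time. -/
theorem mul_pmfLaw_aux [NeZero n] (i : Fin n) (μ : Fin k₁₃ × Fin k₂₃ × Fin k₃₂)
    (h : Fin i → ZMod q × ZMod q) :
    n * pmfLaw (W.jointLaw (W.meanInput c)) (fun t => t.2.2.2.1) ⟨i, μ, h⟩ =
      ∑ u, if pastOf u i = h then W.visibleLaw c μ u else 0 := by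
  classical
  have h1 := sum_pmfLaw_pair_mul (W.codeLaw c) (fun ω => (ω.1.1, ω.1.2.1, ω.1.2.2.2))
    (fun ω i => (ω.2 i).1) μ (fun u => if pastOf u i = h then 1 else 0)
  simp only [mul_ite, mul_one, mul_zero, ← ite_and] at h1
  rw [mul_pmfLaw_jointLaw_meanInput]
  refine Eq.trans ?_ h1.symm
  rw [Fintype.sum_eq_single i]
  · rw [pmfLaw_eq_sum_ite]
    refine sum_congr rfl fun ω _ => ?_
    simp only [codeState, codeInput, Sigma.mk.injEq, heq_eq_eq, true_and, Prod.mk.injEq]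
    rfl
  · intro j hj
    rw [pmfLaw_eq_sum_ite]
    refine sum_eq_zero fun ω _ => if_neg ?_
    simp only [codeState, codeInput, Sigma.mk.injEq, hj, false_and, not_false_eq_true]

/-- The input `X₂` is determined by the auxiliary variable; given that, prescribing `X₃ + Z₁ + Z₂`
is the same as prescribing `Y₂`. -/
theorem mul_pmfLaw_aux_output [NeZero n] (i : Fin n) (μ : Fin k₁₃ × Fin k₂₃ × Fin k₃₂)
    (h : Fin i → ZMod q × ZMod q) (b : ZMod q) :
    n * pmfLaw (W.jointLaw (W.meanInput c))
        (fun t => (t.2.2.2.1, t.2.2.1 + t.2.2.2.2.2.1 + t.2.2.2.2.2.2))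
        (⟨i, μ, h⟩, b - c.enc₂ i μ.2.1 fun j => (h j).2) =
      ∑ u, if pastOf u i = h ∧ (u i).2 = b then W.visibleLaw c μ u else 0 := by
  classical
  have h1 := sum_pmfLaw_pair_mul (W.codeLaw c) (fun ω => (ω.1.1, ω.1.2.1, ω.1.2.2.2))
    (fun ω i => (ω.2 i).1) μ (fun u => if pastOf u i = h ∧ (u i).2 = b then 1 else 0)
  simp only [mul_ite, mul_one, mul_zero, ← ite_and] at h1
  rw [mul_pmfLaw_jointLaw_meanInput]
  refine Eq.trans ?_ h1.symm
  have hs : ∀ x y₁ y₂ z w : ZMod q, z + (y₁ - x - z) + (y₂ - w - y₁ + x) = y₂ - w := by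
    intros; abel
  rw [Fintype.sum_eq_single i]
  · rw [pmfLaw_eq_sum_ite]
    refine sum_congr rfl fun ω _ => ?_
    obtain ⟨⟨m₁, m₂, m₃, m₄⟩, o⟩ := ω
    simp only [codeState, codeInput, Prod.mk.injEq, Sigma.mk.injEq, heq_eq_eq, true_and, hs]
    refine if_congr ⟨?_, ?_⟩ rfl rfl
    · rintro ⟨⟨rfl, rfl⟩, h2⟩
      exact ⟨rfl, rfl, sub_left_injective h2⟩
    · rintro ⟨rfl, rfl, rfl⟩
      exact ⟨⟨rfl, rfl⟩, rfl⟩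
  · intro j hj
    rw [pmfLaw_eq_sum_ite]
    refine sum_eq_zero fun ω _ => if_neg ?_
    simp only [codeState, codeInput, Prod.mk.injEq, Sigma.mk.injEq, hj, false_and,
      not_false_eq_true]

/-- Here the reference replaces the law of `X₃ + Z₁ + Z₂` given the auxiliary variable by its
overall law. The auxiliary variable contains outputs of user 1 that receiver 2 lacks, so domination
by kernels is unavailable step by step and `sum_mul_prod_ratio_le` does the replacement along the
whole sequence. Receiver 2 gets `M₁₃` as side information. -/
theorem converse₃₂ [NeZero n] [NeZero k₁₃] [NeZero k₂₃] [NeZero k₃₁] [NeZero k₃₂] :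
    (∑ ω, if c.dec₂ ω.1.2.1 (fun i => (ω.2 i).1.2) = ω.1.2.2.2 then W.codeLaw c ω else 0) *
        Real.logb 2 k₃₂ - 1 ≤
      n * mutualInfo (W.jointLaw (W.meanInput c)) (fun t => t.2.2.2.1)
        (fun t => t.2.2.1 + t.2.2.2.2.2.1 + t.2.2.2.2.2.2) := by
  classical
  have hP := W.jointLaw_mem (W.meanInput_mem c)
  set jl := W.jointLaw (W.meanInput c) with hjl
  let V : ZMod q × ZMod q × ZMod q × CodeAux q n k₁₃ k₂₃ k₃₂ × 𝒴 × ZMod q × ZMod q →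
    CodeAux q n k₁₃ k₂₃ k₃₂ := fun t => t.2.2.2.1
  let Y : ZMod q × ZMod q × ZMod q × CodeAux q n k₁₃ k₂₃ k₃₂ × 𝒴 × ZMod q × ZMod q → ZMod q :=
    fun t => t.2.2.1 + t.2.2.2.2.2.1 + t.2.2.2.2.2.2
  let D : ZMod q × ZMod q × ZMod q × CodeAux q n k₁₃ k₂₃ k₃₂ × 𝒴 × ZMod q × ZMod q → ℝ :=
    fun t => pmfLaw jl (fun t => (V t, Y t)) (V t, Y t) / (pmfLaw jl V (V t) * pmfLaw jl Y (Y t))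
  have hn : (n : ℝ) ≠ 0 := NeZero.ne _
  have hY0 : ∀ b, 0 ≤ pmfLaw jl Y b := pmfLaw_nonneg hP.1 Y
  have hY1 : ∀ x, ∑ b, pmfLaw jl Y (b - x) ≤ 1 := fun x => by
    rw [Fintype.sum_equiv (Equiv.subRight x) (fun b => pmfLaw jl Y (b - x)) (pmfLaw jl Y)
      fun _ => rfl, sum_pmfLaw, hP.2]
  have key := W.converse_of_density c (D := D)
    (fun t => div_nonneg (pmfLaw_nonneg hP.1 _ _)
      (mul_nonneg (pmfLaw_nonneg hP.1 _ _) (pmfLaw_nonneg hP.1 _ _)))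
    (fun t ht => div_pos (pmfLaw_pos hP.1 (fun t => (V t, Y t)) ht)
      (mul_pos (pmfLaw_pos hP.1 V ht) (pmfLaw_pos hP.1 Y ht)))
    (fun ω => ω.1.2.2.2) (fun ω => (ω.1.1, ω.1.2.1)) (fun ω i => (ω.2 i).1.2)
    (fun m u => c.dec₂ m.2 u)
    (G := fun m => causalLaw fun i h b => pmfLaw jl Y (b - c.enc₂ i m.2 h))
    (fun m => sum_causalLaw_le_one (fun _ _ _ => hY0 _) (fun _ _ => hY1 _)) (by
      rintro m₃₂ ⟨m₁₃, m₂₃⟩ w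
      let r : (i : Fin n) → (Fin i → ZMod q) → ZMod q → ℝ :=
        fun i h b => pmfLaw jl Y (b - c.enc₂ i m₂₃ h)
      -- The ratios `N / c` are the reciprocal conditional laws of `Y₂` given the auxiliary
      -- variable; taking `G` to be an indicator isolates a single output word.
      have hratio := sum_mul_prod_ratio_le (fun u : ZMod q × ZMod q => u.2) (r := r)
        (fun i h b => hY0 _) (L := W.visibleLaw c (m₁₃, m₂₃, m₃₂))
        (fun u => pmfLaw_nonneg (W.codeLaw_mem c).1 _ _)
        (fun i h => W.mul_pmfLaw_aux c i (m₁₃, m₂₃, m₃₂) h)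
        (fun i h b => W.mul_pmfLaw_aux_output c i (m₁₃, m₂₃, m₃₂) h b)
        (G := fun b => if b = w then 1 else 0) (fun b => by split_ifs <;> norm_num)
      rw [sum_visibleLaw] at hratio
      simp only [mul_ite, mul_one, mul_zero, sum_ite_eq', mem_univ, if_true] at hratio
      rw [Fintype.card_prod, Fintype.card_fin, Fintype.card_fin, Fintype.card_fin, Nat.cast_mul]
      refine le_trans (le_of_eq ?_) hratio
      have hpair := sum_pmfLaw_pair_mul (W.codeLaw c) (fun ω => (ω.1.1, ω.1.2.1, ω.1.2.2.2))
        (fun ω i => (ω.2 i).1) (m₁₃, m₂₃, m₃₂) (fun u => if (fun i => (u i).2) = w then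
          ∏ i, r i (fun j => (pastOf u i j).2) (u i).2 *
            (n * pmfLaw jl V ⟨i, (m₁₃, m₂₃, m₃₂), pastOf u i⟩) /
            (n * pmfLaw jl (fun t => (V t, Y t)) (⟨i, (m₁₃, m₂₃, m₃₂), pastOf u i⟩,
              (u i).2 - c.enc₂ i m₂₃ fun j => (pastOf u i j).2)) else 0)
      simp only [mul_ite, mul_zero] at hpair
      refine Eq.trans ?_ hpair.symm
      rw [pmfLaw_eq_sum_ite]
      refine sum_congr rfl fun ω _ => ?_
      rw [← ite_and]
      obtain ⟨⟨m₁, m₂, m₃, m₄⟩, o⟩ := ω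
      refine ite_congr (by simp only [Prod.mk.injEq, eq_iff_iff]; tauto) (fun hω => ?_)
        fun _ => rfl
      simp only [Prod.mk.injEq] at hω
      obtain ⟨⟨rfl, rfl, rfl⟩, rfl⟩ := hω
      congr 1
      refine prod_congr rfl fun i _ => ?_
      have hs : ∀ x y₁ y₂ z w : ZMod q, z + (y₁ - x - z) + (y₂ - w - y₁ + x) = y₂ - w := by
        intros; abel
      simp only [D, inv_div]
      rw [mul_left_comm, mul_div_mul_left _ _ hn, mul_comm]
      simp only [V, Y, codeState, codeInput, hs, r]
      rfl)
  rw [Fintype.card_fin] at key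
  rw [mutualInfo_eq_expectation]
  exact key

end MADBChannel

/-! ### From the converse bounds to the rate region. -/

namespace MADBChannel

variable {q : ℕ} [NeZero q] {𝒴 : Type*} [Fintype 𝒴] {n k₁₃ k₂₃ k₃₁ k₃₂ : ℕ}

open Classical in
theorem errorProb_eq_sum_codeLaw (W : MADBChannel q 𝒴) (c : MADBCode q 𝒴 n k₁₃ k₂₃ k₃₁ k₃₂) :
    W.errorProb c = ∑ ω, if (c.dec₃ ω.1.2.2.1 ω.1.2.2.2 fun i => (ω.2 i).2) ≠ (ω.1.1, ω.1.2.1) ∨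
      c.dec₁ ω.1.1 (fun i => (ω.2 i).1.1) ≠ ω.1.2.2.1 ∨
      c.dec₂ ω.1.2.1 (fun i => (ω.2 i).1.2) ≠ ω.1.2.2.2 then W.codeLaw c ω else 0 := by
  simp only [Fintype.sum_prod_type (α₁ := Fin k₁₃ × Fin k₂₃ × Fin k₃₁ × Fin k₃₂)]
  simp only [Fintype.sum_prod_type (α₁ := Fin k₁₃), Fintype.sum_prod_type (α₁ := Fin k₂₃),
    Fintype.sum_prod_type (α₁ := Fin k₃₁), errorProb]
  refine sum_congr rfl fun m₁₃ _ => sum_congr rfl fun m₂₃ _ => sum_congr rfl fun m₃₁ _ =>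
    sum_congr rfl fun m₃₂ _ => ?_
  have h1 := sum_arrow_prod (ι := Fin n) (A := ZMod q × ZMod q) (B := 𝒴) fun u y₃ =>
    if c.dec₃ m₃₁ m₃₂ y₃ ≠ (m₁₃, m₂₃) ∨ c.dec₁ m₁₃ (fun i => (u i).1) ≠ m₃₁ ∨
      c.dec₂ m₂₃ (fun i => (u i).2) ≠ m₃₂ then
      W.outputProb c m₁₃ m₂₃ m₃₁ m₃₂ (fun i => (u i).1) (fun i => (u i).2) y₃ else 0
  have h2 := sum_arrow_prod (ι := Fin n) (A := ZMod q) (B := ZMod q) fun y₁ y₂ =>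
    ∑ y₃, if c.dec₃ m₃₁ m₃₂ y₃ ≠ (m₁₃, m₂₃) ∨ c.dec₁ m₁₃ y₁ ≠ m₃₁ ∨ c.dec₂ m₂₃ y₂ ≠ m₃₂ then
      W.outputProb c m₁₃ m₂₃ m₃₁ m₃₂ y₁ y₂ y₃ else 0
  rw [← h2, ← h1, mul_sum]
  refine sum_congr rfl fun o _ => ?_
  rw [mul_ite, mul_zero]
  rfl

variable [NeZero k₁₃] [NeZero k₂₃] [NeZero k₃₁] [NeZero k₃₂]

theorem errorProb_le_one (W : MADBChannel q 𝒴) (c : MADBCode q 𝒴 n k₁₃ k₂₃ k₃₁ k₃₂) :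
    W.errorProb c ≤ 1 := by
  rw [errorProb_eq_sum_codeLaw, ← (W.codeLaw_mem c).2]
  exact sum_le_sum fun ω _ => by split_ifs; exacts [le_rfl, (W.codeLaw_mem c).1 _]

/-- An event that occurs unless some message is decoded wrongly. -/
theorem one_sub_errorProb_le (W : MADBChannel q 𝒴) (c : MADBCode q 𝒴 n k₁₃ k₂₃ k₃₁ k₃₂)
    (A : (Fin k₁₃ × Fin k₂₃ × Fin k₃₁ × Fin k₃₂) × (Fin n → (ZMod q × ZMod q) × 𝒴) → Prop)
    [DecidablePred A]
    (hA : ∀ ω, (c.dec₃ ω.1.2.2.1 ω.1.2.2.2 fun i => (ω.2 i).2) = (ω.1.1, ω.1.2.1) →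
      c.dec₁ ω.1.1 (fun i => (ω.2 i).1.1) = ω.1.2.2.1 →
      c.dec₂ ω.1.2.1 (fun i => (ω.2 i).1.2) = ω.1.2.2.2 → A ω) :
    1 - W.errorProb c ≤ ∑ ω, if A ω then W.codeLaw c ω else 0 := by
  classical
  rw [errorProb_eq_sum_codeLaw, sub_le_iff_le_add, ← (W.codeLaw_mem c).2, ← sum_add_distrib]
  refine sum_le_sum fun ω _ => ?_
  have h0 := (W.codeLaw_mem c).1 ω
  by_cases h : A ω
  · rw [if_pos h]
    split_ifs <;> linarith
  · rw [if_neg h, if_pos, zero_add]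
    by_contra hne
    push Not at hne
    exact h (hA ω hne.1 hne.2.1 hne.2.2)

/-- Nonnegativity of all the information quantities, needed because the reduced rates are truncated
at zero. -/
theorem zero_mem_rateRegion (W : MADBChannel q 𝒴) {𝒱 : Type*} [Fintype 𝒱]
    {P : ZMod q × ZMod q × ZMod q × 𝒱 → ℝ}
    (hP : P ∈ stdSimplex ℝ (ZMod q × ZMod q × ZMod q × 𝒱)) : (0, 0, 0, 0) ∈ W.rateRegion P := by
  have hin : ∀ x₁ x₂ x₃, 0 ≤ inputMarginal P x₁ x₂ x₃ := fun _ _ _ => sum_nonneg fun _ _ => hP.1 _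
  have haux : ∀ v x, 0 ≤ auxMarginal P v x :=
    fun _ _ => sum_nonneg fun _ _ => sum_nonneg fun _ _ => hP.1 _
  rw [W.mem_rateRegion hP, add_zero]
  exact ⟨le_rfl, le_rfl, le_rfl, le_rfl,
    sum_nonneg fun _ _ => sum_nonneg fun _ _ => scaledInfo_nonneg (fun _ => hin _ _ _)
      fun _ => W.mac_mem _ _ _,
    sum_nonneg fun _ _ => sum_nonneg fun _ _ => scaledInfo_nonneg (fun _ => hin _ _ _)
      fun _ => W.mac_mem _ _ _,
    sum_nonneg fun _ _ => scaledInfo_nonneg (fun _ => hin _ _ _) fun _ => W.mac_mem _ _ _,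
    sum_nonneg fun _ _ => scaledInfo_nonneg (haux _) W.kernel₁_mem,
    sub_nonneg.2 (sum_scaledInfo_le haux W.kernel₂_mem)⟩

theorem mul_le_logb_numMessages (n : ℕ) (R : ℝ) : n * R ≤ Real.logb 2 (numMessages n R) := by
  rw [Real.le_logb_iff_rpow_le one_lt_two (by exact_mod_cast numMessages_pos n R)]
  exact Nat.le_ceil _

/-- Rates of a code, reduced according to its error probability, are allowed by the law of the
inputs that it generates. -/
theorem reduced_rates_mem_rateRegion (W : MADBChannel q 𝒴) [NeZero n] {R₁₃ R₂₃ R₃₁ R₃₂ : ℝ}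
    (h₁₃ : 0 ≤ R₁₃) (h₂₃ : 0 ≤ R₂₃) (c : MADBCode q 𝒴 n (numMessages n R₁₃) (numMessages n R₂₃)
      (numMessages n R₃₁) (numMessages n R₃₂)) :
    (max 0 ((1 - W.errorProb c) * R₁₃ - (n : ℝ)⁻¹), max 0 ((1 - W.errorProb c) * R₂₃ - (n : ℝ)⁻¹),
      max 0 ((1 - W.errorProb c) * R₃₁ - (n : ℝ)⁻¹),
      max 0 ((1 - W.errorProb c) * R₃₂ - (n : ℝ)⁻¹)) ∈ W.rateRegion (W.meanInput c) := by
  have hn : (0 : ℝ) < n := Nat.cast_pos.2 (NeZero.pos n)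
  have hzero := W.zero_mem_rateRegion (W.meanInput_mem c)
  simp only [rateRegion, Set.mem_ofPred_eq] at hzero ⊢
  obtain ⟨-, -, -, -, z₁₃, z₂₃, zs, z₃₁, z₃₂⟩ := hzero
  have he0 := sub_nonneg.2 (W.errorProb_le_one c)
  -- Here `s` is the probability of decoding the message in question correctly and `k` the logarithm
  -- of the number of messages.
  have key : ∀ {s R k I : ℝ}, 1 - W.errorProb c ≤ s → n * R ≤ k → 0 ≤ k → s * k - 1 ≤ n * I →
      (1 - W.errorProb c) * R - (n : ℝ)⁻¹ ≤ I := by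
    intro s R k I hs hR hk hI
    have h1 : (1 - W.errorProb c) * (n * R) ≤ s * k :=
      (mul_le_mul_of_nonneg_left hR he0).trans (mul_le_mul_of_nonneg_right hs hk)
    have h2 : n * ((1 - W.errorProb c) * R - (n : ℝ)⁻¹) ≤ n * I := by
      rw [mul_sub, mul_inv_cancel₀ hn.ne']
      linarith
    exact le_of_mul_le_mul_left h2 hn
  have hlog : ∀ R, 0 ≤ Real.logb 2 (numMessages n R) :=
    fun R => Real.logb_nonneg one_lt_two (one_le_numMessages n R)
  have b₁₃ := key (W.one_sub_errorProb_le c _ fun ω h _ _ => by rw [h])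
    (mul_le_logb_numMessages n R₁₃) (hlog _) (W.converse₁₃ c)
  have b₂₃ := key (W.one_sub_errorProb_le c _ fun ω h _ _ => by rw [h])
    (mul_le_logb_numMessages n R₂₃) (hlog _) (W.converse₂₃ c)
  have b₃₁ := key (W.one_sub_errorProb_le c _ fun ω _ h _ => h)
    (mul_le_logb_numMessages n R₃₁) (hlog _) (W.converse₃₁ c)
  have b₃₂ := key (W.one_sub_errorProb_le c _ fun ω _ _ h => h)
    (mul_le_logb_numMessages n R₃₂) (hlog _) (W.converse₃₂ c)
  have hlogs : Real.logb 2 ((numMessages n R₁₃ : ℝ) * numMessages n R₂₃) =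
      Real.logb 2 (numMessages n R₁₃) + Real.logb 2 (numMessages n R₂₃) :=
    Real.logb_mul (NeZero.ne _) (NeZero.ne _)
  have bs := key (R := R₁₃ + R₂₃) (W.one_sub_errorProb_le c _ fun ω h _ _ => h)
    (by rw [hlogs, mul_add]; exact add_le_add (mul_le_logb_numMessages n _)
          (mul_le_logb_numMessages n _))
    (by rw [hlogs]; exact add_nonneg (hlog _) (hlog _)) (W.converse_sum c)
  refine ⟨le_max_left _ _, le_max_left _ _, le_max_left _ _, le_max_left _ _, max_le z₁₃ b₁₃,
    max_le z₂₃ b₂₃, ?_, max_le z₃₁ b₃₁, max_le z₃₂ b₃₂⟩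
  rw [add_zero] at zs
  have e₁₃ := mul_nonneg he0 h₁₃
  have e₂₃ := mul_nonneg he0 h₂₃
  have hi : 0 < (n : ℝ)⁻¹ := inv_pos.2 hn
  refine le_trans ?_ (max_le zs bs)
  -- If one reduced rate is truncated, the bound on the other follows from the sum bound because the
  -- dropped rate is nonnegative; if neither is, `2 / n` is subtracted where `1 / n` suffices.
  rcases max_cases 0 ((1 - W.errorProb c) * R₁₃ - (n : ℝ)⁻¹) with ⟨e, _⟩ | ⟨e, _⟩ <;>
  rcases max_cases 0 ((1 - W.errorProb c) * R₂₃ - (n : ℝ)⁻¹) with ⟨e', _⟩ | ⟨e', _⟩ <;>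
  rw [e, e']
  · simp
  all_goals refine le_max_of_le_right ?_; linarith

/-- The converse: a closed set which contains the rate region of every input law contains all
achievable rates. -/
theorem mem_of_achievable (W : MADBChannel q 𝒴) {S : Set (ℝ × ℝ × ℝ × ℝ)} (hS : IsClosed S)
    (h : ∀ {𝒱 : Type} [Fintype 𝒱] {P : ZMod q × ZMod q × ZMod q × 𝒱 → ℝ},
      P ∈ stdSimplex ℝ (ZMod q × ZMod q × ZMod q × 𝒱) → W.rateRegion P ⊆ S)
    {R₁₃ R₂₃ R₃₁ R₃₂ : ℝ} (hR : W.Achievable R₁₃ R₂₃ R₃₁ R₃₂) : (R₁₃, R₂₃, R₃₁, R₃₂) ∈ S := by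
  obtain ⟨h₁₃, h₂₃, h₃₁, h₃₂, c, hc⟩ := hR
  have hlim : ∀ {R : ℝ}, 0 ≤ R → Tendsto (fun n : ℕ =>
      max 0 ((1 - W.errorProb (c n)) * R - (n : ℝ)⁻¹)) atTop (𝓝 R) := by
    intro R hR
    have := ((hc.const_sub 1).mul_const R).sub (tendsto_inv_atTop_nhds_zero_nat (𝕜 := ℝ))
    have := (tendsto_const_nhds (x := (0 : ℝ))).max this
    simpa [hR] using this
  refine hS.mem_of_tendsto
    ((hlim h₁₃).prodMk_nhds ((hlim h₂₃).prodMk_nhds ((hlim h₃₁).prodMk_nhds (hlim h₃₂)))) ?_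
  -- Length zero is excluded, since there is no time to average over.
  filter_upwards [eventually_ge_atTop 1] with n hn
  have : NeZero n := ⟨by omega⟩
  exact h (W.meanInput_mem (c n)) (W.reduced_rates_mem_rateRegion h₁₃ h₂₃ (c n))

end MADBChannel

end

theorem theorem14 {q : ℕ} [NeZero q] (hq : 2 ≤ q) {𝒴 : Type*} [Fintype 𝒴]
    (W : MADBChannel q 𝒴) (Pstar : ZMod q → ℝ) (hPstar : Pstar ∈ stdSimplex ℝ (ZMod q))
    (hi_max : ∀ x₂ x₃ : ZMod q, ∀ P ∈ stdSimplex ℝ (ZMod q),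
      channelInfo P (fun x₁ => W.mac x₁ x₂ x₃) ≤ channelInfo Pstar (fun x₁ => W.mac x₁ x₂ x₃))
    (hi_inv : ∀ x₃ x₂ x₂' : ZMod q,
      channelInfo Pstar (fun x₁ => W.mac x₁ x₂ x₃) =
        channelInfo Pstar (fun x₁ => W.mac x₁ x₂' x₃))
    (hii : ∀ P ∈ stdSimplex ℝ (ZMod q), ∀ x₁ x₃ x₁' x₃' : ZMod q,
      channelInfo P (fun x₂ => W.mac x₁ x₂ x₃) = channelInfo P (fun x₂ => W.mac x₁' x₂ x₃'))
    (hiii_inv : ∀ P ∈ stdSimplex ℝ (ZMod q × ZMod q), ∀ x₃ x₃' : ZMod q,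
      channelInfo P (fun x : ZMod q × ZMod q => W.mac x.1 x.2 x₃) =
        channelInfo P (fun x : ZMod q × ZMod q => W.mac x.1 x.2 x₃'))
    (hiii_dom : ∀ P ∈ stdSimplex ℝ (ZMod q × ZMod q), ∀ x₃ : ZMod q,
      channelInfo P (fun x : ZMod q × ZMod q => W.mac x.1 x.2 x₃) ≤
        channelInfo (fun x : ZMod q × ZMod q => Pstar x.1 * ∑ x₁, P (x₁, x.2))
          (fun x : ZMod q × ZMod q => W.mac x.1 x.2 x₃)) :
    W.innerBound = W.outerBound ∧ W.capacityRegion = W.innerBound ∧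
      W.capacityRegion = W.fixedFirstInputRegion Pstar := by
  -- The alphabet is an arbitrary finite type because the auxiliary variable of a code grows with
  -- the block length.
  have hsub : ∀ {𝒱 : Type} [Fintype 𝒱] {P : ZMod q × ZMod q × ZMod q × 𝒱 → ℝ},
      P ∈ stdSimplex ℝ (ZMod q × ZMod q × ZMod q × 𝒱) →
      W.rateRegion P ⊆ W.fixedFirstInputRegion Pstar := by
    intro 𝒱 _ P hP r hr
    obtain ⟨P₂, h₂, k, hk, P₃, h₃, h⟩ :=
      W.rateRegion_subset_of_symmetry hPstar hi_max hi_inv hii hiii_inv hiii_dom hP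
    exact subset_closure (subset_convexHull ℝ _ ⟨k, hk, P₂, h₂, P₃, h₃, h hr⟩)
  have hconv : Convex ℝ (W.fixedFirstInputRegion Pstar) := (convex_convexHull ℝ _).closure
  have hfixed_inner : W.fixedFirstInputRegion Pstar ⊆ W.innerBound := by
    refine closure_mono (convexHull_mono ?_)
    rintro r ⟨k, hk, P₂, h₂, P₃, h₃, hr⟩
    exact ⟨k, hk, Pstar, hPstar, P₂, h₂, P₃, h₃, hr⟩
  have hinner_outer : W.innerBound ⊆ W.outerBound := by
    refine closure_mono (convexHull_mono ?_)
    rintro r ⟨k, hk, P₁, h₁, P₂, h₂, P₃, h₃, hr⟩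
    exact ⟨k, hk, _, MADBChannel.productInput_mem h₁ h₂ h₃, hr⟩
  have houter_fixed : W.outerBound ⊆ W.fixedFirstInputRegion Pstar := by
    refine closure_minimal (convexHull_min ?_ hconv) isClosed_closure
    rintro r ⟨k, -, P, hP, hr⟩
    exact hsub hP hr
  have hfixed_capacity : W.fixedFirstInputRegion Pstar ⊆ W.capacityRegion := by
    refine closure_minimal (convexHull_min ?_ (convex_convexHull ℝ _).closure) isClosed_closure
    rintro r ⟨k, -, P₂, h₂, P₃, h₃, hr⟩
    exact W.rateRegion_productInput_subset_capacityRegion hPstar h₂ h₃ hr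
  -- Codes are compared with the `Pstar` region directly: `hsub` removes the joint dependence and
  -- cuts the alphabet at once, so `outerBound` is not an intermediate stage.
  have hcapacity_fixed : W.capacityRegion ⊆ W.fixedFirstInputRegion Pstar := by
    refine closure_minimal (convexHull_min ?_ hconv) isClosed_closure
    rintro ⟨R₁₃, R₂₃, R₃₁, R₃₂⟩ hR
    exact W.mem_of_achievable isClosed_closure hsub hR
  have hcapacity := hcapacity_fixed.antisymm hfixed_capacity
  have hinner := (hinner_outer.trans houter_fixed).antisymm hfixed_inner
  exact ⟨hinner_outer.antisymm (houter_fixed.trans hfixed_inner), hcapacity.trans hinner.symm,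
    hcapacity⟩
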